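/- **Setting.** For every security parameter $k$ fix a prime $p$, integers $m,n\ge 1$ with $p\mid n$, and put $q=p^m$; assume that $n$, $m$ and $\log p$ are bounded by a polynomial in $k$. Let $D_{2n}=\langle x,y: x^n=y^2=1,\ yxy^{-1}=x^{-1}\rangle$, $\sigma(c)=c^q$ on $\mathbb F_{q^2}$, and let $\theta:D_{2n}\to\mathrm{Aut}(\mathbb F_{q^2})$ be given by $\theta(x^i)=1$, $\theta(x^iy)=\sigma$. The skew group ring $R=\mathbb F_{q^2}^{\theta}D_{2n}$ has the multiplication $(a\,g)(b\,h)=a\,\theta(g)(b)\,gh$. Let $R_0$ and $R_1$ be the sets of elements supported on $\{x^i\}$ and on $\{x^iy\}$, let $\Gamma=\{\sum a_i x^iy: a_i=a_{n-i},\ 1\le i\le n-1\}\subseteq R_1$, and let $\widehat a=\sum_g\theta(g^{-1})(a_g)g^{-1}$. The public element is $h=h_1+h_2$ with $h_1\in R_0\setminus\{0\}$ and $h_2\in R_1\setminus\{0\}$ uniformly random. "Efficient" means probabilistic polynomial time in $k$ (for adversaries with oracles: whatever the answers are), and "negligible" means $o(k^{-c})$ for every $c$. **Protocol.** On input $(P_i,P_j,s)$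 the initiator $P_i$ chooses $(a_i,\gamma_i)$ uniformly in $R_0\times\Gamma$ and sends $(P_i,s,pk_i=a_ih\gamma_i)$. On receipt, $P_j$ chooses $(a_j,\gamma_j)$ uniformly in $R_0\times\Gamma$, sends $(P_j,s,pk_j=a_jh\gamma_j)$, outputs the key $a_j\,pk_i\,\widehat{\gamma_j}$ and erases $(a_j,\gamma_j)$. On receipt of the reply, $P_i$ outputs $a_i\,pk_j\,\widehat{\gamma_i}$ and erases $(a_i,\gamma_i)$. **DSDP assumption.** For independent uniform $(a_t,\gamma_t)\in R_0\times\Gamma$, $t=1,2,3$, put $pk_t=a_th\gamma_t$, $k_0=a_2\,pk_1\,\widehat{\gamma_2}$, $k_1=a_3h\gamma_3$. The advantage $\mathrm{DSDPadv}[D]$ is $|\Pr[W_0]-\Pr[W_1]|$, where $W_b$ is the event that $D$ outputs $1$ on input $h,pk_1,pk_2,k_b$ (and the parameters). The assumption: $\mathrm{DSDPadv}[D]$ is negligible for every efficient $D$. **Authenticated-links model.** There is a finite number (polynomial in $k$) of parties. The adversary is given $h$ and the parameters. It activates parties as initiators of sessions with other parties (a session-id is used only once by each party), receives all outgoing messages,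 and decides whether and when each is delivered, at most once and unmodified, to its destination; it may send arbitrary messages only on behalf of corrupted parties or of sessions whose state it has revealed (to their peer). It may reveal the state of an unexpired session (which then stops), reveal the key of a completed unexpired session, expire a completed session (its key is erased), and corrupt a party (it obtains all that the party's memory still holds, and the party stops). A session is exposed if its state or key is revealed, or if its owner is corrupted while it is unexpired. The partner of the session $s$ of $P_i$ with peer $P_j$ is the session $s$ of $P_j$ with peer $P_i$; the two match if the outgoing message of each is the incoming message of the other. A session is fresh if neither it nor its partner is exposed and, in case its peer is corrupted, it has a matching session. Once, the adversary may test a completed, unexpired, fresh session: for a random bit $b$ it receives the session key if $b=0$, and a random key $ah\gamma$ with $(a,\gamma)$ uniform in $R_0\times\Gamma$ if $b=1$; afterwards it must expose neither the test session nor its partner. Finally it outputs a guess for $b$, and $\mathrm{SKAdv}[A]=|\Pr[\text{the guess is correct}]-1/2|$. **Theorem.** (a) If the DSDP assumption holds, then the protocol is session-key secure in the authenticated-links model: (1) if two uncorrupted parties complete matching sessions, then they output the same key; (2) $\mathrm{SKAdv}[A]$ is negligible for every efficient adversary $A$. (b) Quantitatively, and without any assumption: for every efficient adversary $A$ and every polynomial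 $l$ such that $A$ invokes at most $l(k)$ sessions in any interaction, there is an efficient $D$ with $2\,\mathrm{SKAdv}[A](k)\le l(k)\cdot\mathrm{DSDPadv}[D](k)$ for all $k$. -/

import Mathlib

open scoped Polynomial

noncomputable section

namespace SkewDihedral

/-! ### Public parameters and the skew dihedral group ring -/

/-- Parameters of one instance: a prime `p`, exponents `m, n ≥ 1` with `p ∣ n`, `q = p ^ m`, the
field with `q ^ 2` elements, and an `𝔽_p`-basis of it, through which field elements are written as
strings of `p`-ary digits. -/
structure Params where
  p : ℕ
  m : ℕ
  n : ℕ
  prime : p.Prime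
  m_pos : 0 < m
  n_pos : 0 < n
  dvd : p ∣ n
  basis : letI : Fact p.Prime := ⟨prime⟩
    Module.Basis (Fin (2 * m)) (ZMod p) (GaloisField p (2 * m))

instance (P : Params) : Fact P.p.Prime := ⟨P.prime⟩

instance (P : Params) : NeZero P.n := ⟨P.n_pos.ne'⟩

/-- `q = p ^ m`. -/
def Params.q (P : Params) : ℕ := P.p ^ P.m

/-- The field `𝔽_{q²}`. -/
abbrev Params.K (P : Params) : Type := GaloisField P.p (2 * P.m)

instance (P : Params) : Fintype P.K := Fintype.ofFinite P.K

/-- The dihedral group of order `2n`. -/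
abbrev Params.G (P : Params) : Type := DihedralGroup P.n

theorem card_K (P : Params) : Nat.card P.K = P.q ^ 2 := by
  rw [GaloisField.card P.p (2 * P.m) (by have := P.m_pos; omega), Params.q, ← pow_mul, mul_comm]

theorem pow_q_q (P : Params) (a : P.K) : (a ^ P.q) ^ P.q = a := by
  rw [← pow_mul, ← pow_two, ← card_K, Nat.card_eq_fintype_card]
  exact FiniteField.pow_card a

/-- The automorphism `σ : a ↦ a ^ q` of `𝔽_{q²}`. -/
def sigma (P : Params) : RingAut P.K where
  toFun a := a ^ P.q
  invFun a := a ^ P.q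
  left_inv a := pow_q_q P a
  right_inv a := pow_q_q P a
  map_mul' a b := mul_pow a b P.q
  map_add' a b := add_pow_expChar_pow a b P.p P.m

theorem sigma_mul_sigma (P : Params) : sigma P * sigma P = 1 := by
  ext a
  exact pow_q_q P a

/-- The homomorphism `θ_σ`: rotations act trivially, reflections act by `σ`. -/
def theta (P : Params) : P.G →* RingAut P.K where
  toFun
    | .r _ => 1
    | .sr _ => sigma P
  map_one' := rfl
  map_mul' g h := by
    cases g <;> cases h <;> simp [sigma_mul_sigma]

instance (P : Params) : MulSemiringAction P.G P.K := MulSemiringAction.compHom P.K (theta P)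

/-- The skew dihedral group ring `𝔽_{q²}^θ D_{2n}`, with `(a g)(b h) = (a θ(g)(b)) g h`. -/
abbrev Params.R (P : Params) : Type := SkewMonoidAlgebra P.K P.G

instance (P : Params) : Finite P.R :=
  Finite.of_injective (fun a : P.R => (a.coeff : P.G → P.K))
    (DFunLike.coe_injective.comp SkewMonoidAlgebra.coeff_injective)

/-- The rotation `x` of the presentation `⟨x, y : xⁿ = y² = 1, y x y⁻¹ = x⁻¹⟩`. -/
def Params.x (P : Params) : P.G := DihedralGroup.r 1

/-- The reflection `y`. -/
def Params.y (P : Params) : P.G := DihedralGroup.sr 0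

/-- `𝔽_{q²}^θ C_n`: elements supported on the powers of `x`. -/
def FC (P : Params) : Set P.R := {a | ∀ i : ℕ, a.coeff (P.x ^ i * P.y) = 0}

/-- `𝔽_{q²}^θ C_n y`: elements supported on the `x ^ i * y`. -/
def FCy (P : Params) : Set P.R := {a | ∀ i : ℕ, a.coeff (P.x ^ i) = 0}

/-- The `θ`-reversible subspace `Γ_θ` of `𝔽_{q²}^θ C_n y`. -/
def Gam (P : Params) : Set P.R :=
  {a | a ∈ FCy P ∧
    ∀ i ∈ Finset.Icc 1 (P.n - 1), a.coeff (P.x ^ i * P.y) = a.coeff (P.x ^ (P.n - i) * P.y)}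

/-- The adjunct `â = ∑ θ(g⁻¹)(a_g) g⁻¹`. -/
def adj {P : Params} (a : P.R) : P.R :=
  a.sum fun g c => SkewMonoidAlgebra.single g⁻¹ (theta P g⁻¹ c)

theorem FC_diff_nonempty (P : Params) : (FC P \ {0}).Nonempty := by
  refine ⟨SkewMonoidAlgebra.single 1 1, fun i => ?_, ?_⟩
  · rw [SkewMonoidAlgebra.coeff_single, Finsupp.single_apply, if_neg]
    simp only [Params.x, Params.y, DihedralGroup.r_pow, DihedralGroup.r_mul_sr]
    exact fun h => by cases h
  · simp

theorem FCy_diff_nonempty (P : Params) : (FCy P \ {0}).Nonempty := by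
  refine ⟨SkewMonoidAlgebra.single P.y 1, fun i => ?_, ?_⟩
  · rw [SkewMonoidAlgebra.coeff_single, Finsupp.single_apply, if_neg]
    simp [Params.x, Params.y]
  · exact fun h => one_ne_zero (SkewMonoidAlgebra.single_eq_zero.1 h)

theorem FC_nonempty (P : Params) : (FC P).Nonempty := ⟨0, fun _ => rfl⟩

theorem Gam_nonempty (P : Params) : (Gam P).Nonempty := ⟨0, fun _ => rfl, fun _ _ => rfl⟩

/-- The uniform distribution on a nonempty set of ring elements. -/
def uniformOn {P : Params} (s : Set P.R) (hs : s.Nonempty) : PMF P.R :=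
  PMF.uniformOfFinset s.toFinite.toFinset ((Set.Finite.toFinset_nonempty _).2 hs)

/-- The public element `h = h₁ + h₂`. -/
def samplePublic (P : Params) : PMF P.R := do
  let h₁ ← uniformOn (FC P \ {0}) (FC_diff_nonempty P)
  let h₂ ← uniformOn (FCy P \ {0}) (FCy_diff_nonempty P)
  return h₁ + h₂

/-- A uniformly random secret pair `(a, γ)` in `𝔽_{q²}^θ C_n × Γ_θ`. -/
def sampleSecret (P : Params) : PMF (P.R × P.R) := do
  let a ← uniformOn (FC P) (FC_nonempty P)
  let γ ← uniformOn (Gam P) (Gam_nonempty P)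
  return (a, γ)

/-- The public key `a h γ`. -/
def pubKey {P : Params} (h : P.R) (sk : P.R × P.R) : P.R := sk.1 * h * sk.2

/-- The key `a pk γ̂` that the holder of `(a, γ)` computes from a received `pk`. -/
def sharedKey {P : Params} (sk : P.R × P.R) (pk : P.R) : P.R := sk.1 * pk * adj sk.2

/-! ### Probabilistic programs with a step count

Data are binary trees whose leaves are natural numbers or elements of the field. A program is a
fixed finite text that does not depend on the security parameter. Each instruction costs one step;
the field operations are those of `𝔽_{q²}`. Natural numbers have only addition and truncated
subtraction, so their length grows by at most one bit per step. Every loop is entered with a bound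
on the number of its iterations, and pays for each of them; since a probabilistic polynomial-time
machine can be simulated step by step for polynomially many steps, computed in advance, the
programs that run in polynomial time compute exactly what such machines compute. -/

/-- Data handled by programs. -/
inductive Val (K : Type) where
  | nat (k : ℕ)
  | fld (c : K)
  | pair (v w : Val K)

namespace Val

variable {K : Type}

def fst : Val K → Val K
  | pair v _ => v
  | _ => nat 0

def snd : Val K → Val K
  | pair _ w => w
  | _ => nat 0

def toNat : Val K → ℕ
  | nat k => k
  | _ => 0

def toFld [Zero K] : Val K → K
  | fld c => c
  | _ => 0

def toBool (v : Val K) : Bool := v.toNat != 0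

def ofBool (b : Bool) : Val K := nat b.toNat

/-- A list as a right-nested tree, terminated by `nat 0`. -/
def ofList : List (Val K) → Val K
  | [] => nat 0
  | v :: l => pair v (ofList l)

def ofOption {α : Type} (f : α → Val K) : Option α → Val K
  | none => nat 0
  | some a => pair (nat 1) (f a)

/-- The entry at position `i` of a list. -/
def get (v : Val K) (i : ℕ) : Val K := (snd^[i] v).fst

/-- The shape of a value: `0` for numbers, `1` for field elements, `2` for pairs. -/
def tag : Val K → ℕ
  | nat _ => 0
  | fld _ => 1
  | pair _ _ => 2

end Val

/-- The group element at position `i` of the coefficient array of a ring element: the first `n`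
positions are for `x ^ i`, the last `n` positions for `x ^ i * y`. -/
def Params.pos (P : Params) (i : ℕ) : P.G :=
  if i < P.n then P.x ^ i else P.x ^ (i - P.n) * P.y

/-- A ring element as the array of its `2n` coefficients. -/
def encR {P : Params} (a : P.R) : Val P.K :=
  Val.ofList ((List.range (2 * P.n)).map fun i => Val.fld (a.coeff (P.pos i)))

/-- The ring element that a value is read as. -/
def decR {P : Params} (v : Val P.K) : P.R :=
  ∑ i ∈ Finset.range (2 * P.n), SkewMonoidAlgebra.single (P.pos i) (v.get i).toFld

/-- Programs. They take one value to one value, may toss coins, and may call an oracle. -/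
inductive Prog where
  -- control and data
  | id
  | seq (f g : Prog)
  | pair (f g : Prog)
  | fst
  | snd
  | ite (c f g : Prog)
  | loop (f : Prog)
  | tag
  -- natural numbers
  | nat (k : ℕ)
  | add
  | sub
  | rand
  -- field elements
  | fcast
  | fadd
  | fsub
  | fmul
  | finv
  | fsigma
  | feq
  | frand
  | fbasis
  | fcoord
  -- oracle
  | call

/-- An oracle with state space `S`. -/
abbrev Oracle (P : Params) (S : Type) : Type := Val P.K → S → PMF (Val P.K × S)

/-- Iterate `f`, adding up the steps. -/
def iter {V S : Type} (f : V → S → PMF (V × S × ℕ)) : ℕ → V → S → PMF (V × S × ℕ)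
  | 0, v, s => PMF.pure (v, s, 1)
  | k + 1, v, s => do
    let (v₁, s₁, c₁) ← f v s
    let (v₂, s₂, c₂) ← iter f k v₁ s₁
    return (v₂, s₂, c₁ + c₂ + 1)

/-- The uniform distribution on `{0, …, k - 1}` (and `0` if `k = 0`). -/
def uniformBelow (k : ℕ) : PMF ℕ :=
  if h : 0 < k then
    PMF.uniformOfFinset (Finset.range k) (Finset.nonempty_range_iff.2 h.ne')
  else PMF.pure 0

/-- The `i`-th element of the basis, and `0` if there is none. -/
def Params.basisElt (P : Params) (i : ℕ) : P.K :=
  if h : i < 2 * P.m then P.basis ⟨i, h⟩ else 0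

/-- The `i`-th digit of a field element, a number below `p`. -/
def Params.coord (P : Params) (c : P.K) (i : ℕ) : ℕ :=
  if h : i < 2 * P.m then (P.basis.repr c ⟨i, h⟩ : ZMod P.p).val else 0

open Classical in
/-- Run a program with an oracle: the joint distribution of the output, the final state of the
oracle, and the number of steps. -/
def run (P : Params) {S : Type} (O : Oracle P S) :
    Prog → Val P.K → S → PMF (Val P.K × S × ℕ)
  | .id, v, s => PMF.pure (v, s, 1)
  | .seq f g, v, s => do
    let (v₁, s₁, c₁) ← run P O f v s
    let (v₂, s₂, c₂) ← run P O g v₁ s₁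
    return (v₂, s₂, c₁ + c₂ + 1)
  | .pair f g, v, s => do
    let (v₁, s₁, c₁) ← run P O f v s
    let (v₂, s₂, c₂) ← run P O g v s₁
    return (.pair v₁ v₂, s₂, c₁ + c₂ + 1)
  | .fst, v, s => PMF.pure (v.fst, s, 1)
  | .snd, v, s => PMF.pure (v.snd, s, 1)
  | .ite c f g, v, s => do
    let (v₁, s₁, c₁) ← run P O c v s
    let (v₂, s₂, c₂) ← if v₁.toBool then run P O f v s₁ else run P O g v s₁
    return (v₂, s₂, c₁ + c₂ + 1)
  | .loop f, v, s => iter (run P O f) v.fst.toNat v.snd s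
  | .tag, v, s => PMF.pure (.nat v.tag, s, 1)
  | .nat k, _, s => PMF.pure (.nat k, s, 1)
  | .add, v, s => PMF.pure (.nat (v.fst.toNat + v.snd.toNat), s, 1)
  | .sub, v, s => PMF.pure (.nat (v.fst.toNat - v.snd.toNat), s, 1)
  | .rand, v, s => do
    let k ← uniformBelow v.toNat
    return (.nat k, s, 1)
  | .fcast, v, s => PMF.pure (.fld (v.toNat : P.K), s, 1)
  | .fadd, v, s => PMF.pure (.fld (v.fst.toFld + v.snd.toFld), s, 1)
  | .fsub, v, s => PMF.pure (.fld (v.fst.toFld - v.snd.toFld), s, 1)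
  | .fmul, v, s => PMF.pure (.fld (v.fst.toFld * v.snd.toFld), s, 1)
  | .finv, v, s => PMF.pure (.fld (v.toFld)⁻¹, s, 1)
  | .fsigma, v, s => PMF.pure (.fld (sigma P v.toFld), s, 1)
  | .feq, v, s => PMF.pure (.ofBool (decide (v.fst.toFld = v.snd.toFld)), s, 1)
  | .frand, _, s => do
    let c ← PMF.uniformOfFintype P.K
    return (.fld c, s, 1)
  | .fbasis, v, s => PMF.pure (.fld (P.basisElt v.toNat), s, 1)
  | .fcoord, v, s => PMF.pure (.nat (P.coord v.fst.toFld v.snd.toNat), s, 1)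
  | .call, v, s => do
    let (v₁, s₁) ← O v s
    return (v₁, s₁, 1)

/-! ### Asymptotics -/

/-- A choice of the parameters for every security parameter, such that elements of the ring have
descriptions of polynomial length. -/
def PolySize (pp : ℕ → Params) : Prop :=
  ∃ T : ℕ[X], ∀ k, (pp k).n + (pp k).m + Nat.log 2 (pp k).p ≤ T.eval k

/-- The program runs in polynomially many steps on the given inputs for security parameter `k`,
whatever its oracle answers. -/
def PolyTime (pp : ℕ → Params) (A : Prog) (inputs : ∀ k, Set (Val (pp k).K)) : Prop :=
  ∃ T : ℕ[X], ∀ k, ∀ v ∈ inputs k, ∀ (S : Type) (O : Oracle (pp k) S) (s : S),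
    ∀ w ∈ (run (pp k) O A v s).support, w.2.2 ≤ T.eval k

/-- A function of the security parameter decreases faster than every inverse polynomial. -/
def Negligible (f : ℕ → ℝ) : Prop :=
  Asymptotics.SuperpolynomialDecay Filter.atTop (fun k : ℕ => (k : ℝ)) f

/-- The security parameter and the numerical parameters, as part of the input of an adversary. -/
def encParams (P : Params) (k : ℕ) : List (Val P.K) :=
  [.nat k, .nat P.p, .nat P.m, .nat P.n]

/-! ### The decisional skew dihedral product game -/

/-- The oracle of a program that has none. -/
def noOracle (P : Params) : Oracle P Unit := fun _ _ => PMF.pure (.nat 0, ())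

/-- The input of a DSDP adversary. -/
def dsdpInput (P : Params) (k : ℕ) (h pk₁ pk₂ key : P.R) : Val P.K :=
  .ofList (encParams P k ++ [encR h, encR pk₁, encR pk₂, encR key])

/-- The output bit of the adversary in Experiment `b` (`false` is `0`, `true` is `1`). -/
def dsdpExp (P : Params) (k : ℕ) (D : Prog) (b : Bool) : PMF Bool := do
  let h ← samplePublic P
  let sk₁ ← sampleSecret P
  let sk₂ ← sampleSecret P
  let sk₃ ← sampleSecret P
  let pk₁ := pubKey h sk₁
  let pk₂ := pubKey h sk₂
  let key := if b then pubKey h sk₃ else sharedKey sk₂ pk₁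
  let (out, _, _) ← run P (noOracle P) D (dsdpInput P k h pk₁ pk₂ key) ()
  return out.toBool

/-- `DSDPadv[D]`, as a function of the security parameter. -/
def dsdpAdv (pp : ℕ → Params) (D : Prog) (k : ℕ) : ℝ :=
  |(dsdpExp (pp k) k D false true).toReal - (dsdpExp (pp k) k D true true).toReal|

/-- An efficient DSDP adversary. -/
def EfficientDSDP (pp : ℕ → Params) (D : Prog) : Prop :=
  PolyTime pp D fun k => {v | ∃ h pk₁ pk₂ key, v = dsdpInput (pp k) k h pk₁ pk₂ key}

/-- The DSDP assumption. -/
def DSDPAssumption (pp : ℕ → Params) : Prop :=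
  ∀ D, EfficientDSDP pp D → Negligible (dsdpAdv pp D)

/-! ### The authenticated-links model

Parties are numbered `0, …, N - 1`. A session is identified by its owner and its session-id, which
a party uses only once. Each session sends one message `(owner, sid, sent)`, to its peer. -/

/-- The record of a session. -/
structure Session (P : Params) where
  owner : ℕ
  peer : ℕ
  sid : ℕ
  /-- whether the session was invoked as initiator -/
  initiator : Bool
  /-- the secret pair, until it is erased -/
  secret : Option (P.R × P.R)
  /-- the outgoing public key -/
  sent : P.R
  /-- whether the outgoing message has been delivered -/
  delivered : Bool := false
  /-- the incoming public key -/
  received : Option P.R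
  /-- the key that was output; a session is complete if there is one -/
  output : Option P.R
  /-- the key has been erased from the memory of the owner -/
  expired : Bool := false
  /-- the state was revealed, so that the session produces no further output -/
  stopped : Bool := false
  /-- the state or the key was revealed, or the owner was corrupted while the session was
  unexpired -/
  exposed : Bool := false

/-- State of the interaction. -/
structure Game (P : Params) where
  sessions : List (Session P)
  corrupted : Finset ℕ
  /-- owner and session-id of the test session -/
  test : Option (ℕ × ℕ)

def Game.init (P : Params) : Game P := ⟨[], ∅, none⟩

variable {P : Params}

/-- The session of party `i` with session-id `s`. -/
def Game.find (g : Game P) (i s : ℕ) : Option (Session P) :=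
  g.sessions.find? fun t => t.owner == i && t.sid == s

/-- Add a session. -/
def Game.push (g : Game P) (t : Session P) : Game P := { g with sessions := g.sessions ++ [t] }

/-- Modify the session of party `i` with session-id `s`. -/
def Game.modify (g : Game P) (i s : ℕ) (f : Session P → Session P) : Game P :=
  { g with sessions := g.sessions.map fun t => if t.owner == i && t.sid == s then f t else t }

/-- The two sessions run between the same two parties under the same session-id. -/
def Session.Partner (t u : Session P) : Prop :=
  t.owner = u.peer ∧ t.peer = u.owner ∧ t.sid = u.sid

/-- Matching sessions: the outgoing message of each is the incoming message of the other. -/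
def Session.Matching (t u : Session P) : Prop :=
  t.Partner u ∧ t.received = some u.sent ∧ u.received = some t.sent

/-- A session is fresh if neither it nor its partner is exposed; if its peer is corrupted, it must
moreover have a matching session (which was then expired before the corruption). -/
def Game.Fresh (g : Game P) (t : Session P) : Prop :=
  t.exposed = false ∧ (∀ u ∈ g.sessions, t.Partner u → u.exposed = false) ∧
    (t.peer ∈ g.corrupted → ∃ u ∈ g.sessions, t.Matching u)

/-- The session is the test session or its partner, and must no longer be exposed. -/
def Game.Protected (g : Game P) (u : Session P) : Prop :=
  ∃ t ∈ g.sessions, g.test = some (t.owner, t.sid) ∧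
    ((u.owner = t.owner ∧ u.sid = t.sid) ∨ t.Partner u)

/-- What the memory of the owner contains about a session, beyond the messages, which the adversary
has seen. -/
def Session.contents (t : Session P) : Val P.K :=
  .ofList [.nat t.peer, .nat t.sid,
    .ofOption (fun sk => .pair (encR sk.1) (encR sk.2)) t.secret, .ofOption encR t.output]

/-- The queries of the adversary. -/
inductive Query (P : Params) where
  /-- activate party `i` as initiator of session `s` with party `j` -/
  | establish (i j s : ℕ)
  /-- forward the message of session `s` of party `i` to its destination -/
  | deliver (i s : ℕ)
  /-- send `(i, s, z)` to `j` on behalf of a corrupted party or session -/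
  | inject (i j s : ℕ) (z : P.R)
  | stateReveal (i s : ℕ)
  | keyReveal (i s : ℕ)
  /-- end the life of a completed session: its key is erased -/
  | expire (i s : ℕ)
  | corrupt (i : ℕ)
  | test (i s : ℕ)

/-- A query is submitted as a list `[kind, i, s, j, z]`. -/
def decQuery (v : Val P.K) : Query P :=
  let i := (v.get 1).toNat
  let s := (v.get 2).toNat
  let j := (v.get 3).toNat
  match (v.get 0).toNat with
  | 0 => .establish i j s
  | 1 => .deliver i s
  | 2 => .inject i j s (decR (v.get 4))
  | 3 => .stateReveal i s
  | 4 => .keyReveal i s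
  | 5 => .expire i s
  | 6 => .corrupt i
  | _ => .test i s

/-- The answer to a query that is not admissible. -/
def refuse (g : Game P) : PMF (Val P.K × Game P) := PMF.pure (.nat 0, g)

/-- Party `j` receives the message `(i, s, z)`. If it waits for it as initiator, it computes its key
and erases its secret pair; if it has no session `s`, it runs the responder. The adversary is
given the outgoing message of the responder. -/
def receive (h : P.R) (g : Game P) (i j s : ℕ) (z : P.R) : PMF (Val P.K × Game P) :=
  if j ∈ g.corrupted then refuse g else
  match g.find j s with
  | none => do
    let sk ← sampleSecret P
    return (.pair (.nat 1) (encR (pubKey h sk)), g.push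
      { owner := j, peer := i, sid := s, initiator := false, secret := none,
        sent := pubKey h sk, received := some z, output := some (sharedKey sk z) })
  | some t =>
    match t.secret with
    | none => refuse g
    | some sk =>
      if t.peer = i ∧ t.stopped = false then
        PMF.pure (.nat 1, g.modify j s fun t =>
          { t with secret := none, received := some z, output := some (sharedKey sk z) })
      else refuse g

open Classical in
/-- The answer of the authenticated-links model with `N` parties, public element `h` and test bit
`b` to a query. -/
def answer (N : ℕ) (h : P.R) (b : Bool) (g : Game P) : Query P → PMF (Val P.K × Game P)
  | .establish i j s =>
    if i < N ∧ j < N ∧ i ≠ j ∧ i ∉ g.corrupted ∧ g.find i s = none then do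
      let sk ← sampleSecret P
      return (.pair (.nat 1) (encR (pubKey h sk)), g.push
        { owner := i, peer := j, sid := s, initiator := true, secret := some sk,
          sent := pubKey h sk, received := none, output := none })
    else refuse g
  | .deliver i s =>
    match g.find i s with
    | none => refuse g
    | some t =>
      if t.delivered then refuse g
      else receive h (g.modify i s fun t => { t with delivered := true }) i t.peer s t.sent
  | .inject i j s z =>
    if i < N ∧ j < N ∧ i ≠ j ∧
        (i ∈ g.corrupted ∨ ∃ t, g.find i s = some t ∧ t.stopped = true ∧ t.peer = j) then
      receive h g i j s z
    else refuse g
  | .stateReveal i s =>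
    match g.find i s with
    | none => refuse g
    | some t =>
      if t.expired = false ∧ ¬ g.Protected t then
        PMF.pure (t.contents, g.modify i s fun t => { t with stopped := true, exposed := true })
      else refuse g
  | .keyReveal i s =>
    match g.find i s with
    | none => refuse g
    | some t =>
      match t.output with
      | none => refuse g
      | some key =>
        if t.expired = false ∧ ¬ g.Protected t then
          PMF.pure (encR key, g.modify i s fun t => { t with exposed := true })
        else refuse g
  | .expire i s =>
    match g.find i s with
    | none => refuse g
    | some t =>
      if t.output.isSome then
        PMF.pure (.nat 1, g.modify i s fun t => { t with expired := true })
      else refuse g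
  | .corrupt i =>
    if i < N ∧ i ∉ g.corrupted ∧
        ∀ t ∈ g.sessions, t.owner = i → g.Protected t → t.expired = true then
      PMF.pure
        (.ofList ((g.sessions.filter fun t => t.owner == i && !t.expired).map Session.contents),
          { g with
            corrupted := insert i g.corrupted
            sessions := g.sessions.map fun t =>
              if t.owner == i && !t.expired then { t with exposed := true } else t })
    else refuse g
  | .test i s =>
    match g.find i s with
    | none => refuse g
    | some t =>
      match t.output with
      | none => refuse g
      | some key =>
        if g.test = none ∧ t.expired = false ∧ g.Fresh t then do
          let sk ← sampleSecret P
          return (encR (if b then pubKey h sk else key), { g with test := some (i, s) })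
        else refuse g

/-- The authenticated-links model as an oracle. -/
def amOracle (N : ℕ) (h : P.R) (b : Bool) : Oracle P (Game P) :=
  fun v g => answer N h b g (decQuery v)

/-- The states that an adversary can bring about. -/
inductive Reachable (N : ℕ) (h : P.R) (b : Bool) : Game P → Prop
  | init : Reachable N h b (Game.init P)
  | step {g g' : Game P} {Q : Query P} {v : Val P.K} : Reachable N h b g →
      (v, g') ∈ (answer N h b g Q).support → Reachable N h b g'

/-- The input of an adversary in the authenticated-links model. -/
def amInput (P : Params) (k N : ℕ) (h : P.R) : Val P.K :=
  .ofList (encParams P k ++ [.nat N, encR h])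

/-- An interaction of the adversary `A` in the authenticated-links model. -/
def amRun (P : Params) (k N : ℕ) (A : Prog) (h : P.R) (b : Bool) :
    PMF (Val P.K × Game P × ℕ) :=
  run P (amOracle N h b) A (amInput P k N h) (Game.init P)

/-- Whether the adversary guesses the bit of the test oracle. -/
def skGame (P : Params) (k N : ℕ) (A : Prog) : PMF Bool := do
  let h ← samplePublic P
  let b ← PMF.uniformOfFintype Bool
  let (out, _, _) ← amRun P k N A h b
  return out.toBool == b

/-- `SKAdv[A]`, as a function of the security parameter. -/
def skAdv (pp : ℕ → Params) (N : ℕ[X]) (A : Prog) (k : ℕ) : ℝ :=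
  |(skGame (pp k) k (N.eval k) A true).toReal - 1 / 2|

/-- An efficient adversary in the authenticated-links model. -/
def EfficientAM (pp : ℕ → Params) (N : ℕ[X]) (A : Prog) : Prop :=
  PolyTime pp A fun k => {v | ∃ h, v = amInput (pp k) k (N.eval k) h}

/-- In every interaction, the adversary invokes at most `l k` sessions. -/
def SessionBound (pp : ℕ → Params) (N : ℕ[X]) (A : Prog) (l : ℕ[X]) : Prop :=
  ∀ k, ∀ h ∈ (samplePublic (pp k)).support, ∀ b,
    ∀ w ∈ (amRun (pp k) k (N.eval k) A h b).support,
      (w.2.1.sessions.filter fun t => t.initiator).length ≤ l.eval k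

/-- Two uncorrupted parties that complete matching sessions output the same key. -/
def MatchingKeysAgree (P : Params) (N : ℕ) : Prop :=
  ∀ h ∈ (samplePublic P).support, ∀ b, ∀ g : Game P, Reachable N h b g →
    ∀ t ∈ g.sessions, ∀ u ∈ g.sessions,
      t.owner ∉ g.corrupted → u.owner ∉ g.corrupted → t.Matching u →
      t.output.isSome → u.output.isSome → t.output = u.output

/-- Session-key security in the authenticated-links model. -/
def SessionKeySecure (pp : ℕ → Params) (N : ℕ[X]) : Prop :=
  (∀ k, MatchingKeysAgree (pp k) (N.eval k)) ∧
    ∀ A, EfficientAM pp N A → Negligible (skAdv pp N A)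

end SkewDihedral

end

/-!
The theorem is a reduction with a guess. Every completed test session that is fresh has a partner,
and one of the two was activated as an initiator. The DSDP adversary `D` therefore draws `r` below
the bound `l k` on the number of initiators, and runs the adversary `A` in a simulation in which
the `r`-th initiator sends `pk₁`, its partner sends `pk₂`, and the test is answered with the key
that `D` was given. At the end `D` outputs `1` if `A` does and the guess was right (`Hit`): there
was a test, the test session is the `r`-th initiator or its partner, neither of the two was
exposed, and the two did not already occur among earlier initiators.

*The simulation is perfect as long as the guess has not failed* (`interp_sim`). The secrets of the
two guessed sessions and of the random key can be drawn in advance (`interp_amOracle_eager`). The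
simulation and the model then give the same answers while their states differ only in the secrets
and keys of the two guessed sessions, which the adversary sees only by exposing one of them; a
failed guess stays failed, and makes the output `0` (`interp_couple`). The answer to the test is
right because `sharedKey sk₁ (pubKey h sk₂) = sharedKey sk₂ (pubKey h sk₁)`
(`sharedKey_pubKey`), which is also what makes matching sessions agree (`matchingKeysAgree`).

*The advantages.* If there is a test, exactly one `r` is a hit (`exists_hit`), so that summing over
`r` the probability that `A` outputs `1` and `r` is a hit gives the probability that `A` outputs `1`
after a test; without a test, the test bit has no influence (`noTest_indep`). This yields even an
equality in the quantitative statement (`two_skAdv_eq`). The qualitative one follows, since the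
number of sessions is at most the number of steps of `A`.

*The reduction is a program.* A run of a program is unfolded into an interaction tree (`Tree`,
`run_eq_interp`), and everything about oracles is proved by induction on trees. That `D` is an
efficient program is shown with a class `RC` of randomized functions computed by programs in a
number of steps that is polynomial in a given bound `M`; all loops of such programs are cut off
after `M` rounds, so that the bound on the number of steps holds for all inputs, and closure of the
class under composition, case distinction, loops and operations on lists turns the description of
the simulation on encoded states into a proof of efficiency (`RC.reduceV`). That this description is
correct is a refinement between states of the model and their encodings (`Rep`, `genStepV_enc`). The
adversary itself is run inside the reduction by induction on its program text (`simRun`); as it is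
efficient for every oracle, its loops are not affected by the cut-off (`simRun_eq`).
-/

noncomputable section

namespace SkewDihedral

/-! ### Distributions -/

theorem pmf_bind_eq {α β : Type} (p : PMF α) (f : α → PMF β) : (p >>= f) = p.bind f := rfl

theorem pmf_pure_eq {α : Type} (a : α) : (pure a : PMF α) = PMF.pure a := rfl

theorem bind_congr_support {α β : Type} {p : PMF α} {f g : α → PMF β}
    (h : ∀ a ∈ p.support, f a = g a) : p.bind f = p.bind g := by
  ext b
  rw [PMF.bind_apply, PMF.bind_apply]
  refine tsum_congr fun a => ?_
  by_cases ha : a ∈ p.support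
  · rw [h a ha]
  · rw [(p.apply_eq_zero_iff a).2 ha, zero_mul, zero_mul]

/-! ### Programs as interaction trees -/

/-- An interaction tree: what remains of a program once its input is fixed and only the sampled
values and the answers of the oracle are still open. A leaf carries the output and the number of
steps. -/
inductive Tree (K : Type) where
  | ret (v : Val K) (c : ℕ)
  | samp (d : PMF (Val K)) (k : Val K → Tree K)
  | call (q : Val K) (k : Val K → Tree K)

/-- Continue an interaction tree at its leaves. -/
def Tree.bind {K : Type} : Tree K → (Val K → ℕ → Tree K) → Tree K
  | .ret v c, f => f v c
  | .samp d k, f => .samp d fun v => (k v).bind f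
  | .call q k, f => .call q fun v => (k v).bind f

/-- The tree of an iterated program. -/
def iterTree {K : Type} (f : Val K → Tree K) : ℕ → Val K → Tree K
  | 0, v => .ret v 1
  | k + 1, v => (f v).bind fun v₁ c₁ => (iterTree f k v₁).bind fun v₂ c₂ => .ret v₂ (c₁ + c₂ + 1)

open Classical in
/-- The interaction tree of a program on an input. -/
def tree (P : Params) : Prog → Val P.K → Tree P.K
  | .id, v => .ret v 1
  | .seq f g, v => (tree P f v).bind fun v₁ c₁ => (tree P g v₁).bind fun v₂ c₂ =>
      .ret v₂ (c₁ + c₂ + 1)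
  | .pair f g, v => (tree P f v).bind fun v₁ c₁ => (tree P g v).bind fun v₂ c₂ =>
      .ret (.pair v₁ v₂) (c₁ + c₂ + 1)
  | .fst, v => .ret v.fst 1
  | .snd, v => .ret v.snd 1
  | .ite c f g, v => (tree P c v).bind fun v₁ c₁ =>
      (if v₁.toBool then tree P f v else tree P g v).bind fun v₂ c₂ => .ret v₂ (c₁ + c₂ + 1)
  | .loop f, v => iterTree (tree P f) v.fst.toNat v.snd
  | .tag, v => .ret (.nat v.tag) 1
  | .nat k, _ => .ret (.nat k) 1
  | .add, v => .ret (.nat (v.fst.toNat + v.snd.toNat)) 1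
  | .sub, v => .ret (.nat (v.fst.toNat - v.snd.toNat)) 1
  | .rand, v => .samp ((uniformBelow v.toNat).map .nat) fun x => .ret x 1
  | .fcast, v => .ret (.fld (v.toNat : P.K)) 1
  | .fadd, v => .ret (.fld (v.fst.toFld + v.snd.toFld)) 1
  | .fsub, v => .ret (.fld (v.fst.toFld - v.snd.toFld)) 1
  | .fmul, v => .ret (.fld (v.fst.toFld * v.snd.toFld)) 1
  | .finv, v => .ret (.fld (v.toFld)⁻¹) 1
  | .fsigma, v => .ret (.fld (sigma P v.toFld)) 1
  | .feq, v => .ret (.ofBool (decide (v.fst.toFld = v.snd.toFld))) 1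
  | .frand, _ => .samp ((PMF.uniformOfFintype P.K).map .fld) fun x => .ret x 1
  | .fbasis, v => .ret (.fld (P.basisElt v.toNat)) 1
  | .fcoord, v => .ret (.nat (P.coord v.fst.toFld v.snd.toNat)) 1
  | .call, v => .call v fun x => .ret x 1

/-- Run an interaction tree with an oracle. -/
def interp {P : Params} {S : Type} (O : Oracle P S) : Tree P.K → S → PMF (Val P.K × S × ℕ)
  | .ret v c, s => PMF.pure (v, s, c)
  | .samp d k, s => d.bind fun v => interp O (k v) s
  | .call q k, s => (O q s).bind fun r => interp O (k r.1) r.2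

section Interp

variable {P : Params} {S : Type}

theorem interp_bind (O : Oracle P S) (t : Tree P.K) (f : Val P.K → ℕ → Tree P.K) (s : S) :
    interp O (t.bind f) s = (interp O t s).bind fun w => interp O (f w.1 w.2.2) w.2.1 := by
  induction t generalizing s with
  | ret v c => simp [Tree.bind, interp]
  | samp d k ih => simp [Tree.bind, interp, ih]
  | call q k ih => simp [Tree.bind, interp, ih]

theorem iter_eq_interp (O : Oracle P S) (f : Val P.K → S → PMF (Val P.K × S × ℕ))
    (t : Val P.K → Tree P.K) (h : ∀ v s, f v s = interp O (t v) s) (k : ℕ) (v : Val P.K) (s : S) :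
    iter f k v s = interp O (iterTree t k v) s := by
  induction k generalizing v s with
  | zero => rfl
  | succ k ih =>
    rw [iterTree, interp_bind, iter, h]
    simp only [interp_bind, pmf_bind_eq, pmf_pure_eq, ih, interp]

/-- Running a program amounts to running its interaction tree, so that facts about oracles can be
proved by induction on trees. -/
theorem run_eq_interp (O : Oracle P S) (A : Prog) (v : Val P.K) (s : S) :
    run P O A v s = interp O (tree P A v) s := by
  induction A generalizing v s with
  | seq f g hf hg | pair f g hf hg =>
    simp only [run, tree, interp_bind, pmf_bind_eq, pmf_pure_eq, interp, hf, hg]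
  | ite c f g hc hf hg =>
    simp only [run, tree, interp_bind, pmf_bind_eq, pmf_pure_eq, interp, hc, hf, hg]
    congr 1; funext w
    split_ifs <;> rfl
  | loop f hf => exact iter_eq_interp O _ _ hf _ _ _
  | rand =>
    simp only [run, tree, interp, PMF.bind_map]; rfl
  | frand =>
    simp only [run, tree, interp, PMF.bind_map]; rfl
  | _ => simp [run, tree, interp, pmf_bind_eq, pmf_pure_eq]

/-! ### The number of oracle calls -/

/-- At every leaf, the calls made on the way, counted from `j`, are at most the steps recorded
there, counted from `e`. -/
def Tree.CallsLe {K : Type} : Tree K → ℕ → ℕ → Prop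
  | .ret _ c, j, e => j ≤ c + e
  | .samp _ k, j, e => ∀ v, (k v).CallsLe j e
  | .call _ k, j, e => ∀ v, (k v).CallsLe (j + 1) e

/-- There are at most `B` calls on every path of the tree that has positive probability. -/
def Tree.Bounded {K : Type} : Tree K → ℕ → Prop
  | .ret _ _, _ => True
  | .samp d k, B => ∀ v ∈ d.support, (k v).Bounded B
  | .call _ k, B => 0 < B ∧ ∀ v, (k v).Bounded (B - 1)

theorem Tree.CallsLe.shift {K : Type} {t : Tree K} {j e : ℕ} (h : t.CallsLe j e) (i i' : ℕ)
    (hi : i ≤ i') : t.CallsLe (j + i) (e + i') := by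
  induction t generalizing j with
  | ret v c => simp only [Tree.CallsLe] at *; omega
  | samp d k ih => exact fun v => ih v (h v)
  | call q k ih => exact fun v => by have := ih v (h v); rwa [add_right_comm] at this

theorem Tree.CallsLe.bind {K : Type} {t : Tree K} {j e : ℕ} (h : t.CallsLe j e)
    {f : Val K → ℕ → Tree K} (hf : ∀ v c j', j' ≤ c + e → (f v c).CallsLe j' e) :
    (t.bind f).CallsLe j e := by
  induction t generalizing j with
  | ret v c => exact hf _ _ _ h
  | samp d k ih => exact fun v => ih v (h v)
  | call q k ih => exact fun v => ih v (h v)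

theorem Tree.CallsLe.bind₂ {K : Type} {t : Tree K} (h : t.CallsLe 0 0)
    {f : Val K → Tree K} (hf : ∀ v, (f v).CallsLe 0 0) (g : Val K → Val K → Val K) :
    (t.bind fun v₁ c₁ => (f v₁).bind fun v₂ c₂ => .ret (g v₁ v₂) (c₁ + c₂ + 1)).CallsLe 0 0 := by
  refine h.bind fun v c j hj => ?_
  have h1 := (hf v).shift j j le_rfl
  rw [zero_add] at h1
  have key : ∀ (t : Tree K) (i : ℕ), t.CallsLe i j →
      (t.bind fun v₂ c₂ => .ret (g v v₂) (c + c₂ + 1)).CallsLe i 0 := by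
    intro t
    induction t with
    | ret v c => intro i hi; simp only [Tree.CallsLe, Tree.bind] at *; omega
    | samp d k ih => exact fun i hi v => ih v i (hi v)
    | call q k ih => exact fun i hi v => ih v _ (hi v)
  exact key _ _ h1

theorem tree_callsLe (A : Prog) (v : Val P.K) : (tree P A v).CallsLe 0 0 := by
  induction A generalizing v with
  | seq f g hf hg => exact (hf v).bind₂ hg fun _ w => w
  | pair f g hf hg => exact (hf v).bind₂ (fun _ => hg v) fun v w => .pair v w
  | ite c f g hc hf hg =>
    refine (hc v).bind₂ (fun w => ?_) fun _ w => w
    split_ifs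
    exacts [hf v, hg v]
  | loop f hf =>
    rw [tree]
    generalize v.fst.toNat = n
    generalize v.snd = w
    induction n generalizing w with
    | zero => exact Nat.zero_le _
    | succ n ih => exact (hf w).bind₂ ih fun _ w => w
  | _ => simp [tree, Tree.CallsLe]

theorem Tree.CallsLe.le_cost {t : Tree P.K} {j : ℕ} (h : t.CallsLe j 0) (O : Oracle P S) (s : S)
    {w : Val P.K × S × ℕ} (hw : w ∈ (interp O t s).support) : j ≤ w.2.2 := by
  induction t generalizing s j with
  | ret v c =>
    rw [interp, PMF.mem_support_pure_iff] at hw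
    subst hw; exact h
  | samp d k ih =>
    obtain ⟨v, -, hv⟩ := (PMF.mem_support_bind_iff _ _ _).1 hw
    exact ih v (h v) s hv
  | call q k ih =>
    obtain ⟨r, -, hr⟩ := (PMF.mem_support_bind_iff _ _ _).1 hw
    exact (Nat.le_succ j).trans (ih _ (h _) _ hr)

/-- The oracle that answers with the items of a list, given in advance. -/
def listOracle (P : Params) : Oracle P (List (Val P.K)) :=
  fun _ s => PMF.pure (s.headD (.nat 0), s.tail)

/-- A step bound that holds whatever the oracle answers bounds the number of calls on every path:
each path is taken with an oracle whose answers are fixed in advance. -/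
theorem Tree.CallsLe.bounded {t : Tree P.K} {j T : ℕ} (h : t.CallsLe j 0)
    (hT : ∀ s, ∀ w ∈ (interp (listOracle P) t s).support, w.2.2 ≤ T) : t.Bounded (T - j) := by
  induction t generalizing j with
  | ret v c => trivial
  | samp d k ih =>
    exact fun v hv => ih v (h v) fun s w hw =>
      hT s w ((PMF.mem_support_bind_iff _ _ _).2 ⟨v, hv, hw⟩)
  | call q k ih =>
    have hk : ∀ v s, ∀ w ∈ (interp (listOracle P) (k v) s).support, w.2.2 ≤ T := by
      intro v s w hw
      refine hT (v :: s) w ?_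
      simpa [interp, listOracle] using hw
    constructor
    · obtain ⟨w, hw⟩ := (interp (listOracle P) (k (.nat 0)) []).support_nonempty
      have h1 := (h (.nat 0)).le_cost _ _ hw
      have h2 := hk _ _ w hw
      omega
    · intro v
      have := ih v (h v) (hk v)
      rwa [Nat.sub_sub]

end Interp

/-! ### Computable functions with structural cost bounds -/

/-- The program calls no oracle on the input `u`, its output has distribution `d`, and it takes at
most `C` steps. -/
def Evals (P : Params) (prog : Prog) (u : Val P.K) (d : PMF (Val P.K)) (C : ℕ) : Prop :=
  ∀ (S : Type) (O : Oracle P S) (s : S),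
    (run P O prog u s).map (fun w => (w.1, w.2.1)) = d.map (fun x => (x, s)) ∧
      ∀ w ∈ (run P O prog u s).support, w.2.2 ≤ C

/-- The randomized function `f` is computed by a program that takes a number `M` together with its
argument, in a number of steps bounded by a polynomial in `M` alone. All loops of such programs are
cut off after `M` rounds, so that the bound holds for every argument. As a class, it is established
for composite functions by instance search. -/
class RC (f : ∀ P : Params, ℕ → Val P.K → PMF (Val P.K)) : Prop where
  exists_prog :
    ∃ (prog : Prog) (T : ℕ[X]), ∀ P M v, Evals P prog (.pair (.nat M) v) (f P M v) (T.eval M)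

/-- The deterministic case of `RC`. -/
abbrev DC (f : ∀ P : Params, ℕ → Val P.K → Val P.K) : Prop := RC fun P M v => PMF.pure (f P M v)

/-- `DC` for functions with values in the natural numbers. -/
abbrev NC (f : ∀ P : Params, ℕ → Val P.K → ℕ) : Prop := DC fun P M v => .nat (f P M v)

/-- `DC` for functions with Boolean values. -/
abbrev BC (f : ∀ P : Params, ℕ → Val P.K → Bool) : Prop := DC fun P M v => .ofBool (f P M v)

/-- `DC` for functions with values in the field. -/
abbrev KC (f : ∀ P : Params, ℕ → Val P.K → P.K) : Prop := DC fun P M v => .fld (f P M v)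

namespace Evals

variable {P : Params} {f g : Prog} {u : Val P.K} {d : PMF (Val P.K)} {C C' : ℕ}

theorem mem_support (h : Evals P f u d C) {S : Type} {O : Oracle P S} {s : S}
    {w : Val P.K × S × ℕ} (hw : w ∈ (run P O f u s).support) : w.1 ∈ d.support ∧ w.2.1 = s := by
  have : (w.1, w.2.1) ∈ (d.map fun x => (x, s)).support := by
    rw [← (h S O s).1]
    exact (PMF.mem_support_map_iff _ _ _).2 ⟨w, hw, rfl⟩
  obtain ⟨x, hx, hxe⟩ := (PMF.mem_support_map_iff _ _ _).1 this
  rw [Prod.mk.injEq] at hxe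
  exact ⟨hxe.1 ▸ hx, hxe.2.symm⟩

/-- What follows a program that calls no oracle sees only its output. -/
theorem bind_run {α : Type} (h : Evals P f u d C) {S : Type} (O : Oracle P S) (s : S)
    (F : Val P.K → PMF α) : ((run P O f u s).bind fun w => F w.1) = d.bind F := by
  have := congrArg (fun p => p.bind fun x : Val P.K × S => F x.1) (h S O s).1
  simpa [PMF.bind_map, Function.comp_def] using this

theorem mono (h : Evals P f u d C) (hC : C ≤ C') : Evals P f u d C' :=
  fun S O s => ⟨(h S O s).1, fun w hw => ((h S O s).2 w hw).trans hC⟩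

theorem seq {e : Val P.K → PMF (Val P.K)} (hf : Evals P f u d C)
    (hg : ∀ v ∈ d.support, Evals P g v (e v) C') :
    Evals P (.seq f g) u (d.bind e) (C + C' + 1) := by
  intro S O s
  constructor
  · simp only [run, pmf_bind_eq, pmf_pure_eq, PMF.map_bind, PMF.pure_map]
    rw [← hf.bind_run O s]
    refine bind_congr_support fun w hw => ?_
    obtain ⟨h1, h2⟩ := hf.mem_support hw
    rw [h2, ← (hg _ h1 S O s).1]
    rfl
  · intro w hw
    simp only [run, pmf_bind_eq, pmf_pure_eq, PMF.mem_support_bind_iff,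
      PMF.mem_support_pure_iff] at hw
    obtain ⟨w₁, hw₁, w₂, hw₂, rfl⟩ := hw
    have h1 := (hf S O s).2 _ hw₁
    have h2 := (hg _ (hf.mem_support hw₁).1 S O _).2 _ hw₂
    change w₁.2.2 + w₂.2.2 + 1 ≤ _
    omega

theorem pair {e : PMF (Val P.K)} (hf : Evals P f u d C) (hg : Evals P g u e C') :
    Evals P (.pair f g) u (d.bind fun x => e.map (.pair x)) (C + C' + 1) := by
  intro S O s
  constructor
  · simp only [run, pmf_bind_eq, pmf_pure_eq, PMF.map_bind, PMF.pure_map]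
    rw [← hf.bind_run O s]
    refine bind_congr_support fun w hw => ?_
    obtain ⟨h1, h2⟩ := hf.mem_support hw
    rw [h2, PMF.map_comp, ← PMF.bind_pure_comp, ← hg.bind_run O s]
    refine bind_congr_support fun w' hw' => ?_
    rw [(hg.mem_support hw').2]; rfl
  · intro w hw
    simp only [run, pmf_bind_eq, pmf_pure_eq, PMF.mem_support_bind_iff,
      PMF.mem_support_pure_iff] at hw
    obtain ⟨w₁, hw₁, w₂, hw₂, rfl⟩ := hw
    have h1 := (hf S O s).2 _ hw₁
    have h2 := (hg S O _).2 _ hw₂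
    change w₁.2.2 + w₂.2.2 + 1 ≤ _
    omega

/-- Only the branch that is taken has to be understood. -/
theorem ite {c : Prog} {b : Bool} {x : Val P.K} (hb : x.toBool = b)
    (hc : Evals P c u (PMF.pure x) C) (hf : Evals P (bif b then f else g) u d C') :
    Evals P (.ite c f g) u d (C + C' + 1) := by
  intro S O s
  have key : ∀ w ∈ (run P O c u s).support, (if w.1.toBool then run P O f u w.2.1
      else run P O g u w.2.1) = run P O (bif b then f else g) u s := by
    intro w hw
    obtain ⟨h1, h2⟩ := hc.mem_support hw
    rw [PMF.mem_support_pure_iff] at h1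
    rw [h1, h2, hb]
    cases b <;> rfl
  have hrun : run P O (.ite c f g) u s = (run P O c u s).bind fun w =>
      (if w.1.toBool then run P O f u w.2.1 else run P O g u w.2.1).bind fun w' =>
        PMF.pure (w'.1, w'.2.1, w.2.2 + w'.2.2 + 1) := by
    simp only [run, pmf_bind_eq, pmf_pure_eq]
    congr 1; funext w
    split_ifs <;> rfl
  rw [hrun]
  constructor
  · simp only [PMF.map_bind, PMF.pure_map]
    refine Eq.trans (bind_congr_support fun w hw => ?_) (PMF.bind_const (run P O c u s) _)
    rw [key w hw, ← (hf S O s).1]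
    rfl
  · intro w hw
    simp only [PMF.mem_support_bind_iff, PMF.mem_support_pure_iff] at hw
    obtain ⟨w₁, hw₁, w₂, hw₂, rfl⟩ := hw
    rw [key w₁ hw₁] at hw₂
    have h1 := (hc S O s).2 _ hw₁
    have h2 := (hf S O _).2 _ hw₂
    change w₁.2.2 + w₂.2.2 + 1 ≤ _
    omega

theorem of_run {x : Val P.K} (h : ∀ (S : Type) (O : Oracle P S) (s : S),
    run P O f u s = PMF.pure (x, s, 1)) : Evals P f u (PMF.pure x) 1 := by
  intro S O s
  rw [h S O s]
  constructor
  · simp [PMF.pure_map]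
  · intro w hw
    rw [PMF.mem_support_pure_iff] at hw
    rw [hw]

theorem of_run_rand {α : Type} {p : PMF α} {x : α → Val P.K}
    (h : ∀ (S : Type) (O : Oracle P S) (s : S),
      run P O f u s = p.bind fun a => PMF.pure (x a, s, 1)) : Evals P f u (p.map x) 1 := by
  intro S O s
  rw [h S O s]
  constructor
  · simp only [PMF.map_bind, PMF.pure_map, PMF.map_comp]; rfl
  · intro w hw
    simp only [PMF.mem_support_bind_iff, PMF.mem_support_pure_iff] at hw
    obtain ⟨a, -, rfl⟩ := hw
    exact le_rfl

end Evals

/-- Iterate a randomized function. -/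
def piter {α : Type} (f : α → PMF α) : ℕ → α → PMF α
  | 0, x => PMF.pure x
  | k + 1, x => (f x).bind (piter f k)

theorem piter_pure {α : Type} (f : α → α) (k : ℕ) (x : α) :
    piter (fun x => PMF.pure (f x)) k x = PMF.pure (f^[k] x) := by
  induction k generalizing x with
  | zero => rfl
  | succ k ih => rw [piter, PMF.pure_bind, ih]; rfl

theorem piter_map {α β : Type} {f : α → PMF α} {g : β → PMF β} (φ : α → β)
    (h : ∀ x, g (φ x) = (f x).map φ) (k : ℕ) (x : α) :
    piter g k (φ x) = (piter f k x).map φ := by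
  induction k generalizing x with
  | zero => rw [piter, piter, PMF.pure_map]
  | succ k ih =>
    rw [piter, piter, h, PMF.bind_map, PMF.map_bind]
    exact congrArg _ (funext fun y => ih y)

/-- The body of the loop has to be understood only on inputs that satisfy an invariant `I`. -/
theorem Evals.loop {P : Params} {f : Prog} {e : Val P.K → PMF (Val P.K)} {C : ℕ}
    (I : Val P.K → Prop)
    (hf : ∀ x, I x → Evals P f x (e x) C) (hI : ∀ x, I x → ∀ y ∈ (e x).support, I y)
    (k : ℕ) (x : Val P.K) (hx : I x) :
    Evals P (.loop f) (.pair (.nat k) x) (piter e k x) (k * (C + 1) + 1) := by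
  intro S O s
  change (iter (run P O f) k x s).map _ = _ ∧ ∀ w ∈ (iter (run P O f) k x s).support, _
  induction k generalizing x s with
  | zero =>
    constructor
    · simp [iter, piter, PMF.pure_map]
    · intro w hw
      rw [iter, PMF.mem_support_pure_iff] at hw
      simp [hw]
  | succ k ih =>
    constructor
    · simp only [iter, pmf_bind_eq, pmf_pure_eq, PMF.map_bind, PMF.pure_map, piter]
      rw [← (hf x hx).bind_run O s]
      refine bind_congr_support fun w hw => ?_
      obtain ⟨h1, h2⟩ := (hf x hx).mem_support hw
      rw [h2, ← (ih w.1 (hI _ hx _ h1) s).1]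
      rfl
    · intro w hw
      simp only [iter, pmf_bind_eq, pmf_pure_eq, PMF.mem_support_bind_iff,
        PMF.mem_support_pure_iff] at hw
      obtain ⟨w₁, hw₁, w₂, hw₂, rfl⟩ := hw
      have h1 := (hf x hx S O s).2 _ hw₁
      have h2 := (ih w₁.1 (hI _ hx _ ((hf x hx).mem_support hw₁).1) _).2 _ hw₂
      change w₁.2.2 + w₂.2.2 + 1 ≤ _
      rw [Nat.succ_mul]
      omega

/-! ### Closure properties -/

theorem DC.of_run {f : ∀ P : Params, ℕ → Val P.K → Val P.K} (prog : Prog)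
    (h : ∀ P M v (S : Type) (O : Oracle P S) (s : S),
      run P O prog (.pair (.nat M) v) s = PMF.pure (f P M v, s, 1)) : DC f :=
  ⟨prog, 1, fun P M v => by simpa using Evals.of_run (h P M v)⟩

section Closure

variable {f g : ∀ P : Params, ℕ → Val P.K → PMF (Val P.K)}
  {d e : ∀ P : Params, ℕ → Val P.K → Val P.K} {b c : ∀ P : Params, ℕ → Val P.K → Bool}
  {i j : ∀ P : Params, ℕ → Val P.K → ℕ} {x y : ∀ P : Params, ℕ → Val P.K → P.K}

theorem RC.congr (hf : RC f) (h : ∀ P M v, f P M v = g P M v) : RC g := by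
  obtain rfl : f = g := by funext P M v; exact h P M v
  exact hf

theorem DC.congr (hd : DC d) (h : ∀ P M v, d P M v = e P M v) : DC e :=
  RC.congr hd fun P M v => by rw [h]

/-- The argument of the computed function is the second component of the input of the program. -/
instance DC.arg : DC fun _ _ v => v := DC.of_run .snd fun _ _ _ _ _ _ => rfl

instance NC.bound : NC fun _ M _ => M := DC.of_run .fst fun _ _ _ _ _ _ => rfl

theorem RC.comp (hf : RC f) (hg : RC g) : RC fun P M v => (f P M v).bind (g P M) := by
  obtain ⟨p, T, hp⟩ := hf
  obtain ⟨p', T', hp'⟩ := hg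
  refine ⟨.seq (.pair .fst p) p', 1 + T + 1 + T' + 1, fun P M v => ?_⟩
  have h1 : Evals P .fst (.pair (.nat M) v) (PMF.pure (.nat M)) 1 :=
    Evals.of_run fun _ _ _ => rfl
  have h2 := h1.pair (hp P M v)
  rw [PMF.pure_bind] at h2
  have h3 := h2.seq (g := p') (C' := T'.eval M) (e := fun w => g P M w.snd) (by
    intro w hw
    obtain ⟨x, -, rfl⟩ := (PMF.mem_support_map_iff _ _ _).1 hw
    exact hp' P M x)
  rw [PMF.bind_map] at h3
  simpa [Function.comp_def, Val.snd] using h3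

theorem RC.pair (hf : RC f) (hg : RC g) :
    RC fun P M v => (f P M v).bind fun x => (g P M v).map (.pair x) := by
  obtain ⟨p, T, hp⟩ := hf
  obtain ⟨p', T', hp'⟩ := hg
  exact ⟨.pair p p', T + T' + 1, fun P M v => by simpa using (hp P M v).pair (hp' P M v)⟩

instance DC.pair [hd : DC d] [he : DC e] : DC fun P M v => .pair (d P M v) (e P M v) :=
  (RC.pair hd he).congr fun P M v => by simp [PMF.pure_map]

theorem DC.rcomp (hd : DC d) (hg : RC g) : RC fun P M v => g P M (d P M v) :=
  (RC.comp hd hg).congr fun P M v => by simp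

theorem DC.comp (hd : DC d) (he : DC e) : DC fun P M v => e P M (d P M v) :=
  DC.rcomp (g := fun P M v => PMF.pure (e P M v)) hd he

/-- Sample a value and go on with it. -/
theorem RC.bind (hf : RC f) (hg : RC g) :
    RC fun P M v => (f P M v).bind fun x => g P M (.pair x v) :=
  ((RC.pair hf DC.arg).comp hg).congr fun P M v => by simp [PMF.pure_map, PMF.bind_bind]

theorem RC.map (hf : RC f) (hd : DC d) : RC fun P M v => (f P M v).map (d P M) :=
  (RC.comp hf hd).congr fun _ _ _ => PMF.bind_pure_comp _ _

theorem DC.unary {φ : ∀ P : Params, Val P.K → Val P.K} (prog : Prog)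
    (h : ∀ P v (S : Type) (O : Oracle P S) (s : S), run P O prog v s = PMF.pure (φ P v, s, 1))
    (hd : DC d) : DC fun P M v => φ P (d P M v) := by
  obtain ⟨p, T, hp⟩ := hd
  refine ⟨.seq p prog, T + 1 + 1, fun P M v => ?_⟩
  have := (hp P M v).seq (g := prog) (C' := 1) (e := fun w => PMF.pure (φ P w))
    fun w _ => Evals.of_run (h P w)
  rw [PMF.pure_bind] at this
  simpa using this

instance DC.fst [hd : DC d] : DC fun P M v => (d P M v).fst :=
  hd.unary (φ := fun _ v => v.fst) .fst fun _ _ _ _ _ => rfl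

instance DC.snd [hd : DC d] : DC fun P M v => (d P M v).snd :=
  hd.unary (φ := fun _ v => v.snd) .snd fun _ _ _ _ _ => rfl

instance NC.tag [hd : DC d] : NC fun P M v => (d P M v).tag :=
  hd.unary (φ := fun _ v => .nat v.tag) .tag fun _ _ _ _ _ => rfl

instance NC.const (k : ℕ) : NC fun _ _ _ => k := DC.of_run (.nat k) fun _ _ _ _ _ _ => rfl

instance NC.add [hi : NC i] [hj : NC j] : NC fun P M v => i P M v + j P M v :=
  (DC.pair (hd := hi) (he := hj)).unary (φ := fun _ v => .nat (v.fst.toNat + v.snd.toNat)) .add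
    fun _ _ _ _ _ => rfl

instance NC.succ [hi : NC i] : NC fun P M v => i P M v + 1 :=
  NC.add (hi := hi) (hj := NC.const 1)

instance NC.sub [hi : NC i] [hj : NC j] : NC fun P M v => i P M v - j P M v :=
  (DC.pair (hd := hi) (he := hj)).unary (φ := fun _ v => .nat (v.fst.toNat - v.snd.toNat)) .sub
    fun _ _ _ _ _ => rfl

instance NC.toNat [hd : DC d] : NC fun P M v => (d P M v).toNat :=
  (DC.pair (hd := hd) (he := NC.const 0)).unary (φ := fun _ v => .nat (v.fst.toNat + v.snd.toNat))
    .add fun _ _ _ _ _ => rfl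

instance NC.min [hi : NC i] [hj : NC j] : NC fun P M v => min (i P M v) (j P M v) :=
  DC.congr (d := fun P M v => .nat (i P M v - (i P M v - j P M v))) inferInstance fun P M v => by
    dsimp only
    congr 1
    omega

instance RC.cond [hb : BC b] [hf : RC f] [hg : RC g] :
    RC fun P M v => bif b P M v then f P M v else g P M v := by
  obtain ⟨p, T, hp⟩ := hb
  obtain ⟨q, T', hq⟩ := hf
  obtain ⟨q', T'', hq'⟩ := hg
  refine ⟨.ite p q q', T + (T' + T'') + 1, fun P M v => ?_⟩
  have : Evals P (.ite p q q') (.pair (.nat M) v) (bif b P M v then f P M v else g P M v)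
      (T.eval M + (T'.eval M + T''.eval M) + 1) := by
    refine (hp P M v).ite (b := b P M v) ?_ ?_
    · beta_reduce; cases b P M v <;> rfl
    · cases b P M v
      · exact (hq' P M v).mono (Nat.le_add_left _ _)
      · exact (hq P M v).mono (Nat.le_add_right _ _)
  simpa using this

instance DC.cond [hb : BC b] [hd : DC d] [he : DC e] :
    DC fun P M v => bif b P M v then d P M v else e P M v :=
  (RC.cond (hb := hb) (hf := hd) (hg := he)).congr fun P M v => by
    beta_reduce; cases b P M v <;> rfl

instance BC.cond [hb : BC b] {c' : ∀ P : Params, ℕ → Val P.K → Bool} [hc : BC c] [hc' : BC c'] :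
    BC fun P M v => bif b P M v then c P M v else c' P M v :=
  (DC.cond (hb := hb) (hd := hc) (he := hc')).congr fun P M v => by
    beta_reduce; cases b P M v <;> rfl

instance NC.cond [hb : BC b] [hi : NC i] [hj : NC j] :
    NC fun P M v => bif b P M v then i P M v else j P M v :=
  (DC.cond (hb := hb) (hd := hi) (he := hj)).congr fun P M v => by
    beta_reduce; cases b P M v <;> rfl

instance KC.cond [hb : BC b] [hx : KC x] [hy : KC y] :
    KC fun P M v => bif b P M v then x P M v else y P M v :=
  (DC.cond (hb := hb) (hd := hx) (he := hy)).congr fun P M v => by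
    beta_reduce; cases b P M v <;> rfl

instance BC.const (k : Bool) : BC fun _ _ _ => k := NC.const k.toNat

instance BC.not [hb : BC b] : BC fun P M v => !b P M v :=
  (BC.cond (hb := hb) (hc := BC.const false) (hc' := BC.const true)).congr fun P M v => by
    beta_reduce; cases b P M v <;> rfl

instance BC.and [hb : BC b] [hc : BC c] : BC fun P M v => b P M v && c P M v :=
  (BC.cond (hb := hb) (hc := hc) (hc' := BC.const false)).congr fun P M v => by
    beta_reduce; cases b P M v <;> rfl

instance BC.or [hb : BC b] [hc : BC c] : BC fun P M v => b P M v || c P M v :=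
  (BC.cond (hb := hb) (hc := BC.const true) (hc' := hc)).congr fun P M v => by
    beta_reduce; cases b P M v <;> rfl

instance BC.toBool [hd : DC d] : BC fun P M v => (d P M v).toBool := by
  obtain ⟨p, T, hp⟩ := hd
  refine ⟨.ite p (.nat 1) (.nat 0), T + 1 + 1, fun P M v => ?_⟩
  have : Evals P (.ite p (.nat 1) (.nat 0)) (.pair (.nat M) v)
      (PMF.pure (.ofBool (d P M v).toBool)) (T.eval M + 1 + 1) := by
    refine (hp P M v).ite rfl ?_
    cases (d P M v).toBool
    · exact Evals.of_run fun _ _ _ => rfl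
    · exact Evals.of_run fun _ _ _ => rfl
  simpa using this

instance BC.ne_zero [hi : NC i] : BC fun P M v => i P M v != 0 := BC.toBool (hd := hi)

instance BC.le [hi : NC i] [hj : NC j] : BC fun P M v => decide (i P M v ≤ j P M v) :=
  DC.congr (d := fun P M v => .ofBool (!(i P M v - j P M v != 0))) inferInstance fun P M v => by
    congr 1
    rw [Bool.eq_iff_iff]
    simp [Nat.sub_eq_zero_iff_le]

instance BC.lt [hi : NC i] [hj : NC j] : BC fun P M v => decide (i P M v < j P M v) :=
  DC.congr (d := fun P M v => .ofBool (!decide (j P M v ≤ i P M v))) inferInstance fun P M v => by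
    congr 1
    rw [Bool.eq_iff_iff]
    simp

instance BC.eq [hi : NC i] [hj : NC j] : BC fun P M v => decide (i P M v = j P M v) :=
  DC.congr (d := fun P M v => .ofBool (decide (i P M v ≤ j P M v) && decide (j P M v ≤ i P M v)))
    inferInstance fun P M v => by
    congr 1
    rw [Bool.eq_iff_iff]
    simp [le_antisymm_iff]

instance BC.beq [hi : NC i] [hj : NC j] : BC fun P M v => i P M v == j P M v :=
  DC.congr (BC.eq (hi := hi) (hj := hj)) fun P M v => by
    congr 1

instance KC.toFld [hd : DC d] : KC fun P M v => (d P M v).toFld :=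
  ((DC.pair (hd := hd) (he := NC.const 0)).unary (φ := fun _ v => .fld (v.fst.toFld + v.snd.toFld))
    .fadd fun _ _ _ _ _ => rfl).congr fun P M v => by simp [Val.fst, Val.snd, Val.toFld]

instance KC.zero : KC fun _ _ _ => 0 :=
  ((NC.const 0).unary (φ := fun _ v => .fld v.toNat) .fcast fun _ _ _ _ _ => rfl).congr
    fun P M v => by simp [Val.toNat]

instance KC.add [hx : KC x] [hy : KC y] : KC fun P M v => x P M v + y P M v :=
  (DC.pair (hd := hx) (he := hy)).unary (φ := fun _ v => .fld (v.fst.toFld + v.snd.toFld)) .fadd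
    fun _ _ _ _ _ => rfl

instance KC.mul [hx : KC x] [hy : KC y] : KC fun P M v => x P M v * y P M v :=
  (DC.pair (hd := hx) (he := hy)).unary (φ := fun _ v => .fld (v.fst.toFld * v.snd.toFld)) .fmul
    fun _ _ _ _ _ => rfl

instance KC.sigma [hx : KC x] : KC fun P M v => sigma P (x P M v) :=
  DC.unary (φ := fun _ v => .fld (SkewDihedral.sigma _ v.toFld)) .fsigma (fun _ _ _ _ _ => rfl) hx

open Classical in
instance BC.feq [hx : KC x] [hy : KC y] : BC fun P M v => decide (x P M v = y P M v) :=
  (DC.pair (hd := hx) (he := hy)).unary (φ := fun _ v => .ofBool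
    (decide (v.fst.toFld = v.snd.toFld))) .feq fun _ _ _ _ _ => rfl

theorem RC.unary_rand {φ : ∀ P : Params, Val P.K → PMF (Val P.K)} (prog : Prog)
    (h : ∀ P v, Evals P prog v (φ P v) 1) (hd : DC d) : RC fun P M v => φ P (d P M v) := by
  obtain ⟨p, T, hp⟩ := hd
  refine ⟨.seq p prog, T + 1 + 1, fun P M v => ?_⟩
  have := (hp P M v).seq (g := prog) (C' := 1) (e := φ P) fun w _ => h P w
  rw [PMF.pure_bind] at this
  simpa using this

instance RC.frand : RC fun P _ _ => (PMF.uniformOfFintype P.K).map .fld :=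
  RC.unary_rand (φ := fun P _ => (PMF.uniformOfFintype P.K).map .fld) .frand
    (fun _ _ => Evals.of_run_rand fun _ _ _ => rfl) DC.arg

instance RC.rand [hi : NC i] : RC fun P M v => (uniformBelow (i P M v)).map .nat :=
  RC.unary_rand (φ := fun _ v => (uniformBelow v.toNat).map .nat) .rand
    (fun _ _ => Evals.of_run_rand fun _ _ _ => rfl) hi

/-- Loops are cut off after `M` rounds. The argument stays available to the body. -/
theorem RC.loop (hf : RC f) (hi : NC i) (hd : DC d) :
    RC fun P M v => piter (fun x => f P M (.pair x v)) (min (i P M v) M) (d P M v) := by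
  obtain ⟨pi, Ti, hpi⟩ := NC.min (hi := hi) (hj := NC.bound)
  obtain ⟨pd, Td, hpd⟩ := hd
  obtain ⟨pf, Tf, hpf⟩ := hf
  refine ⟨.seq (.seq (.pair pi (.pair .fst (.pair pd .snd)))
    (.loop (.pair .fst (.pair pf (.seq .snd .snd))))) (.seq .snd .fst),
    Ti + (1 + (Td + 1 + 1) + 1) + 1 + (Polynomial.X * (1 + (Tf + (1 + 1 + 1) + 1) + 1 + 1) + 1) + 1
      + (1 + 1 + 1) + 1, fun P M v => ?_⟩
  have h1 : Evals P .fst (.pair (.nat M) v) (PMF.pure (.nat M)) 1 :=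
    Evals.of_run fun _ _ _ => rfl
  have h2 : Evals P .snd (.pair (.nat M) v) (PMF.pure v) 1 := Evals.of_run fun _ _ _ => rfl
  have h3 := (hpi P M v).pair (h1.pair ((hpd P M v).pair h2))
  simp only [PMF.pure_bind, PMF.pure_map] at h3
  -- the loop carries the bound, the current value and the argument
  set φ : Val P.K → Val P.K := fun x => .pair (.nat M) (.pair x v) with hφ
  have hbody : ∀ x, Evals P (.pair .fst (.pair pf (.seq .snd .snd))) (φ x)
      ((f P M (.pair x v)).map φ) (1 + (Tf.eval M + (1 + 1 + 1) + 1) + 1) := by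
    intro x
    have k1 : Evals P .fst (φ x) (PMF.pure (.nat M)) 1 := Evals.of_run fun _ _ _ => rfl
    have k2 : Evals P .snd (φ x) (PMF.pure (.pair x v)) 1 := Evals.of_run fun _ _ _ => rfl
    have k3 : Evals P .snd (.pair x v) (PMF.pure v) 1 := Evals.of_run fun _ _ _ => rfl
    have k4 : Evals P (.seq .snd .snd) (φ x) (PMF.pure v) (1 + 1 + 1) := by
      have := k2.seq (g := .snd) (C' := 1) (e := fun _ => PMF.pure v) (by
        intro w hw
        rw [PMF.mem_support_pure_iff] at hw
        exact hw ▸ k3)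
      rwa [PMF.pure_bind] at this
    have k5 := k1.pair ((hpf P M (.pair x v)).pair k4)
    simp only [PMF.pure_bind, PMF.pure_map, PMF.map_bind] at k5
    exact k5
  have hloop := Evals.loop (P := P) (f := .pair .fst (.pair pf (.seq .snd .snd)))
    (e := fun w => (f P M (.pair w.snd.fst v)).map φ) (fun w => ∃ x, w = φ x)
    (by rintro _ ⟨x, rfl⟩; exact hbody x)
    (by
      rintro _ ⟨x, rfl⟩ y hy
      obtain ⟨z, -, rfl⟩ := (PMF.mem_support_map_iff _ _ _).1 hy
      exact ⟨z, rfl⟩)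
    (min (i P M v) M) (φ (d P M v)) ⟨_, rfl⟩
  rw [piter_map (f := fun x => f P M (.pair x v)) φ (fun _ => rfl)] at hloop
  have h4 := h3.seq (C' := M * (1 + (Tf.eval M + (1 + 1 + 1) + 1) + 1 + 1) + 1)
    (g := .loop (.pair .fst (.pair pf (.seq .snd .snd))))
    (e := fun _ => (piter (fun x => f P M (.pair x v)) (min (i P M v) M) (d P M v)).map φ) (by
      intro w hw
      rw [PMF.mem_support_pure_iff] at hw
      rw [hw]
      exact hloop.mono (Nat.add_le_add_right (Nat.mul_le_mul_right _ (min_le_right _ _)) _))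
  rw [PMF.pure_bind] at h4
  have h5 := h4.seq (C' := 1 + 1 + 1) (g := .seq .snd .fst) (e := fun w => PMF.pure w.snd.fst) (by
    intro w _
    have k1 : Evals P .snd w (PMF.pure w.snd) 1 := Evals.of_run fun _ _ _ => rfl
    have := k1.seq (g := .fst) (C' := 1) (e := fun w => PMF.pure w.fst)
      fun w _ => Evals.of_run fun _ _ _ => rfl
    rwa [PMF.pure_bind] at this)
  have h6 : (((piter (fun x => f P M (.pair x v)) (min (i P M v) M) (d P M v)).map φ).bind
      fun w => PMF.pure w.snd.fst) =
      piter (fun x => f P M (.pair x v)) (min (i P M v) M) (d P M v) := by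
    rw [PMF.bind_map]
    exact PMF.bind_pure _
  rw [h6] at h5
  simpa using h5

theorem DC.loop (hd : DC d) (hi : NC i) (he : DC e) :
    DC fun P M v => (fun x => d P M (.pair x v))^[min (i P M v) M] (e P M v) :=
  (RC.loop hd hi he).congr fun _ _ _ => piter_pure _ _ _

end Closure

/-! ### Lists and arrays -/

theorem DC.comp₂ {F : ∀ P : Params, ℕ → Val P.K → Val P.K → Val P.K}
    {d e : ∀ P : Params, ℕ → Val P.K → Val P.K}
    (hF : DC fun P M v => F P M v.fst v.snd) [hd : DC d] [he : DC e] :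
    DC fun P M v => F P M (d P M v) (e P M v) :=
  DC.comp (d := fun P M v => .pair (d P M v) (e P M v)) inferInstance hF

theorem DC.comp₃ {F : ∀ P : Params, ℕ → Val P.K → Val P.K → Val P.K → Val P.K}
    {c d e : ∀ P : Params, ℕ → Val P.K → Val P.K}
    (hF : DC fun P M v => F P M v.fst v.snd.fst v.snd.snd) [hc : DC c] [hd : DC d] [he : DC e] :
    DC fun P M v => F P M (c P M v) (d P M v) (e P M v) :=
  DC.comp (d := fun P M v => .pair (c P M v) (.pair (d P M v) (e P M v))) inferInstance hF

theorem DC.comp₄ {F : ∀ P : Params, ℕ → Val P.K → Val P.K → Val P.K → Val P.K → Val P.K}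
    {b c d e : ∀ P : Params, ℕ → Val P.K → Val P.K}
    (hF : DC fun P M v => F P M v.fst v.snd.fst v.snd.snd.fst v.snd.snd.snd)
    [hb : DC b] [hc : DC c] [hd : DC d] [he : DC e] :
    DC fun P M v => F P M (b P M v) (c P M v) (d P M v) (e P M v) :=
  DC.comp (d := fun P M v => .pair (b P M v) (.pair (c P M v) (.pair (d P M v) (e P M v))))
    inferInstance hF

/-- The list of the first at most `m` items of a value that is read as a list. -/
def Val.toList {K : Type} : ℕ → Val K → List (Val K)
  | m + 1, .pair x l => x :: toList m l
  | _, _ => []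

theorem Val.toList_ofList {K : Type} (m : ℕ) (l : List (Val K)) :
    (Val.ofList l).toList m = l.take m := by
  induction l generalizing m with
  | nil => cases m <;> rfl
  | cons x l ih => cases m with
    | zero => rfl
    | succ m => simp [ofList, toList, ih]

theorem Val.length_toList_le {K : Type} (m : ℕ) (v : Val K) : (v.toList m).length ≤ m := by
  induction m generalizing v with
  | zero => cases v <;> simp [toList]
  | succ m ih => cases v <;> simp [toList, ih]

theorem Val.toList_ofList_of_le {K : Type} {m : ℕ} {l : List (Val K)} (h : l.length ≤ m) :
    (Val.ofList l).toList m = l := by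
  rw [toList_ofList, List.take_of_length_le h]

theorem Val.get_ofList {K : Type} (l : List (Val K)) (i : ℕ) :
    (Val.ofList l).get i = l.getD i (.nat 0) := by
  induction l generalizing i with
  | nil =>
    have : ∀ i, (Val.snd^[i] (.nat 0 : Val K)) = .nat 0 := by
      intro i
      induction i with
      | zero => rfl
      | succ i ih => rw [Function.iterate_succ_apply]; exact ih
    simp [get, ofList, this, fst]
  | cons x l ih =>
    cases i with
    | zero => rfl
    | succ i => simpa [get, ofList, Function.iterate_succ_apply, snd] using ih i

section Lists

variable {d e : ∀ P : Params, ℕ → Val P.K → Val P.K} {i j : ∀ P : Params, ℕ → Val P.K → ℕ}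

instance DC.get [hd : DC d] [hi : NC i] :
    DC fun P M v => (d P M v).get (min (i P M v) M) :=
  DC.fst (hd := DC.loop (d := fun _ _ w => w.fst.snd) inferInstance hi hd)

instance DC.get_const [hd : DC d] (k : ℕ) : DC fun P M v => (d P M v).get k := by
  induction k generalizing d with
  | zero => exact DC.fst (hd := hd)
  | succ k ih =>
    exact (ih (d := fun P M v => (d P M v).snd)).congr fun P M v => by
      simp [Val.get, Function.iterate_succ_apply]

/-- Fold over the first items of a list; the argument stays available to the body. -/
theorem DC.foldl_min {b : ∀ P : Params, ℕ → Val P.K → Val P.K → Val P.K → Val P.K}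
    (hb : DC fun P M w => b P M w.fst w.snd.fst w.snd.snd) (hi : NC i) (hd : DC d) (he : DC e) :
    DC fun P M v => ((d P M v).toList (min (i P M v) M)).foldl (fun a x => b P M a x v)
      (e P M v) := by
  have hb' : DC fun P M w => b P M w.fst.snd w.fst.fst.fst w.snd :=
    DC.comp (d := fun P M w => .pair w.fst.snd (.pair w.fst.fst.fst w.snd)) inferInstance hb
  refine DC.congr (DC.snd (hd := DC.loop
    (d := fun P M w => bif decide (w.fst.fst.tag = 2) then
        .pair w.fst.fst.snd (b P M w.fst.snd w.fst.fst.fst w.snd) else w.fst) inferInstance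
    (i := i) hi (DC.pair (hd := hd) (he := he)))) fun P M v => ?_
  generalize min (i P M v) M = k
  generalize d P M v = l
  generalize e P M v = a
  induction k generalizing l a with
  | zero => cases l <;> rfl
  | succ k ih =>
    rw [Function.iterate_succ_apply]
    have stay : ∀ (l : Val P.K), l.tag ≠ 2 → ∀ k, ((fun x : Val P.K =>
        bif decide ((Val.pair x v).fst.fst.tag = 2) then
          Val.pair (Val.pair x v).fst.fst.snd
            (b P M (Val.pair x v).fst.snd (Val.pair x v).fst.fst.fst (Val.pair x v).snd)
        else (Val.pair x v).fst)^[k] (.pair l a)) = .pair l a := by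
      intro l hl k
      induction k with
      | zero => rfl
      | succ k ih =>
        rw [Function.iterate_succ_apply]
        simp only [Val.fst, hl, decide_false, cond_false]
        exact ih
    cases l with
    | nat n => exact congrArg Val.snd (stay (.nat n) (by simp [Val.tag]) k)
    | fld c => exact congrArg Val.snd (stay (.fld c) (by simp [Val.tag]) k)
    | pair x l => exact ih l _

theorem DC.foldl {b : ∀ P : Params, ℕ → Val P.K → Val P.K → Val P.K → Val P.K}
    (hb : DC fun P M w => b P M w.fst w.snd.fst w.snd.snd) (hd : DC d) (he : DC e) :
    DC fun P M v => ((d P M v).toList M).foldl (fun a x => b P M a x v) (e P M v) :=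
  (DC.foldl_min hb NC.bound hd he).congr fun P M v => by rw [min_self]

theorem foldl_or {α β : Type} (p : α → Bool) (l : List α) (f : Bool → β) (g : β → Bool)
    (hgf : ∀ b, g (f b) = b) (b : Bool) :
    l.foldl (fun a x => f (g a || p x)) (f b) = f (b || l.any p) := by
  induction l generalizing b with
  | nil => simp
  | cons x l ih => simp [ih, hgf, Bool.or_assoc]

theorem Val.toBool_ofBool {K : Type} (b : Bool) : (Val.ofBool b : Val K).toBool = b := by
  cases b <;> rfl

instance BC.any_min {p : ∀ P : Params, ℕ → Val P.K → Val P.K → Bool}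
    [hp : BC fun P M w => p P M w.fst w.snd] [hi : NC i] [hd : DC d] :
    BC fun P M v => ((d P M v).toList (min (i P M v) M)).any fun x => p P M x v := by
  have hp' : BC fun P M w => p P M w.snd.fst w.snd.snd :=
    DC.comp (d := fun P M w => w.snd) inferInstance hp
  exact DC.congr (DC.foldl_min (b := fun P M a x v => .ofBool (a.toBool || p P M x v))
    inferInstance hi hd (BC.const false)) fun P M v => by
      rw [foldl_or _ _ _ _ Val.toBool_ofBool, Bool.false_or]

instance BC.any {p : ∀ P : Params, ℕ → Val P.K → Val P.K → Bool}
    [hp : BC fun P M w => p P M w.fst w.snd] [hd : DC d] :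
    BC fun P M v => ((d P M v).toList M).any fun x => p P M x v :=
  DC.congr (BC.any_min (p := p) (d := d) (i := fun _ M _ => M)) fun P M v => by
    beta_reduce; rw [min_self]

theorem foldl_find {K : Type} (p : Val K → Bool) (l : List (Val K)) :
    l.foldl (fun a x => bif decide (a.tag = 2) then a else
      bif p x then .pair (.nat 1) x else .nat 0) (.nat 0) = Val.ofOption id (l.find? p) := by
  have key : ∀ (l : List (Val K)) (a : Val K), a.tag = 2 → l.foldl (fun a x =>
      bif decide (a.tag = 2) then a else bif p x then .pair (.nat 1) x else .nat 0) a = a := by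
    intro l
    induction l with
    | nil => exact fun _ _ => rfl
    | cons x l ih =>
      intro a ha
      rw [List.foldl_cons, ha]
      exact ih a ha
  induction l with
  | nil => rfl
  | cons x l ih =>
    cases hx : p x with
    | false => simpa [List.find?, hx, Val.tag] using ih
    | true =>
      simp only [List.foldl_cons, hx, List.find?, Val.tag]
      exact key l _ rfl

instance DC.find {p : ∀ P : Params, ℕ → Val P.K → Val P.K → Bool}
    [hp : BC fun P M w => p P M w.fst w.snd] [hd : DC d] :
    DC fun P M v => Val.ofOption id (((d P M v).toList M).find? fun x => p P M x v) := by
  have hp' : BC fun P M w => p P M w.snd.fst w.snd.snd :=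
    DC.comp (d := fun P M w => w.snd) inferInstance hp
  exact DC.congr (DC.foldl (b := fun P M a x v => bif decide (a.tag = 2) then a else
      bif p P M x v then .pair (.nat 1) x else .nat 0)
    inferInstance hd (NC.const 0)) fun P M v => foldl_find _ _

theorem foldl_cons_ofList {K : Type} (p : Val K → Bool) (f : Val K → Val K) (l a : List (Val K)) :
    l.foldl (fun a x => bif p x then .pair (f x) a else a) (.ofList a) =
      Val.ofList (((l.filter p).map f).reverse ++ a) := by
  induction l generalizing a with
  | nil => rfl
  | cons x l ih =>
    cases hx : p x with
    | false => simp [hx, ih]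
    | true =>
      have := ih (f x :: a)
      simpa [List.filter_cons, hx, Val.ofList] using this

theorem foldl_pair_ofList {K : Type} (l a : List (Val K)) :
    l.foldl (fun a x => .pair x a) (.ofList a) = Val.ofList (l.reverse ++ a) := by
  simpa using foldl_cons_ofList (fun _ => true) id l a

/-- Select items of a list and transform them. -/
theorem DC.filter_map {p : ∀ P : Params, ℕ → Val P.K → Val P.K → Bool}
    {f : ∀ P : Params, ℕ → Val P.K → Val P.K → Val P.K}
    (hp : BC fun P M w => p P M w.fst w.snd) (hf : DC fun P M w => f P M w.fst w.snd)
    (hd : DC d) :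
    DC fun P M v => Val.ofList ((((d P M v).toList M).filter fun x => p P M x v).map
      fun x => f P M x v) := by
  have hp' : BC fun P M w => p P M w.snd.fst w.snd.snd :=
    DC.comp (d := fun P M w => w.snd) inferInstance hp
  have hf' : DC fun P M w => f P M w.snd.fst w.snd.snd :=
    DC.comp (d := fun P M w => w.snd) inferInstance hf
  have h1 := DC.foldl (b := fun P M a x v => bif p P M x v then .pair (f P M x v) a else a)
    inferInstance hd (NC.const 0)
  refine DC.congr (DC.foldl (b := fun P M a x v => .pair x a) inferInstance h1 (NC.const 0))
    fun P M v => ?_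
  have h2 := foldl_cons_ofList (fun x => p P M x v) (fun x => f P M x v) ((d P M v).toList M) []
  have h3 := foldl_pair_ofList
    ((((d P M v).toList M).filter fun x => p P M x v).map fun x => f P M x v).reverse []
  simp only [Val.ofList, List.append_nil, List.reverse_reverse] at h2 h3
  beta_reduce
  rw [h2, Val.toList_ofList_of_le, h3]
  rw [List.length_reverse, List.length_map]
  exact (List.length_filter_le _ _).trans (Val.length_toList_le _ _)

instance DC.map {f : ∀ P : Params, ℕ → Val P.K → Val P.K → Val P.K}
    [hf : DC fun P M w => f P M w.fst w.snd] [hd : DC d] :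
    DC fun P M v => Val.ofList (((d P M v).toList M).map fun x => f P M x v) :=
  (DC.filter_map (p := fun _ _ _ _ => true) inferInstance hf hd).congr fun P M v => by simp

instance DC.snoc [hd : DC d] [he : DC e] :
    DC fun P M v => Val.ofList ((d P M v).toList M ++ [e P M v]) := by
  have h1 := DC.foldl (b := fun P M a x v => .pair x a) inferInstance hd (NC.const 0)
  refine DC.congr (DC.foldl (b := fun P M a x v => .pair x a) inferInstance h1
    (DC.pair (hd := he) (he := NC.const 0))) fun P M v => ?_
  have h2 := foldl_pair_ofList ((d P M v).toList M) []
  have h3 := foldl_pair_ofList ((d P M v).toList M).reverse [e P M v]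
  simp only [Val.ofList, List.append_nil, List.reverse_reverse] at h2 h3
  beta_reduce
  rw [h2, Val.toList_ofList_of_le, h3]
  rw [List.length_reverse]
  exact Val.length_toList_le _ _

instance NC.length [hd : DC d] : NC fun P M v => ((d P M v).toList M).length := by
  refine DC.congr (DC.foldl (b := fun P M a x v => .nat (a.toNat + 1)) inferInstance hd
    (NC.const 0)) fun P M v => ?_
  have key : ∀ (l : List (Val P.K)) (n : ℕ), l.foldl (fun (a : Val P.K) _ => .nat (a.toNat + 1))
      (.nat n) = .nat (n + l.length) := by
    intro l
    induction l with
    | nil => exact fun _ => rfl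
    | cons x l ih => 
      intro n
      rw [List.foldl_cons, List.length_cons, ← Nat.add_assoc, Nat.add_right_comm]
      exact ih _
  simpa using key _ 0

/-- Arrays: the values of a function at `0, …, i - 1`. -/
instance DC.tabulate {b : ∀ P : Params, ℕ → ℕ → Val P.K → Val P.K}
    [hb : DC fun P M w => b P M w.fst.toNat w.snd] [hi : NC i] :
    DC fun P M v => Val.ofList ((List.range (min (i P M v) M)).map fun j => b P M j v) := by
  have hb' : DC fun P M w => b P M (w.fst.fst.toNat - 1) w.snd :=
    DC.comp (d := fun P M w => .pair (.nat (w.fst.fst.toNat - 1)) w.snd) inferInstance hb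
  refine DC.congr (DC.snd (hd := DC.loop
    (d := fun P M w => .pair (.nat (w.fst.fst.toNat - 1))
      (.pair (b P M (w.fst.fst.toNat - 1) w.snd) w.fst.snd)) inferInstance hi
    (e := fun P M v => .pair (.nat (min (i P M v) M)) (.nat 0)) inferInstance)) fun P M v => ?_
  generalize min (i P M v) M = k
  have key : ∀ (k : ℕ) (l : List (Val P.K)), ((fun x : Val P.K =>
      Val.pair (.nat ((Val.pair x v).fst.fst.toNat - 1))
        (.pair (b P M ((Val.pair x v).fst.fst.toNat - 1) (Val.pair x v).snd)
          (Val.pair x v).fst.snd))^[k] (.pair (.nat k) (.ofList l))) =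
      .pair (.nat 0) (.ofList (((List.range k).map fun j => b P M j v) ++ l)) := by
    intro k
    induction k with
    | zero => exact fun _ => rfl
    | succ k ih =>
      intro l
      rw [Function.iterate_succ_apply]
      have := ih (b P M k v :: l)
      rw [List.range_succ, List.map_append, List.append_assoc]
      exact this
  have := congrArg Val.snd (key k [])
  rw [List.append_nil] at this
  exact this

instance KC.sum {x : ∀ P : Params, ℕ → ℕ → Val P.K → P.K}
    [hx : KC fun P M w => x P M w.fst.toNat w.snd] [hi : NC i] :
    KC fun P M v => ∑ j ∈ Finset.range (min (i P M v) M), x P M j v := by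
  have hx' : KC fun P M w => x P M w.fst.fst.toNat w.snd :=
    DC.comp (d := fun P M w => .pair w.fst.fst w.snd) inferInstance hx
  refine DC.congr (DC.snd (hd := DC.loop
    (d := fun P M w => .pair (.nat (w.fst.fst.toNat + 1))
      (.fld (w.fst.snd.toFld + x P M w.fst.fst.toNat w.snd))) inferInstance hi
    (e := fun P M v => .pair (.nat 0) (.fld 0)) inferInstance)) fun P M v => ?_
  beta_reduce
  generalize min (i P M v) M = k
  have key : ∀ (k : ℕ), ((fun y : Val P.K =>
      Val.pair (.nat ((Val.pair y v).fst.fst.toNat + 1))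
        (.fld ((Val.pair y v).fst.snd.toFld + x P M (Val.pair y v).fst.fst.toNat
          (Val.pair y v).snd)))^[k] (.pair (.nat 0) (.fld 0))) =
      .pair (.nat k) (.fld (∑ j ∈ Finset.range k, x P M j v)) := by
    intro k
    induction k with
    | zero => rfl
    | succ k ih =>
      rw [Function.iterate_succ_apply', ih, Finset.sum_range_succ]
      rfl
  exact congrArg Val.snd (key k)

/-- Polynomials in the bound `M`. -/
theorem NC.eval (W : ℕ[X]) : NC fun _ M _ => W.eval M := by
  induction W using Polynomial.induction_on with
  | C a => simpa using NC.const a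
  | add p q hp hq => simpa using (inferInstance : NC fun _ M _ => p.eval M + q.eval M)
  | monomial n a h =>
    refine DC.congr (DC.loop (d := fun _ M w =>
      .nat (w.fst.toNat + (Polynomial.C a * Polynomial.X ^ n : ℕ[X]).eval M)) inferInstance
      NC.bound (NC.const 0)) fun P M v => ?_
    beta_reduce
    rw [min_self]
    have key : ∀ c k : ℕ, ((fun x : Val P.K => Val.nat ((Val.pair x v).fst.toNat + c))^[k]
        (.nat 0)) = .nat (k * c) := by
      intro c k
      induction k with
      | zero => simp
      | succ k ih =>
        rw [Function.iterate_succ_apply', ih, Nat.succ_mul]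
        rfl
    rw [key]
    simp [pow_succ, mul_comm, mul_left_comm]

end Lists

/-- The list of `k` independent uniform field elements. -/
def randList (P : Params) (k : ℕ) : PMF (Val P.K) :=
  piter (fun l => (PMF.uniformOfFintype P.K).map fun c => .pair (.fld c) l) k (.nat 0)

theorem RC.of_randList {i : ∀ P : Params, ℕ → Val P.K → ℕ} (hi : NC i) :
    RC fun P M v => randList P (min (i P M v) M) := by
  have h : RC fun P M (v : Val P.K) =>
      (PMF.uniformOfFintype P.K).map fun c => Val.pair (.fld c) v.fst := by
    refine (RC.bind RC.frand (g := fun P M w => PMF.pure (.pair w.fst w.snd.fst))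
      inferInstance).congr fun P M v => ?_
    rw [PMF.bind_map, ← PMF.bind_pure_comp]
    rfl
  exact RC.loop h hi (NC.const 0)

/-! ### The skew dihedral group ring -/

section Ring

variable {P : Params}

theorem smul_eq_theta (g : P.G) (c : P.K) : g • c = theta P g c := rfl

theorem x_pow (P : Params) (i : ℕ) : P.x ^ i = DihedralGroup.r (i : ZMod P.n) := by
  simp [Params.x]

theorem x_pow_mul_y (P : Params) (i : ℕ) :
    P.x ^ i * P.y = DihedralGroup.sr (-(i : ZMod P.n)) := by
  simp [Params.x, Params.y]

theorem coeff_finset_sum {ι : Type} (s : Finset ι) (f : ι → P.R) (g : P.G) :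
    (∑ i ∈ s, f i).coeff g = ∑ i ∈ s, (f i).coeff g := by
  classical
  induction s using Finset.induction_on with
  | empty => simp
  | insert i s hi ih => simp [Finset.sum_insert hi, ih]

theorem mem_FC_iff {a : P.R} : a ∈ FC P ↔ ∀ z, a.coeff (.sr z) = 0 := by
  constructor
  · intro h z
    have := h (-z).val
    rwa [x_pow_mul_y, ZMod.natCast_zmod_val, neg_neg] at this
  · intro h i
    rw [x_pow_mul_y]
    exact h _

theorem mem_FCy_iff {a : P.R} : a ∈ FCy P ↔ ∀ z, a.coeff (.r z) = 0 := by
  constructor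
  · intro h z
    have := h z.val
    rwa [x_pow, ZMod.natCast_zmod_val] at this
  · intro h i
    rw [x_pow]
    exact h _

theorem mem_Gam_iff {a : P.R} :
    a ∈ Gam P ↔ (∀ z, a.coeff (.r z) = 0) ∧ ∀ z, a.coeff (.sr z) = a.coeff (.sr (-z)) := by
  have hn := P.n_pos
  refine and_congr mem_FCy_iff ⟨fun h z => ?_, fun h i hi => ?_⟩
  · by_cases hz : (-z).val = 0
    · have : z = 0 := by simpa using (ZMod.val_eq_zero _).1 hz
      rw [this, neg_zero]
    · have hlt := ZMod.val_lt (-z)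
      have := h (-z).val (Finset.mem_Icc.2 ⟨by omega, by omega⟩)
      rwa [x_pow_mul_y, x_pow_mul_y, Nat.cast_sub hlt.le, ZMod.natCast_self,
        ZMod.natCast_zmod_val, neg_neg, zero_sub, neg_neg] at this
  · have hi' := Finset.mem_Icc.1 hi
    rw [x_pow_mul_y, x_pow_mul_y, Nat.cast_sub (by omega), ZMod.natCast_self, zero_sub, neg_neg, h,
      neg_neg]

theorem eq_sum_of_mem_FC {a : P.R} (ha : a ∈ FC P) :
    a = ∑ z : ZMod P.n, SkewMonoidAlgebra.single (.r z) (a.coeff (.r z)) := by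
  classical
  refine SkewMonoidAlgebra.ext fun g => ?_
  rw [coeff_finset_sum]
  cases g with
  | r w => simp [Finsupp.single_apply]
  | sr w => simp [mem_FC_iff.1 ha]

theorem eq_sum_of_coeff_r {a : P.R} (ha : ∀ z, a.coeff (.r z) = 0) :
    a = ∑ z : ZMod P.n, SkewMonoidAlgebra.single (.sr z) (a.coeff (.sr z)) := by
  classical
  refine SkewMonoidAlgebra.ext fun g => ?_
  rw [coeff_finset_sum]
  cases g with
  | r w => simp [ha]
  | sr w => simp [Finsupp.single_apply]

theorem coeff_adj (a : P.R) (g : P.G) : (adj a).coeff g = theta P g (a.coeff g⁻¹) := by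
  classical
  rw [adj, SkewMonoidAlgebra.sum_def', coeff_finset_sum]
  simp only [SkewMonoidAlgebra.coeff_single_apply]
  rw [Finset.sum_eq_single g⁻¹]
  · rw [inv_inv, if_pos rfl]
  · intro b _ hb
    rw [if_neg fun h => hb (by rw [← h, inv_inv])]
  · intro h
    rw [SkewMonoidAlgebra.notMem_support_iff.1 h]
    simp

theorem mul_comm_of_mem_FC {a b : P.R} (ha : a ∈ FC P) (hb : b ∈ FC P) : a * b = b * a := by
  rw [eq_sum_of_mem_FC ha, eq_sum_of_mem_FC hb, Finset.sum_mul_sum, Finset.sum_mul_sum,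
    Finset.sum_comm]
  refine Finset.sum_congr rfl fun z _ => Finset.sum_congr rfl fun w _ => ?_
  rw [SkewMonoidAlgebra.single_mul_single, SkewMonoidAlgebra.single_mul_single,
    DihedralGroup.r_mul_r, DihedralGroup.r_mul_r, add_comm, smul_eq_theta, smul_eq_theta]
  congr 1
  exact mul_comm _ _

/-- The product of a reversible element with the adjunct of another is symmetric in the two: on
both sides the coefficient of `x ^ i` is a sum of `γ_z δ_w`, and the reversibility allows to change
the signs of the indices. -/
theorem mul_adj_comm {a b : P.R} (ha : a ∈ Gam P) (hb : b ∈ Gam P) : a * adj b = b * adj a := by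
  rw [mem_Gam_iff] at ha hb
  have key : ∀ c : P.R, (∀ z, c.coeff (.r z) = 0) → adj c =
      ∑ z : ZMod P.n, SkewMonoidAlgebra.single (.sr z) (sigma P (c.coeff (.sr z))) := by
    intro c hc
    have h0 : ∀ z, (adj c).coeff (.r z) = 0 := fun z => by
      rw [coeff_adj, DihedralGroup.inv_r, hc, map_zero]
    conv_lhs => rw [eq_sum_of_coeff_r h0]
    refine Finset.sum_congr rfl fun z _ => ?_
    rw [coeff_adj, DihedralGroup.inv_sr]
    rfl
  rw [key a ha.1, key b hb.1]
  conv_lhs => rw [eq_sum_of_coeff_r ha.1]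
  conv_rhs => rw [eq_sum_of_coeff_r hb.1]
  rw [Finset.sum_mul_sum, Finset.sum_mul_sum, Finset.sum_comm]
  refine Fintype.sum_equiv (Equiv.neg _) _ _ fun z => Fintype.sum_equiv (Equiv.neg _) _ _
    fun w => ?_
  rw [SkewMonoidAlgebra.single_mul_single, SkewMonoidAlgebra.single_mul_single]
  simp only [Equiv.neg_apply, DihedralGroup.sr_mul_sr, smul_eq_theta]
  rw [← ha.2, ← hb.2, neg_sub_neg]
  congr 1
  change _ * sigma P (sigma P _) = _ * sigma P (sigma P _)
  have hs : ∀ c, sigma P (sigma P c) = c := pow_q_q P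
  rw [hs, hs, mul_comm]

theorem mem_support_sampleSecret {sk : P.R × P.R} (h : sk ∈ (sampleSecret P).support) :
    sk.1 ∈ FC P ∧ sk.2 ∈ Gam P := by
  simp only [sampleSecret, pmf_bind_eq, pmf_pure_eq, PMF.mem_support_bind_iff,
    PMF.mem_support_pure_iff] at h
  obtain ⟨a, ha, c, hc, rfl⟩ := h
  simpa [uniformOn, PMF.mem_support_uniformOfFinset_iff] using And.intro ha hc

/-- The two ends of an honest exchange compute the same key. -/
theorem sharedKey_pubKey {h : P.R} {sk sk' : P.R × P.R} (hs : sk ∈ (sampleSecret P).support)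
    (hs' : sk' ∈ (sampleSecret P).support) :
    sharedKey sk (pubKey h sk') = sharedKey sk' (pubKey h sk) := by
  obtain ⟨h1, h2⟩ := mem_support_sampleSecret hs
  obtain ⟨h1', h2'⟩ := mem_support_sampleSecret hs'
  simp only [sharedKey, pubKey]
  rw [show sk.1 * (sk'.1 * h * sk'.2) * adj sk.2 = (sk.1 * sk'.1) * h * (sk'.2 * adj sk.2) by
    simp only [mul_assoc], mul_comm_of_mem_FC h1 h1', mul_adj_comm h2' h2]
  simp only [mul_assoc]

end Ring

/-! ### Ring elements as arrays -/

section Arrays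

variable {P : Params}

theorem pos_of_lt {i : ℕ} (h : i < P.n) : P.pos i = .r (i : ZMod P.n) := by
  rw [Params.pos, if_pos h, x_pow]

theorem pos_add (i : ℕ) : P.pos (P.n + i) = .sr (-(i : ZMod P.n)) := by
  rw [Params.pos, if_neg (by omega), x_pow_mul_y, Nat.add_sub_cancel_left]

theorem pos_of_le {i : ℕ} (h : P.n ≤ i) : P.pos i = .sr (-((i - P.n : ℕ) : ZMod P.n)) := by
  rw [Params.pos, if_neg (by omega), x_pow_mul_y]

theorem cast_inj_of_lt {i j : ℕ} (hi : i < P.n) (hj : j < P.n) :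
    (i : ZMod P.n) = j ↔ i = j := by
  constructor
  · intro h
    have := congrArg ZMod.val h
    rwa [ZMod.val_cast_of_lt hi, ZMod.val_cast_of_lt hj] at this
  · exact congrArg _

theorem pos_inj {i j : ℕ} (hi : i < P.n + P.n) (hj : j < P.n + P.n) :
    P.pos i = P.pos j ↔ i = j := by
  refine ⟨fun h => ?_, congrArg _⟩
  by_cases h1 : i < P.n <;> by_cases h2 : j < P.n
  · rw [pos_of_lt h1, pos_of_lt h2] at h
    exact (cast_inj_of_lt h1 h2).1 (DihedralGroup.r.inj h)
  · rw [pos_of_lt h1, pos_of_le (by omega)] at h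
    cases h
  · rw [pos_of_le (by omega), pos_of_lt h2] at h
    cases h
  · rw [pos_of_le (by omega), pos_of_le (by omega)] at h
    have := (cast_inj_of_lt (P := P) (by omega) (by omega)).1
      (neg_injective (DihedralGroup.sr.inj h))
    omega

theorem exists_pos (g : P.G) : ∃ i < P.n + P.n, P.pos i = g := by
  cases g with
  | r z =>
    have := ZMod.val_lt z
    exact ⟨z.val, by omega, by rw [pos_of_lt this, ZMod.natCast_zmod_val]⟩
  | sr z =>
    have := ZMod.val_lt (-z)
    exact ⟨P.n + (-z).val, by omega, by rw [pos_add, ZMod.natCast_zmod_val, neg_neg]⟩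

theorem theta_pos (i : ℕ) (c : P.K) :
    theta P (P.pos i) c = bif decide (i < P.n) then c else sigma P c := by
  by_cases h : i < P.n
  · rw [pos_of_lt h, decide_eq_true h]; rfl
  · rw [pos_of_le (by omega), decide_eq_false h]; rfl

theorem ext_pos {a b : P.R} (h : ∀ i < P.n + P.n, a.coeff (P.pos i) = b.coeff (P.pos i)) :
    a = b := by
  refine SkewMonoidAlgebra.ext fun g => ?_
  obtain ⟨i, hi, rfl⟩ := exists_pos g
  exact h i hi

theorem coeff_sum_pos (f : ℕ → P.K) {k : ℕ} (hk : k < P.n + P.n) :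
    (∑ i ∈ Finset.range (P.n + P.n), SkewMonoidAlgebra.single (P.pos i) (f i) : P.R).coeff
      (P.pos k) = f k := by
  classical
  rw [coeff_finset_sum]
  simp only [SkewMonoidAlgebra.coeff_single_apply]
  rw [Finset.sum_eq_single k]
  · rw [if_pos rfl]
  · intro _ hi hik
    rw [if_neg fun h => hik ((pos_inj (Finset.mem_range.1 hi) hk).1 h)]
  · exact fun h => absurd (Finset.mem_range.2 hk) h

theorem eq_sum_pos (a : P.R) : a = ∑ i ∈ Finset.range (P.n + P.n),
    SkewMonoidAlgebra.single (P.pos i) (a.coeff (P.pos i)) :=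
  ext_pos fun _ hi => (coeff_sum_pos (fun i => a.coeff (P.pos i)) hi).symm

theorem encR_eq (a : P.R) : encR a =
    Val.ofList ((List.range (P.n + P.n)).map fun i => .fld (a.coeff (P.pos i))) := by
  rw [encR, show 2 * P.n = P.n + P.n from two_mul _]

theorem get_encR (a : P.R) {i : ℕ} (hi : i < P.n + P.n) :
    (encR a).get i = .fld (a.coeff (P.pos i)) := by
  rw [encR_eq, Val.get_ofList]
  simp [List.getD, hi]

theorem encR_congr {a : P.R} {f : ℕ → P.K}
    (h : ∀ i < P.n + P.n, f i = a.coeff (P.pos i)) :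
    Val.ofList ((List.range (P.n + P.n)).map fun i => .fld (f i)) = encR a := by
  rw [encR_eq]
  congr 1
  exact List.map_congr_left fun i hi => by rw [h i (List.mem_range.1 hi)]

theorem coeff_decR (v : Val P.K) {k : ℕ} (hk : k < P.n + P.n) :
    (decR v).coeff (P.pos k) = (v.get k).toFld := by
  rw [decR, show 2 * P.n = P.n + P.n from two_mul _]
  exact coeff_sum_pos (fun i => (v.get i).toFld) hk

/-- The position of a product of group elements. -/
def mulIdx (n i j : ℕ) : ℕ :=
  bif decide (i < n) then
    bif decide (j < n) then
      bif decide (i + j < n) then i + j else i + j - n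
    else
      bif decide (i + (j - n) < n) then i + j else i + j - n
  else
    bif decide (j < n) then
      bif decide (j ≤ i - n) then i - j else i + n - j
    else
      bif decide (j ≤ i) then i - j else i + n - j

/-- The position of an inverse. -/
def invIdx (n i : ℕ) : ℕ :=
  bif decide (i < n) then bif decide (i = 0) then 0 else n - i else i

/-- The multiplication table of the dihedral group in terms of positions. -/
theorem mulIdx_spec {i j : ℕ} (hi : i < P.n + P.n) (hj : j < P.n + P.n) :
    mulIdx P.n i j < P.n + P.n ∧ P.pos (mulIdx P.n i j) = P.pos i * P.pos j := by
  have hn : ((P.n : ℕ) : ZMod P.n) = 0 := ZMod.natCast_self _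
  by_cases h1 : i < P.n <;> by_cases h2 : j < P.n
  · by_cases h3 : i + j < P.n
    · simp only [mulIdx, h1, h2, h3, decide_true, cond_true]
      refine ⟨by omega, ?_⟩
      rw [pos_of_lt h1, pos_of_lt h2, pos_of_lt h3, DihedralGroup.r_mul_r]
      push_cast; rfl
    · simp only [mulIdx, h1, h2, h3, decide_true, cond_true, decide_false, cond_false]
      refine ⟨by omega, ?_⟩
      rw [pos_of_lt h1, pos_of_lt h2, pos_of_lt (by omega), DihedralGroup.r_mul_r,
        Nat.cast_sub (by omega), hn]
      push_cast; rw [sub_zero]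
  · obtain ⟨j, rfl⟩ := Nat.exists_eq_add_of_le (not_lt.1 h2)
    by_cases h3 : i + j < P.n
    · simp only [mulIdx, h1, h2, h3, decide_true, cond_true, decide_false, cond_false,
        Nat.add_sub_cancel_left]
      refine ⟨by omega, ?_⟩
      rw [pos_of_lt h1, pos_add, Nat.add_left_comm, pos_add, DihedralGroup.r_mul_sr]
      push_cast; congr 1; ring
    · simp only [mulIdx, h1, h2, h3, decide_true, cond_true, decide_false, cond_false,
        Nat.add_sub_cancel_left]
      refine ⟨by omega, ?_⟩
      rw [pos_of_lt h1, pos_add, show i + (P.n + j) - P.n = P.n + (i + j - P.n) by omega, pos_add,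
        DihedralGroup.r_mul_sr, Nat.cast_sub (by omega), hn]
      push_cast; congr 1; ring
  · obtain ⟨i, rfl⟩ := Nat.exists_eq_add_of_le (not_lt.1 h1)
    by_cases h3 : j ≤ i
    · simp only [mulIdx, h1, h2, h3, decide_true, cond_true, decide_false, cond_false,
        Nat.add_sub_cancel_left]
      refine ⟨by omega, ?_⟩
      rw [pos_add, pos_of_lt h2, show P.n + i - j = P.n + (i - j) by omega, pos_add,
        DihedralGroup.sr_mul_r, Nat.cast_sub h3]
      congr 1; ring
    · simp only [mulIdx, h1, h2, h3, decide_true, cond_true, decide_false, cond_false,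
        Nat.add_sub_cancel_left]
      refine ⟨by omega, ?_⟩
      rw [pos_add, pos_of_lt h2, show P.n + i + P.n - j = P.n + (i + P.n - j) by omega, pos_add,
        DihedralGroup.sr_mul_r, Nat.cast_sub (by omega)]
      push_cast; rw [hn]; congr 1; ring
  · obtain ⟨i, rfl⟩ := Nat.exists_eq_add_of_le (not_lt.1 h1)
    obtain ⟨j, rfl⟩ := Nat.exists_eq_add_of_le (not_lt.1 h2)
    by_cases h3 : P.n + j ≤ P.n + i
    · simp only [mulIdx, h1, h2, h3, decide_true, cond_true, decide_false, cond_false]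
      refine ⟨by omega, ?_⟩
      rw [pos_add, pos_add, pos_of_lt (by omega), show P.n + i - (P.n + j) = i - j by omega,
        DihedralGroup.sr_mul_sr, Nat.cast_sub (by omega)]
      congr 1; ring
    · simp only [mulIdx, h1, h2, h3, decide_false, cond_false]
      refine ⟨by omega, ?_⟩
      rw [pos_add, pos_add, pos_of_lt (by omega), DihedralGroup.sr_mul_sr,
        Nat.cast_sub (by omega)]
      push_cast; rw [hn]; congr 1; ring

theorem invIdx_spec {i : ℕ} (hi : i < P.n + P.n) :
    invIdx P.n i < P.n + P.n ∧ P.pos (invIdx P.n i) = (P.pos i)⁻¹ := by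
  have hn : ((P.n : ℕ) : ZMod P.n) = 0 := ZMod.natCast_self _
  by_cases h1 : i < P.n
  · by_cases h2 : i = 0
    · subst h2
      simp only [invIdx, h1, decide_true, cond_true]
      refine ⟨hi, ?_⟩
      rw [pos_of_lt h1, DihedralGroup.inv_r, Nat.cast_zero, neg_zero]
    · simp only [invIdx, h1, h2, decide_true, cond_true, decide_false, cond_false]
      refine ⟨by omega, ?_⟩
      rw [pos_of_lt h1, pos_of_lt (by omega), DihedralGroup.inv_r, Nat.cast_sub h1.le, hn, zero_sub]
  · simp only [invIdx, h1, decide_false, cond_false]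
    refine ⟨hi, ?_⟩
    rw [pos_of_le (by omega), DihedralGroup.inv_sr]

theorem coeff_mul_pos (a b : P.R) {k : ℕ} (hk : k < P.n + P.n) :
    (a * b).coeff (P.pos k) = ∑ i ∈ Finset.range (P.n + P.n), ∑ j ∈ Finset.range (P.n + P.n),
      bif decide (mulIdx P.n i j = k) then a.coeff (P.pos i) *
        (bif decide (i < P.n) then b.coeff (P.pos j) else sigma P (b.coeff (P.pos j)))
      else 0 := by
  classical
  conv_lhs => rw [eq_sum_pos a, eq_sum_pos b, Finset.sum_mul_sum, coeff_finset_sum]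
  refine Finset.sum_congr rfl fun i hi => ?_
  rw [coeff_finset_sum]
  refine Finset.sum_congr rfl fun j hj => ?_
  obtain ⟨h1, h2⟩ := mulIdx_spec (Finset.mem_range.1 hi) (Finset.mem_range.1 hj)
  rw [SkewMonoidAlgebra.single_mul_single, SkewMonoidAlgebra.coeff_single_apply, smul_eq_theta,
    theta_pos, ← h2]
  simp only [pos_inj h1 hk]
  split_ifs with h <;> simp [h]

/-- Multiplication of arrays; `n` is a value that holds the parameter `n`. -/
def mulV (P : Params) (M : ℕ) (n a b : Val P.K) : Val P.K :=
  Val.ofList ((List.range (min (n.toNat + n.toNat) M)).map fun k =>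
    .fld (∑ i ∈ Finset.range (min (n.toNat + n.toNat) M),
      ∑ j ∈ Finset.range (min (n.toNat + n.toNat) M),
        bif decide (mulIdx n.toNat i j = k) then (a.get (min i M)).toFld *
          (bif decide (i < n.toNat) then (b.get (min j M)).toFld
            else sigma P (b.get (min j M)).toFld)
        else 0))

theorem mulV_encR {M : ℕ} (hM : P.n + P.n ≤ M) (a b : P.R) :
    mulV P M (.nat P.n) (encR a) (encR b) = encR (a * b) := by
  simp only [mulV, Val.toNat, min_eq_left hM]
  refine encR_congr fun k hk => ?_
  rw [coeff_mul_pos a b hk]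
  refine Finset.sum_congr rfl fun i hi => Finset.sum_congr rfl fun j hj => ?_
  have hi := Finset.mem_range.1 hi
  have hj := Finset.mem_range.1 hj
  rw [min_eq_left (by omega), min_eq_left (by omega), get_encR _ hi, get_encR _ hj]
  rfl

/-- The adjunct of an array. -/
def adjV (P : Params) (M : ℕ) (n a : Val P.K) : Val P.K :=
  Val.ofList ((List.range (min (n.toNat + n.toNat) M)).map fun k =>
    .fld (bif decide (k < n.toNat) then (a.get (min (invIdx n.toNat k) M)).toFld
      else sigma P (a.get (min (invIdx n.toNat k) M)).toFld))

theorem adjV_encR {M : ℕ} (hM : P.n + P.n ≤ M) (a : P.R) :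
    adjV P M (.nat P.n) (encR a) = encR (adj a) := by
  simp only [adjV, Val.toNat, min_eq_left hM]
  refine encR_congr fun k hk => ?_
  obtain ⟨h1, h2⟩ := invIdx_spec hk
  rw [coeff_adj, theta_pos, ← h2, min_eq_left (by omega), get_encR _ h1]
  rfl

/-- The array that a value is read as. -/
def canonV (P : Params) (M : ℕ) (n a : Val P.K) : Val P.K :=
  Val.ofList ((List.range (min (n.toNat + n.toNat) M)).map fun k =>
    .fld (a.get (min k M)).toFld)

theorem canonV_eq {M : ℕ} (hM : P.n + P.n ≤ M) (v : Val P.K) :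
    canonV P M (.nat P.n) v = encR (decR v) := by
  simp only [canonV, Val.toNat, min_eq_left hM]
  refine encR_congr fun k hk => ?_
  rw [coeff_decR v hk, min_eq_left (by omega)]

open Classical in
/-- Equality of arrays. -/
def eqV (P : Params) (M : ℕ) (n a b : Val P.K) : Bool :=
  !((Val.ofList ((List.range (min (n.toNat + n.toNat) M)).map fun k =>
      (Val.ofBool (decide ((a.get (min k M)).toFld = (b.get (min k M)).toFld)) :
        Val P.K))).toList M).any fun x => !x.toBool

theorem eqV_encR {M : ℕ} (hM : P.n + P.n ≤ M) (a b : P.R) :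
    eqV P M (.nat P.n) (encR a) (encR b) = true ↔ a = b := by
  simp only [eqV, Val.toNat, min_eq_left hM]
  rw [Val.toList_ofList_of_le (by simpa using hM)]
  simp only [List.any_map, Bool.not_eq_true', List.any_eq_false, List.mem_range,
    Function.comp_apply, Val.toBool_ofBool, Bool.not_eq_false, decide_eq_true_eq]
  constructor
  · intro h
    refine ext_pos fun i hi => ?_
    have := h i hi
    rwa [min_eq_left (by omega), get_encR _ hi, get_encR _ hi] at this
  · rintro rfl i _
    rfl

end Arrays

theorem NC.mulIdx {i j k : ∀ P : Params, ℕ → Val P.K → ℕ} [NC i] [NC j] [NC k] :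
    NC fun P M v => mulIdx (i P M v) (j P M v) (k P M v) := by
  unfold SkewDihedral.mulIdx
  infer_instance

theorem NC.invIdx {i j : ∀ P : Params, ℕ → Val P.K → ℕ} [NC i] [NC j] :
    NC fun P M v => invIdx (i P M v) (j P M v) := by
  unfold SkewDihedral.invIdx
  infer_instance

attribute [instance] NC.mulIdx NC.invIdx

instance DC.mulV {b c d : ∀ P : Params, ℕ → Val P.K → Val P.K} [DC b] [DC c] [DC d] :
    DC fun P M v => mulV P M (b P M v) (c P M v) (d P M v) := by
  refine DC.comp₃ (F := SkewDihedral.mulV) ?_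
  unfold SkewDihedral.mulV
  infer_instance

instance DC.adjV {b c : ∀ P : Params, ℕ → Val P.K → Val P.K} [DC b] [DC c] :
    DC fun P M v => adjV P M (b P M v) (c P M v) := by
  refine DC.comp₂ (F := SkewDihedral.adjV) ?_
  unfold SkewDihedral.adjV
  infer_instance

instance DC.canonV {b c : ∀ P : Params, ℕ → Val P.K → Val P.K} [DC b] [DC c] :
    DC fun P M v => canonV P M (b P M v) (c P M v) := by
  refine DC.comp₂ (F := SkewDihedral.canonV) ?_
  unfold SkewDihedral.canonV
  infer_instance

instance BC.eqV {b c d : ∀ P : Params, ℕ → Val P.K → Val P.K} [DC b] [DC c] [DC d] :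
    BC fun P M v => eqV P M (b P M v) (c P M v) (d P M v) := by
  refine DC.comp₃ (F := fun P M a b c => .ofBool (SkewDihedral.eqV P M a b c)) ?_
  unfold SkewDihedral.eqV
  infer_instance

/-! ### Sampling secret pairs -/

/-- A map all of whose fibers over `t` have the same size takes the uniform distribution on its
domain to the uniform distribution on `t`. -/
theorem map_uniformOfFinset {α β : Type} [DecidableEq β] {s : Finset α} (hs : s.Nonempty)
    {t : Finset β} (ht : t.Nonempty) (φ : α → β) (hφ : ∀ x ∈ s, φ x ∈ t) (m : ℕ)
    (hm : ∀ y ∈ t, (s.filter fun x => φ x = y).card = m) :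
    (PMF.uniformOfFinset s hs).map φ = PMF.uniformOfFinset t ht := by
  classical
  have hcard : s.card = t.card * m := by
    rw [Finset.card_eq_sum_card_fiberwise (f := φ) (t := t) fun x hx => hφ x hx,
      Finset.sum_congr rfl hm, Finset.sum_const, smul_eq_mul]
  have hm0 : (m : ENNReal) ≠ 0 := by
    have := hs.card_pos
    rw [hcard] at this
    exact_mod_cast (Nat.pos_of_mul_pos_left this).ne'
  ext y
  rw [PMF.map_apply, tsum_eq_sum (s := s.filter fun x => φ x = y)]
  · rw [PMF.uniformOfFinset_apply]
    split_ifs with hy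
    · refine (Finset.sum_congr rfl (g := fun _ => (s.card : ENNReal)⁻¹) fun x hx => ?_).trans ?_
      · rw [Finset.mem_filter] at hx
        rw [if_pos hx.2.symm, PMF.uniformOfFinset_apply_of_mem _ hx.1]
      · rw [Finset.sum_const, hm y hy, hcard, nsmul_eq_mul, Nat.cast_mul,
          ENNReal.mul_inv (Or.inr (by simp)) (Or.inr hm0), mul_comm, mul_assoc,
          ENNReal.inv_mul_cancel hm0 (by simp), mul_one]
    · rw [Finset.sum_eq_zero]
      intro x hx
      rw [Finset.mem_filter] at hx
      exact absurd (hx.2 ▸ hφ x hx.1) hy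
  · intro x hx
    rw [Finset.mem_filter, not_and] at hx
    split_ifs with h
    · exact PMF.uniformOfFinset_apply_of_notMem _ fun hxs => hx hxs h.symm
    · rfl

theorem piter_succ' {α : Type} (f : α → PMF α) (k : ℕ) (x : α) :
    piter f (k + 1) x = (piter f k x).bind f := by
  induction k generalizing x with
  | zero => rw [piter, piter, PMF.pure_bind]; exact PMF.bind_pure _
  | succ k ih =>
    rw [piter, piter, PMF.bind_bind]
    exact congrArg _ (funext fun y => ih y)

theorem uniform_bind_map {α β : Type} [Fintype α] [Fintype β] [Nonempty α] [Nonempty β] :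
    ((PMF.uniformOfFintype α).bind fun a => (PMF.uniformOfFintype β).map fun b => (a, b)) =
      PMF.uniformOfFintype (α × β) := by
  classical
  ext ⟨a, b⟩
  rw [PMF.bind_apply, tsum_fintype, Finset.sum_eq_single a]
  · rw [PMF.map_apply, tsum_fintype, Finset.sum_eq_single b]
    · simp only [if_true, PMF.uniformOfFintype_apply, Fintype.card_prod, Nat.cast_mul]
      rw [ENNReal.mul_inv (Or.inr (by simp)) (Or.inl (by simp))]
    · intro b' _ hb
      rw [if_neg fun h => hb (Prod.mk.inj h).2.symm]
    · simp
  · intro a' _ ha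
    rw [PMF.map_apply, ENNReal.tsum_eq_zero.2, mul_zero]
    intro b'
    rw [if_neg fun h => ha (Prod.mk.inj h).1.symm]
  · simp

theorem map_uniformOfFintype_equiv {α β : Type} [Fintype α] [Fintype β] [Nonempty α] [Nonempty β]
    (e : α ≃ β) : (PMF.uniformOfFintype α).map e = PMF.uniformOfFintype β := by
  classical
  refine map_uniformOfFinset _ _ e (fun _ _ => Finset.mem_univ _) 1 fun y _ => ?_
  rw [Finset.card_eq_one]
  exact ⟨e.symm y, by ext x; simp [Equiv.eq_symm_apply]⟩

section Sampling

variable {P : Params}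

theorem randList_eq (k : ℕ) : randList P k = (PMF.uniformOfFintype (Fin k → P.K)).map
    fun c => Val.ofList (List.ofFn fun i => .fld (c i)) := by
  induction k with
  | zero =>
    have : ∀ c : Fin 0 → P.K, Val.ofList (List.ofFn fun i => .fld (c i)) = (.nat 0 : Val P.K) :=
      fun c => by simp [Val.ofList]
    simp only [this]
    exact (PMF.map_const _ _).symm
  | succ k ih =>
    rw [randList, piter_succ', ← randList, ih, PMF.bind_map, ← map_uniformOfFintype_equiv
      (((Equiv.prodComm _ _).trans (Fin.consEquiv fun _ : Fin (k + 1) => P.K)) :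
        (Fin k → P.K) × P.K ≃ (Fin (k + 1) → P.K)), ← uniform_bind_map]
    simp only [PMF.map_bind, PMF.map_comp]
    refine congrArg _ (funext fun c => ?_)
    simp only [Function.comp_def]
    congr 1
    funext x
    simp [Fin.consEquiv, List.ofFn_succ, Val.ofList]

/-- The uniform distribution on the ring. -/
def uniformR (P : Params) : PMF P.R := uniformOn Set.univ Set.univ_nonempty

theorem randList_eq_encR : randList P (P.n + P.n) = (uniformR P).map encR := by
  classical
  have h1 : (PMF.uniformOfFintype (Fin (P.n + P.n) → P.K)).map (fun c =>
      (∑ i ∈ Finset.range (P.n + P.n), SkewMonoidAlgebra.single (P.pos i)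
        (if h : i < P.n + P.n then c ⟨i, h⟩ else 0) : P.R)) = uniformR P := by
    refine map_uniformOfFinset _ ((Set.Finite.toFinset_nonempty _).2 Set.univ_nonempty) _
      (fun _ _ => by simp) 1 fun a _ => ?_
    rw [Finset.card_eq_one]
    refine ⟨fun i => a.coeff (P.pos i), ?_⟩
    ext c
    simp only [Finset.mem_filter, Finset.mem_univ, true_and, Finset.mem_singleton]
    constructor
    · rintro rfl
      funext i
      rw [coeff_sum_pos (fun i => if h : i < P.n + P.n then c ⟨i, h⟩ else 0) i.2, dif_pos i.2]
    · rintro rfl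
      refine ext_pos fun i hi => ?_
      rw [coeff_sum_pos (fun i => if h : i < P.n + P.n then _ else 0) hi, dif_pos hi]
  rw [← h1, randList_eq, PMF.map_comp]
  congr 1
  funext c
  rw [Function.comp_apply, encR_eq]
  congr 1
  refine List.ext_getElem (by simp) fun i h1 h2 => ?_
  have hi : i < P.n + P.n := by simpa using h1
  simp [coeff_sum_pos (fun i => if h : i < P.n + P.n then c ⟨i, h⟩ else 0) hi, hi]

/-- Additive maps of the ring take the uniform distribution to the one on their range. -/
theorem map_uniformR (φ : P.R →+ P.R) {s : Set P.R} (hs : s.Nonempty) (h : Set.range φ = s) :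
    (uniformR P).map φ = uniformOn s hs := by
  classical
  have : Fintype P.R := Fintype.ofFinite _
  refine map_uniformOfFinset ((Set.Finite.toFinset_nonempty _).2 Set.univ_nonempty)
    ((Set.Finite.toFinset_nonempty _).2 hs) φ (fun x _ => by simp [← h])
    (Finset.univ.filter fun x => φ x = 0).card fun y hy => ?_
  have hy' : y ∈ Set.range φ := by simpa [h] using hy
  obtain ⟨x₀, rfl⟩ := hy'
  refine Finset.card_bij' (fun x _ => x - x₀) (fun x _ => x + x₀) ?_ ?_ ?_ ?_
  · intro x hx
    simp only [Finset.mem_filter, Set.Finite.mem_toFinset, Set.mem_univ, true_and] at hx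
    simp [hx]
  · intro x hx
    simp only [Finset.mem_filter, Finset.mem_univ, true_and] at hx
    simp [hx]
  · intro x _; simp
  · intro x _; simp

/-- The element with coefficient `f (a_j)` at position `i`, where `j = idx i`, and `0` at the
positions without an index. -/
def spread (P : Params) (idx : ℕ → Option ℕ) : P.R →+ P.R where
  toFun a := ∑ i ∈ Finset.range (P.n + P.n), SkewMonoidAlgebra.single (P.pos i)
    ((idx i).elim 0 fun j => a.coeff (P.pos j))
  map_zero' := by
    refine Finset.sum_eq_zero fun i _ => ?_
    cases idx i <;> simp
  map_add' a b := by
    rw [← Finset.sum_add_distrib]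
    refine Finset.sum_congr rfl fun i _ => ?_
    cases idx i <;> simp

theorem coeff_spread (idx : ℕ → Option ℕ) (a : P.R) {i : ℕ} (hi : i < P.n + P.n) :
    (spread P idx a).coeff (P.pos i) = (idx i).elim 0 fun j => a.coeff (P.pos j) :=
  coeff_sum_pos (fun i => (idx i).elim 0 fun j => a.coeff (P.pos j)) hi

/-- The positions from which the rotation part of an array is copied. -/
def rotIdx (n i : ℕ) : Option ℕ := if i < n then some i else none

/-- The positions from which a reversible array is copied: `x ^ i y` receives the coefficient of
`x ^ j y` with `j` the smaller of `i` and `n - i`. -/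
def revIdx (n i : ℕ) : Option ℕ :=
  if i < n then none else some (n + min (i - n) (n - (i - n)))

theorem range_spread_rotIdx : Set.range (spread P (rotIdx P.n)) = FC P := by
  ext a
  constructor
  · rintro ⟨b, rfl⟩
    rw [mem_FC_iff]
    intro z
    have := ZMod.val_lt (-z)
    have hz : P.pos (P.n + (-z).val) = .sr z := by
      rw [pos_add, ZMod.natCast_zmod_val, neg_neg]
    rw [← hz, coeff_spread _ _ (by omega), rotIdx, if_neg (by omega)]
    rfl
  · intro ha
    refine ⟨a, ext_pos fun i hi => ?_⟩
    rw [coeff_spread _ _ hi, rotIdx]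
    split_ifs with h
    · rfl
    · rw [pos_of_le (by omega), mem_FC_iff.1 ha]
      rfl

theorem range_spread_revIdx : Set.range (spread P (revIdx P.n)) = Gam P := by
  have hn := P.n_pos
  ext a
  constructor
  · rintro ⟨b, rfl⟩
    rw [mem_Gam_iff]
    constructor
    · intro z
      have := ZMod.val_lt z
      have hz : P.pos z.val = .r z := by rw [pos_of_lt this, ZMod.natCast_zmod_val]
      rw [← hz, coeff_spread _ _ (by omega), revIdx, if_pos this]
      rfl
    · intro z
      have h1 := ZMod.val_lt z
      have hz : P.pos (P.n + (-z).val) = .sr z := by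
        rw [pos_add, ZMod.natCast_zmod_val, neg_neg]
      have hz' : P.pos (P.n + z.val) = .sr (-z) := by rw [pos_add, ZMod.natCast_zmod_val]
      have h2 := ZMod.val_lt (-z)
      rw [← hz, ← hz', coeff_spread _ _ (by omega), coeff_spread _ _ (by omega), revIdx, revIdx,
        if_neg (by omega), if_neg (by omega)]
      have : min (P.n + (-z).val - P.n) (P.n - (P.n + (-z).val - P.n)) =
          min (P.n + z.val - P.n) (P.n - (P.n + z.val - P.n)) := by
        rw [ZMod.neg_val]
        split_ifs with h
        · simp [h]
        · omega
      rw [this]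
  · intro ha
    rw [mem_Gam_iff] at ha
    refine ⟨a, ext_pos fun i hi => ?_⟩
    rw [coeff_spread _ _ hi, revIdx]
    split_ifs with h
    · rw [pos_of_lt h, ha.1]
      rfl
    · obtain ⟨i, rfl⟩ := Nat.exists_eq_add_of_le (not_lt.1 h)
      change a.coeff _ = _
      rw [pos_add, pos_add, Nat.add_sub_cancel_left]
      rcases le_total i (P.n - i) with hle | hle
      · rw [min_eq_left hle]
      · rw [min_eq_right hle, Nat.cast_sub (by omega), ZMod.natCast_self, zero_sub, neg_neg, ha.2]

theorem sampleSecret_eq : sampleSecret P = (uniformR P).bind fun a => (uniformR P).map fun c =>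
    (spread P (rotIdx P.n) a, spread P (revIdx P.n) c) := by
  rw [sampleSecret, ← map_uniformR _ (FC_nonempty P) range_spread_rotIdx,
    ← map_uniformR _ (Gam_nonempty P) range_spread_revIdx]
  simp only [pmf_bind_eq, pmf_pure_eq, PMF.bind_map]
  rfl

/-- A secret pair as a value. -/
def encSk (sk : P.R × P.R) : Val P.K := .pair (encR sk.1) (encR sk.2)

/-- The pair of arrays with secret pair made from two arrays of random coefficients. -/
def spreadV (P : Params) (M : ℕ) (n l l' : Val P.K) : Val P.K :=
  .pair
    (Val.ofList ((List.range (min (n.toNat + n.toNat) M)).map fun k =>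
      .fld (bif decide (k < n.toNat) then (l.get (min k M)).toFld else 0)))
    (Val.ofList ((List.range (min (n.toNat + n.toNat) M)).map fun k =>
      .fld (bif decide (k < n.toNat) then 0 else
        (l'.get (min (n.toNat + min (k - n.toNat) (n.toNat - (k - n.toNat))) M)).toFld)))

/-- Sample a secret pair; `n` is a value that holds the parameter `n`. -/
def sampleV (P : Params) (M : ℕ) (n : Val P.K) : PMF (Val P.K) :=
  (randList P (min (n.toNat + n.toNat) M)).bind fun l =>
    (randList P (min (n.toNat + n.toNat) M)).map fun l' => spreadV P M n l l'

theorem spreadV_encR {M : ℕ} (hM : P.n + P.n ≤ M) (a c : P.R) :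
    spreadV P M (.nat P.n) (encR a) (encR c) =
      encSk (spread P (rotIdx P.n) a, spread P (revIdx P.n) c) := by
  have hn := P.n_pos
  simp only [spreadV, Val.toNat, min_eq_left hM, encSk]
  congr 1
  · refine encR_congr fun k hk => ?_
    rw [coeff_spread _ _ hk, rotIdx, min_eq_left (by omega), get_encR _ hk]
    by_cases h : k < P.n <;> simp [h, Val.toFld]
  · refine encR_congr fun k hk => ?_
    rw [coeff_spread _ _ hk, revIdx]
    by_cases h : k < P.n
    · simp [h]
    · rw [min_eq_left (b := M) (by omega), get_encR _ (by omega)]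
      simp [h, Val.toFld]

theorem sampleV_eq {M : ℕ} (hM : P.n + P.n ≤ M) :
    sampleV P M (.nat P.n) = (sampleSecret P).map encSk := by
  simp only [sampleV, Val.toNat, min_eq_left hM, randList_eq_encR, sampleSecret_eq, PMF.bind_map,
    PMF.map_bind, PMF.map_comp]
  refine congrArg _ (funext fun a => ?_)
  simp only [Function.comp_apply]
  congr 1
  funext c
  exact spreadV_encR hM a c

end Sampling

theorem RC.sampleV {d : ∀ P : Params, ℕ → Val P.K → Val P.K} (hd : DC d) :
    RC fun P M v => sampleV P M (d P M v) := by
  refine DC.rcomp (g := SkewDihedral.sampleV) hd ?_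
  have h1 : RC fun P M v => randList P (min (v.toNat + v.toNat) M) :=
    RC.of_randList (i := fun P M v => v.toNat + v.toNat) inferInstance
  have h2 : RC fun P M (v : Val P.K) =>
      randList P (min (v.snd.toNat + v.snd.toNat) M) :=
    RC.of_randList (i := fun P M v => v.snd.toNat + v.snd.toNat) inferInstance
  have h3 : DC fun P M (v : Val P.K) => spreadV P M v.snd.snd v.snd.fst v.fst := by
    unfold SkewDihedral.spreadV
    infer_instance
  have h4 := RC.bind h2 h3
  refine (RC.bind h1 h4).congr fun P M v => ?_
  simp only [SkewDihedral.sampleV, ← PMF.bind_pure_comp]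
  rfl

/-! ### One step of the model, with the randomness made explicit -/

section Step

variable {P : Params}

/-- The reaction of party `j` to the message `(i, s, z)`, if a responder session created by it has
the secret pair `sk` and sends `pk`. -/
def recvStep (sk : P.R × P.R) (pk : P.R) (g : Game P) (i j s : ℕ) (z : P.R) : Val P.K × Game P :=
  if j ∈ g.corrupted then (.nat 0, g) else
  match g.find j s with
  | none => (.pair (.nat 1) (encR pk), g.push
      { owner := j, peer := i, sid := s, initiator := false, secret := none,
        sent := pk, received := some z, output := some (sharedKey sk z) })
  | some t =>
    match t.secret with
    | none => (.nat 0, g)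
    | some sk =>
      if t.peer = i ∧ t.stopped = false then
        (.nat 1, g.modify j s fun t =>
          { t with secret := none, received := some z, output := some (sharedKey sk z) })
      else (.nat 0, g)

open Classical in
/-- The answer to a query and the next state, if a session created by the query has the secret pair
`sk` and sends `pk`, and a test of a session with output `key` is answered with `tk key`. -/
def genStep (N : ℕ) (sk : P.R × P.R) (pk : P.R) (tk : P.R → P.R) (g : Game P) :
    Query P → Val P.K × Game P
  | .establish i j s =>
    if i < N ∧ j < N ∧ i ≠ j ∧ i ∉ g.corrupted ∧ g.find i s = none then
      (.pair (.nat 1) (encR pk), g.push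
        { owner := i, peer := j, sid := s, initiator := true, secret := some sk,
          sent := pk, received := none, output := none })
    else (.nat 0, g)
  | .deliver i s =>
    match g.find i s with
    | none => (.nat 0, g)
    | some t =>
      if t.delivered then (.nat 0, g)
      else recvStep sk pk (g.modify i s fun t => { t with delivered := true }) i t.peer s t.sent
  | .inject i j s z =>
    if i < N ∧ j < N ∧ i ≠ j ∧
        (i ∈ g.corrupted ∨ ∃ t, g.find i s = some t ∧ t.stopped = true ∧ t.peer = j) then
      recvStep sk pk g i j s z
    else (.nat 0, g)
  | .stateReveal i s =>
    match g.find i s with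
    | none => (.nat 0, g)
    | some t =>
      if t.expired = false ∧ ¬ g.Protected t then
        (t.contents, g.modify i s fun t => { t with stopped := true, exposed := true })
      else (.nat 0, g)
  | .keyReveal i s =>
    match g.find i s with
    | none => (.nat 0, g)
    | some t =>
      match t.output with
      | none => (.nat 0, g)
      | some key =>
        if t.expired = false ∧ ¬ g.Protected t then
          (encR key, g.modify i s fun t => { t with exposed := true })
        else (.nat 0, g)
  | .expire i s =>
    match g.find i s with
    | none => (.nat 0, g)
    | some t =>
      if t.output.isSome then
        (.nat 1, g.modify i s fun t => { t with expired := true })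
      else (.nat 0, g)
  | .corrupt i =>
    if i < N ∧ i ∉ g.corrupted ∧
        ∀ t ∈ g.sessions, t.owner = i → g.Protected t → t.expired = true then
      (.ofList ((g.sessions.filter fun t => t.owner == i && !t.expired).map Session.contents),
        { g with
          corrupted := insert i g.corrupted
          sessions := g.sessions.map fun t =>
            if t.owner == i && !t.expired then { t with exposed := true } else t })
    else (.nat 0, g)
  | .test i s =>
    match g.find i s with
    | none => (.nat 0, g)
    | some t =>
      match t.output with
      | none => (.nat 0, g)
      | some key =>
        if g.test = none ∧ t.expired = false ∧ g.Fresh t then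
          (encR (tk key), { g with test := some (i, s) })
        else (.nat 0, g)

/-- A step of the authenticated-links model in which the secret pair `sk` is drawn. -/
def realStep (N : ℕ) (h : P.R) (b : Bool) (sk : P.R × P.R) (g : Game P) (Q : Query P) :
    Val P.K × Game P :=
  genStep N sk (pubKey h sk) (fun key => if b then pubKey h sk else key) g Q

theorem pmf_map_const {α β : Type} (p : PMF α) (b : β) : (p.map fun _ => b) = PMF.pure b :=
  PMF.map_const p b

theorem receive_eq (h : P.R) (g : Game P) (i j s : ℕ) (z : P.R) :
    receive h g i j s z =
      (sampleSecret P).map fun sk => recvStep sk (pubKey h sk) g i j s z := by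
  unfold receive recvStep
  split_ifs with h1
  · exact (pmf_map_const _ _).symm
  · cases g.find j s with
    | none => rfl
    | some t =>
      cases hs : t.secret with
      | none => simp only [hs]; exact (pmf_map_const _ _).symm
      | some sk' =>
        simp only [hs]
        split_ifs <;> exact (pmf_map_const _ _).symm

/-- Every step of the model draws one secret pair, which is used if the query creates a session or
is the test. -/
theorem answer_eq (N : ℕ) (h : P.R) (b : Bool) (g : Game P) (Q : Query P) :
    answer N h b g Q = (sampleSecret P).map fun sk => realStep N h b sk g Q := by
  cases Q with
  | establish i j s =>
    simp only [answer, realStep, genStep]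
    split_ifs
    · rfl
    · exact (pmf_map_const _ _).symm
  | deliver i s =>
    simp only [answer, realStep, genStep]
    cases g.find i s with
    | none => exact (pmf_map_const _ _).symm
    | some t =>
      dsimp only
      split_ifs
      · exact (pmf_map_const _ _).symm
      · exact receive_eq _ _ _ _ _ _
  | inject i j s z =>
    simp only [answer, realStep, genStep]
    split_ifs
    · exact receive_eq _ _ _ _ _ _
    · exact (pmf_map_const _ _).symm
  | stateReveal i s | expire i s =>
    simp only [answer, realStep, genStep]
    cases g.find i s with
    | none => exact (pmf_map_const _ _).symm
    | some t =>
      dsimp only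
      split_ifs <;> exact (pmf_map_const _ _).symm
  | keyReveal i s =>
    simp only [answer, realStep, genStep]
    cases g.find i s with
    | none => exact (pmf_map_const _ _).symm
    | some t =>
      dsimp only
      cases t.output with
      | none => exact (pmf_map_const _ _).symm
      | some key =>
        dsimp only
        split_ifs <;> exact (pmf_map_const _ _).symm
  | corrupt i =>
    simp only [answer, realStep, genStep]
    split_ifs <;> exact (pmf_map_const _ _).symm
  | test i s =>
    simp only [answer, realStep, genStep]
    cases g.find i s with
    | none => exact (pmf_map_const _ _).symm
    | some t =>
      dsimp only
      cases t.output with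
      | none => exact (pmf_map_const _ _).symm
      | some key =>
        dsimp only
        by_cases hc : g.test = none ∧ t.expired = false ∧ g.Fresh t
        · simp only [if_pos hc]
          rfl
        · simp only [if_neg hc]
          exact (pmf_map_const _ _).symm

/-! ### Primitive moves -/

theorem find_some {g : Game P} {i s : ℕ} {t : Session P} (h : g.find i s = some t) :
    t ∈ g.sessions ∧ t.owner = i ∧ t.sid = s := by
  have := List.find?_some h
  simp only [Bool.and_eq_true, beq_iff_eq] at this
  exact ⟨List.mem_of_find?_eq_some h, this⟩

theorem find_none {g : Game P} {i s : ℕ} :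
    g.find i s = none ↔ ∀ t ∈ g.sessions, t.owner = i → t.sid ≠ s := by
  simp [Game.find, List.find?_eq_none]

/-- Where a message `(i, s, z)` to `j` can come from: a corrupted party, a stopped session, or the
session that sent it. -/
def Game.Source (g : Game P) (i j s : ℕ) (z : P.R) : Prop :=
  i ∈ g.corrupted ∨ ∃ u ∈ g.sessions, u.owner = i ∧ u.peer = j ∧ u.sid = s ∧
    (u.sent = z ∨ u.stopped = true)

/-- The primitive transitions of the model; one query makes at most two of them. -/
inductive Move (sk : P.R × P.R) (pk : P.R) (g : Game P) : Game P → Prop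
  | establish (i j s : ℕ) : i ≠ j → i ∉ g.corrupted → g.find i s = none →
      Move sk pk g (g.push
        { owner := i, peer := j, sid := s, initiator := true, secret := some sk,
          sent := pk, received := none, output := none })
  | mark (i s : ℕ) : Move sk pk g (g.modify i s fun t => { t with delivered := true })
  | respond (i j s : ℕ) (z : P.R) : i ≠ j → j ∉ g.corrupted → g.find j s = none →
      g.Source i j s z → Move sk pk g (g.push
        { owner := j, peer := i, sid := s, initiator := false, secret := none,
          sent := pk, received := some z, output := some (sharedKey sk z) })
  | complete (i j s : ℕ) (z : P.R) (t : Session P) (sk' : P.R × P.R) : g.find j s = some t →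
      t.secret = some sk' → t.peer = i → g.Source i j s z →
      Move sk pk g (g.modify j s fun t =>
        { t with secret := none, received := some z, output := some (sharedKey sk' z) })
  | stateReveal (i s : ℕ) (t : Session P) : g.find i s = some t → ¬ g.Protected t →
      Move sk pk g (g.modify i s fun t => { t with stopped := true, exposed := true })
  | keyReveal (i s : ℕ) (t : Session P) : g.find i s = some t → ¬ g.Protected t →
      Move sk pk g (g.modify i s fun t => { t with exposed := true })
  | expire (i s : ℕ) : Move sk pk g (g.modify i s fun t => { t with expired := true })
  | corrupt (i : ℕ) : (∀ t ∈ g.sessions, t.owner = i → g.Protected t → t.expired = true) →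
      Move sk pk g { g with
          corrupted := insert i g.corrupted
          sessions := g.sessions.map fun t =>
            if t.owner == i && !t.expired then { t with exposed := true } else t }
  | test (i s : ℕ) (t : Session P) : g.find i s = some t → t.output.isSome → g.test = none →
      g.Fresh t → Move sk pk g { g with test := some (i, s) }

theorem recvStep_moves (sk : P.R × P.R) (pk : P.R) {g : Game P} {i j s : ℕ} {z : P.R} (hij : i ≠ j)
    (hs : g.Source i j s z) :
    Relation.ReflTransGen (Move sk pk) g (recvStep sk pk g i j s z).2 := by
  unfold recvStep
  split_ifs with h1
  · exact .refl
  · cases hf : g.find j s with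
    | none => exact .single (.respond i j s z hij h1 hf hs)
    | some t =>
      dsimp only
      cases hsk : t.secret with
      | none => exact .refl
      | some sk' =>
        dsimp only
        split_ifs with h2
        · exact .single (.complete i j s z t sk' hf hsk h2.1 hs)
        · exact .refl

/-- The effect of every query is composed of primitive transitions. -/
theorem genStep_moves (N : ℕ) (sk : P.R × P.R) (pk : P.R) (tk : P.R → P.R) {g : Game P}
    (hne : ∀ t ∈ g.sessions, t.owner ≠ t.peer) (Q : Query P) :
    Relation.ReflTransGen (Move sk pk) g (genStep N sk pk tk g Q).2 := by
  cases Q with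
  | establish i j s =>
    simp only [genStep]
    split_ifs with h
    · exact .single (.establish i j s h.2.2.1 h.2.2.2.1 h.2.2.2.2)
    · exact .refl
  | deliver i s =>
    simp only [genStep]
    cases hf : g.find i s with
    | none => exact .refl
    | some t =>
      dsimp only
      obtain ⟨h1, h2, h3⟩ := find_some hf
      split_ifs
      · exact .refl
      · refine .head (.mark i s) (recvStep_moves _ _ (h2 ▸ hne t h1) (Or.inr ?_))
        refine ⟨{ t with delivered := true }, ?_, h2, rfl, h3, Or.inl rfl⟩
        exact List.mem_map.2 ⟨t, h1, by simp [h2, h3]⟩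
  | inject i j s z =>
    simp only [genStep]
    split_ifs with h
    · refine recvStep_moves _ _ h.2.2.1 (h.2.2.2.imp_right ?_)
      rintro ⟨t, hf, hst, hp⟩
      obtain ⟨h1, h2, h3⟩ := find_some hf
      exact ⟨t, h1, h2, hp, h3, Or.inr hst⟩
    · exact .refl
  | stateReveal i s =>
    simp only [genStep]
    cases hf : g.find i s with
    | none => exact .refl
    | some t =>
      dsimp only
      split_ifs with h
      · exact .single (.stateReveal i s t hf h.2)
      · exact .refl
  | keyReveal i s =>
    simp only [genStep]
    cases hf : g.find i s with
    | none => exact .refl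
    | some t =>
      dsimp only
      cases t.output with
      | none => exact .refl
      | some key =>
        dsimp only
        split_ifs with h
        · exact .single (.keyReveal i s t hf h.2)
        · exact .refl
  | expire i s =>
    simp only [genStep]
    cases hf : g.find i s with
    | none => exact .refl
    | some t =>
      dsimp only
      split_ifs with h
      · exact .single (.expire i s)
      · exact .refl
  | corrupt i =>
    simp only [genStep]
    split_ifs with h
    · exact .single (.corrupt i h.2.2)
    · exact .refl
  | test i s =>
    simp only [genStep]
    cases hf : g.find i s with
    | none => exact .refl
    | some t =>
      dsimp only
      cases ho : t.output with
      | none => exact .refl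
      | some key =>
        dsimp only
        split_ifs with h
        · exact .single (.test i s t hf (by simp [ho]) h.1 h.2.2)
        · exact .refl

/-! ### Invariants -/

/-- The properties of the reachable states that do not depend on the secret values. -/
structure Inv (g : Game P) : Prop where
  nodup : (g.sessions.map fun t => (t.owner, t.sid)).Nodup
  ne : ∀ t ∈ g.sessions, t.owner ≠ t.peer
  stopped : ∀ t ∈ g.sessions, t.stopped = true → t.exposed = true
  output : ∀ t ∈ g.sessions, t.output.isSome = t.received.isSome
  /-- an incoming message is that of the partner, unless the peer was corrupted or the partner
  exposed -/
  received : ∀ t ∈ g.sessions, ∀ z, t.received = some z → t.peer ∈ g.corrupted ∨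
    ∃ u ∈ g.sessions, t.Partner u ∧ (u.sent = z ∨ u.exposed = true)
  responder : ∀ t ∈ g.sessions, t.initiator = false → t.peer ∈ g.corrupted ∨
    ∃ u ∈ g.sessions, t.Partner u
  initiator : ∀ t ∈ g.sessions, ∀ u ∈ g.sessions, t.Partner u →
    t.initiator = true ∨ u.initiator = true
  test : ∀ i s, g.test = some (i, s) → ∃ t ∈ g.sessions, t.owner = i ∧ t.sid = s ∧
    t.exposed = false ∧ (∀ u ∈ g.sessions, t.Partner u → u.exposed = false) ∧
      ∃ u ∈ g.sessions, t.Partner u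

/-- The update of a session leaves alone what is fixed when the session is created, and does not
undo an exposure. -/
structure Keeps (F : Session P → Session P) : Prop where
  owner : ∀ t, (F t).owner = t.owner
  peer : ∀ t, (F t).peer = t.peer
  sid : ∀ t, (F t).sid = t.sid
  initiator : ∀ t, (F t).initiator = t.initiator
  sent : ∀ t, (F t).sent = t.sent
  exposed : ∀ t, t.exposed = true → (F t).exposed = true

theorem Keeps.partner {F : Session P → Session P} (hF : Keeps F) {t u : Session P} :
    (F t).Partner (F u) ↔ t.Partner u := by
  simp [Session.Partner, hF.owner, hF.peer, hF.sid]

theorem Keeps.ite {f : Session P → Session P} (hf : Keeps f) (c : Session P → Bool) :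
    Keeps fun t => if c t then f t else t where
  owner t := by split_ifs; exacts [hf.owner t, rfl]
  peer t := by split_ifs; exacts [hf.peer t, rfl]
  sid t := by split_ifs; exacts [hf.sid t, rfl]
  initiator t := by split_ifs; exacts [hf.initiator t, rfl]
  sent t := by split_ifs; exacts [hf.sent t, rfl]
  exposed t h := by split_ifs; exacts [hf.exposed t h, h]

theorem Inv.eq_of_id {g : Game P} (hg : Inv g) {t u : Session P} (ht : t ∈ g.sessions)
    (hu : u ∈ g.sessions) (ho : t.owner = u.owner) (hs : t.sid = u.sid) : t = u :=
  List.inj_on_of_nodup_map hg.nodup ht hu (by rw [ho, hs])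

/-- Updating sessions preserves the invariants if messages are only received from a possible source
and nothing protected is exposed. -/
theorem Inv.map {g : Game P} (hg : Inv g) {F : Session P → Session P} (hF : Keeps F)
    {corr : Finset ℕ} (hc : g.corrupted ⊆ corr)
    (h1 : ∀ t ∈ g.sessions, (F t).stopped = true → (F t).exposed = true)
    (h2 : ∀ t ∈ g.sessions, (F t).output.isSome = (F t).received.isSome)
    (h3 : ∀ t ∈ g.sessions, ∀ z, (F t).received = some z → t.received = some z ∨
      g.Source t.peer t.owner t.sid z)
    (h4 : ∀ t ∈ g.sessions, g.Protected t → (F t).exposed = t.exposed) :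
    Inv { g with corrupted := corr, sessions := g.sessions.map F } where
  nodup := by
    have : (fun t : Session P => (t.owner, t.sid)) ∘ F = fun t => (t.owner, t.sid) := by
      funext t; simp [hF.owner, hF.sid]
    rw [List.map_map, this]
    exact hg.nodup
  ne t ht := by
    replace ht := List.mem_map.1 ht
    obtain ⟨t, ht, rfl⟩ := ht
    rw [hF.owner, hF.peer]
    exact hg.ne t ht
  stopped t ht := by
    replace ht := List.mem_map.1 ht
    obtain ⟨t, ht, rfl⟩ := ht
    exact h1 t ht
  output t ht := by
    replace ht := List.mem_map.1 ht
    obtain ⟨t, ht, rfl⟩ := ht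
    exact h2 t ht
  received t ht z hz := by
    replace ht := List.mem_map.1 ht
    obtain ⟨t, ht, rfl⟩ := ht
    rw [hF.peer]
    rcases h3 t ht z hz with h | h | ⟨u, hu, ho, hp, hs, h⟩
    · rcases hg.received t ht z h with h | ⟨u, hu, hp, h⟩
      · exact Or.inl (hc h)
      · refine Or.inr ⟨F u, List.mem_map_of_mem hu, hF.partner.2 hp, ?_⟩
        rw [hF.sent]
        exact h.imp_right (hF.exposed u)
    · exact Or.inl (hc h)
    · refine Or.inr ⟨F u, List.mem_map_of_mem hu, hF.partner.2 ⟨hp.symm, ho.symm, hs.symm⟩, ?_⟩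
      rw [hF.sent]
      exact h.imp_right fun h => hF.exposed u (hg.stopped u hu h)
  responder t ht hi := by
    replace ht := List.mem_map.1 ht
    obtain ⟨t, ht, rfl⟩ := ht
    rw [hF.initiator] at hi
    rw [hF.peer]
    refine (hg.responder t ht hi).imp (@hc _) ?_
    rintro ⟨u, hu, hp⟩
    exact ⟨F u, List.mem_map_of_mem hu, hF.partner.2 hp⟩
  initiator t ht u hu hp := by
    replace ht := List.mem_map.1 ht
    obtain ⟨t, ht, rfl⟩ := ht
    replace hu := List.mem_map.1 hu
    obtain ⟨u, hu, rfl⟩ := hu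
    rw [hF.initiator, hF.initiator]
    exact hg.initiator t ht u hu (hF.partner.1 hp)
  test i s hts := by
    obtain ⟨t, ht, ho, hs, he, hpe, u, hu, hp⟩ := hg.test i s hts
    have hts' : g.test = some (t.owner, t.sid) := by rw [ho, hs]; exact hts
    refine ⟨F t, List.mem_map_of_mem ht, (hF.owner t).trans ho, (hF.sid t).trans hs, ?_, ?_,
      F u, List.mem_map_of_mem hu, hF.partner.2 hp⟩
    · rw [h4 t ht ⟨t, ht, hts', Or.inl ⟨rfl, rfl⟩⟩, he]
    · intro v hv hpv
      replace hv := List.mem_map.1 hv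
      obtain ⟨v, hv, rfl⟩ := hv
      have hpv' := hF.partner.1 hpv
      rw [h4 v hv ⟨t, ht, hts', Or.inr hpv'⟩]
      exact hpe v hv hpv'

theorem Inv.modify {g : Game P} (hg : Inv g) {f : Session P → Session P} (hf : Keeps f) (i s : ℕ)
    (h1 : ∀ t ∈ g.sessions, t.owner = i → t.sid = s → ((f t).stopped = true →
      (f t).exposed = true) ∧ (f t).output.isSome = (f t).received.isSome ∧
      (∀ z, (f t).received = some z → t.received = some z ∨ g.Source t.peer t.owner t.sid z) ∧
      (g.Protected t → (f t).exposed = t.exposed)) : Inv (g.modify i s f) := by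
  refine hg.map (hf.ite fun t => t.owner == i && t.sid == s) (Finset.Subset.refl _) ?_ ?_ ?_ ?_
  all_goals
    intro t ht
    split_ifs with h
  · simp only [Bool.and_eq_true, beq_iff_eq] at h
    exact (h1 t ht h.1 h.2).1
  · exact hg.stopped t ht
  · simp only [Bool.and_eq_true, beq_iff_eq] at h
    exact (h1 t ht h.1 h.2).2.1
  · exact hg.output t ht
  · simp only [Bool.and_eq_true, beq_iff_eq] at h
    exact (h1 t ht h.1 h.2).2.2.1
  · exact fun z hz => Or.inl hz
  · simp only [Bool.and_eq_true, beq_iff_eq] at h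
    exact (h1 t ht h.1 h.2).2.2.2
  · exact fun _ => rfl

/-- Adding an unexposed session with a new session-id preserves the invariants. Its partner, if it
is there already, is an initiator: a responder is created after its partner, or when its peer is
corrupted, whereas the owner of the new session is not. -/
theorem Inv.push {g : Game P} (hg : Inv g) {t : Session P} (hid : g.find t.owner t.sid = none)
    (hc : t.owner ∉ g.corrupted) (hne : t.owner ≠ t.peer) (hst : t.stopped = false)
    (he : t.exposed = false) (ho : t.output.isSome = t.received.isSome)
    (hr : ∀ z, t.received = some z → g.Source t.peer t.owner t.sid z)
    (hi : t.initiator = false → t.peer ∈ g.corrupted ∨ ∃ u ∈ g.sessions, t.Partner u) :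
    Inv (g.push t) := by
  have hmem : ∀ u, u ∈ (g.push t).sessions ↔ u ∈ g.sessions ∨ u = t := by
    intro u; simp [Game.push]
  have hself : ¬ t.Partner t := fun h => hne h.1
  rw [find_none] at hid
  -- a session whose partner is created later is no responder
  have hlater : ∀ u ∈ g.sessions, u.Partner t → u.initiator = true := by
    intro u hu hp
    cases hui : u.initiator with
    | true => rfl
    | false =>
      rcases hg.responder u hu hui with h | ⟨v, hv, hpv⟩
      · rw [hp.2.1] at h
        exact absurd h hc
      · exact absurd (hpv.2.2.symm.trans hp.2.2) (hid v hv (hpv.2.1.symm.trans hp.2.1))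
  have hsym : ∀ u : Session P, t.Partner u → u.Partner t := fun u h =>
    ⟨h.2.1.symm, h.1.symm, h.2.2.symm⟩
  constructor
  · have : ((g.push t).sessions.map fun t => (t.owner, t.sid)) =
        g.sessions.map (fun t => (t.owner, t.sid)) ++ [(t.owner, t.sid)] := by simp [Game.push]
    rw [this, List.nodup_append]
    refine ⟨hg.nodup, List.nodup_singleton _, ?_⟩
    intro a ha b hb hab
    obtain ⟨u, hu, rfl⟩ := List.mem_map.1 ha
    rw [List.mem_singleton] at hb
    rw [hb, Prod.mk.injEq] at hab
    exact hid u hu hab.1 hab.2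
  · intro u hu
    rcases (hmem u).1 hu with hu | rfl
    exacts [hg.ne u hu, hne]
  · intro u hu
    rcases (hmem u).1 hu with hu | rfl
    · exact hg.stopped u hu
    · rw [hst]; exact fun h => by cases h
  · intro u hu
    rcases (hmem u).1 hu with hu | rfl
    exacts [hg.output u hu, ho]
  · intro u hu z hz
    rcases (hmem u).1 hu with hu | rfl
    · refine (hg.received u hu z hz).imp_right ?_
      rintro ⟨v, hv, h⟩
      exact ⟨v, (hmem v).2 (Or.inl hv), h⟩
    · refine (hr z hz).imp_right ?_
      rintro ⟨v, hv, h1, h2, h3, h4⟩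
      exact ⟨v, (hmem v).2 (Or.inl hv), ⟨h2.symm, h1.symm, h3.symm⟩,
        h4.imp_right (hg.stopped v hv)⟩
  · intro u hu hui
    rcases (hmem u).1 hu with hu | rfl
    · refine (hg.responder u hu hui).imp_right ?_
      rintro ⟨v, hv, h⟩
      exact ⟨v, (hmem v).2 (Or.inl hv), h⟩
    · refine (hi hui).imp_right ?_
      rintro ⟨v, hv, h⟩
      exact ⟨v, (hmem v).2 (Or.inl hv), h⟩
  · intro u hu v hv hp
    replace hu := (hmem u).1 hu
    replace hv := (hmem v).1 hv
    rcases hu with hu | rfl <;> rcases hv with hv | rfl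
    · exact hg.initiator u hu v hv hp
    · exact Or.inl (hlater u hu hp)
    · exact Or.inr (hlater v hv (hsym v hp))
    · exact absurd hp hself
  · intro i s hts
    obtain ⟨u, hu, h1, h2, h3, h4, v, hv, hp⟩ := hg.test i s hts
    refine ⟨u, (hmem u).2 (Or.inl hu), h1, h2, h3, ?_, v, (hmem v).2 (Or.inl hv), hp⟩
    intro w hw hpw
    rcases (hmem w).1 hw with hw | rfl
    exacts [h4 w hw hpw, he]

/-- A fresh session with output has received the message of its partner. -/
theorem Inv.exists_partner {g : Game P} (hg : Inv g) {t : Session P} (ht : t ∈ g.sessions)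
    (ho : t.output.isSome) (hf : g.Fresh t) :
    ∃ u ∈ g.sessions, t.Partner u ∧ t.received = some u.sent := by
  rw [hg.output t ht, Option.isSome_iff_exists] at ho
  obtain ⟨z, hz⟩ := ho
  rcases hg.received t ht z hz with h | ⟨u, hu, hp, h | h⟩
  · obtain ⟨u, hu, hm⟩ := hf.2.2 h
    exact ⟨u, hu, hm.1, hm.2.1⟩
  · exact ⟨u, hu, hp, h ▸ hz⟩
  · rw [hf.2.1 u hu hp] at h
    cases h

theorem Inv.move {sk : P.R × P.R} {pk : P.R} {g g' : Game P} (hg : Inv g)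
    (h : Move sk pk g g') : Inv g' := by
  cases h with
  | establish i j s hij hc hf =>
    exact hg.push hf hc hij rfl rfl rfl (fun z hz => by cases hz) fun h => by cases h
  | mark i s =>
    refine Inv.modify hg ?_ i s ?_
    · exact ⟨fun _ => rfl, fun _ => rfl, fun _ => rfl, fun _ => rfl, fun _ => rfl, fun _ h => h⟩
    · exact fun t ht _ _ => ⟨hg.stopped t ht, hg.output t ht, fun z hz => Or.inl hz, fun _ => rfl⟩
  | respond i j s z hij hc hf hs =>
    refine hg.push hf hc hij.symm rfl rfl rfl (fun z' hz => ?_) fun _ => hs.imp_right ?_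
    · cases hz
      exact hs
    · rintro ⟨u, hu, h1, h2, h3, -⟩
      exact ⟨u, hu, h2.symm, h1.symm, h3.symm⟩
  | complete i j s z t sk' hf hsk hp hs =>
    refine Inv.modify hg ?_ j s ?_
    · exact ⟨fun _ => rfl, fun _ => rfl, fun _ => rfl, fun _ => rfl, fun _ => rfl, fun _ h => h⟩
    refine fun u hu ho hsid => ⟨hg.stopped u hu, rfl, fun z' hz => ?_, fun _ => rfl⟩
    obtain ⟨ht, hto, hts⟩ := find_some hf
    obtain rfl := hg.eq_of_id hu ht (ho.trans hto.symm) (hsid.trans hts.symm)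
    cases hz
    rw [hp, ho, hsid]
    exact Or.inr hs
  | stateReveal i s t hf hpr | keyReveal i s t hf hpr =>
    refine Inv.modify hg ?_ i s ?_
    · exact ⟨fun _ => rfl, fun _ => rfl, fun _ => rfl, fun _ => rfl, fun _ => rfl, fun _ _ => rfl⟩
    refine fun u hu ho hsid => ⟨fun _ => rfl, hg.output u hu, fun z hz => Or.inl hz,
      fun hpu => ?_⟩
    obtain ⟨ht, hto, hts⟩ := find_some hf
    obtain rfl := hg.eq_of_id hu ht (ho.trans hto.symm) (hsid.trans hts.symm)
    exact absurd hpu hpr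
  | expire i s =>
    refine Inv.modify hg ?_ i s ?_
    · exact ⟨fun _ => rfl, fun _ => rfl, fun _ => rfl, fun _ => rfl, fun _ => rfl, fun _ h => h⟩
    · exact fun t ht _ _ => ⟨hg.stopped t ht, hg.output t ht, fun z hz => Or.inl hz, fun _ => rfl⟩
  | corrupt i hpr =>
    have hk : Keeps fun t : Session P => { t with exposed := true } :=
      ⟨fun _ => rfl, fun _ => rfl, fun _ => rfl, fun _ => rfl, fun _ => rfl, fun _ _ => rfl⟩
    refine hg.map (hk.ite fun t => t.owner == i && !t.expired) (Finset.subset_insert _ _)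
      ?_ ?_ ?_ ?_
    all_goals
      intro t ht
      split_ifs with h
    · exact fun _ => rfl
    · exact hg.stopped t ht
    · exact hg.output t ht
    · exact hg.output t ht
    · exact fun z hz => Or.inl hz
    · exact fun z hz => Or.inl hz
    · intro hp
      simp only [Bool.and_eq_true, beq_iff_eq, Bool.not_eq_true'] at h
      rw [hpr t ht h.1 hp] at h
      cases h.2
    · exact fun _ => rfl
  | test i s t hf ho hn hfr =>
    obtain ⟨ht, hto, hts⟩ := find_some hf
    refine ⟨hg.nodup, hg.ne, hg.stopped, hg.output, hg.received, hg.responder, hg.initiator,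
      fun i' s' h => ?_⟩
    cases h
    obtain ⟨u, hu, hp, -⟩ := hg.exists_partner ht ho hfr
    exact ⟨t, ht, hto, hts, hfr.1, hfr.2.1, u, hu, hp⟩

theorem Inv.init : Inv (Game.init P) := by
  constructor <;> simp [Game.init]

theorem Inv.moves {sk : P.R × P.R} {pk : P.R} {g g' : Game P} (hg : Inv g)
    (h : Relation.ReflTransGen (Move sk pk) g g') : Inv g' := by
  induction h with
  | refl => exact hg
  | tail _ h ih => exact ih.move h

theorem Inv.genStep {g : Game P} (hg : Inv g) (N : ℕ) (sk : P.R × P.R) (pk : P.R) (tk : P.R → P.R)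
    (Q : Query P) : Inv (genStep N sk pk tk g Q).2 :=
  hg.moves (genStep_moves N sk pk tk hg.ne Q)

/-- Every session has an honest secret pair, from which its outgoing message and its key are
computed. -/
def Honest (h : P.R) (g : Game P) : Prop :=
  ∀ t ∈ g.sessions, ∃ sk ∈ (sampleSecret P).support, t.sent = pubKey h sk ∧
    (∀ sk', t.secret = some sk' → sk' = sk) ∧ t.output = t.received.map (sharedKey sk)

theorem Honest.move {h : P.R} {sk : P.R × P.R} (hsk : sk ∈ (sampleSecret P).support)
    {g g' : Game P} (hI : Inv g) (hg : Honest h g) (hm : Move sk (pubKey h sk) g g') :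
    Honest h g' := by
  have hpush : ∀ t : Session P, t.sent = pubKey h sk → (∀ sk', t.secret = some sk' → sk' = sk) →
      t.output = t.received.map (sharedKey sk) → Honest h (g.push t) := by
    intro t h1 h2 h3 u hu
    rcases List.mem_append.1 hu with hu | hu
    · exact hg u hu
    · rw [List.mem_singleton] at hu
      subst hu
      exact ⟨sk, hsk, h1, h2, h3⟩
  have hmap : ∀ (F : Session P → Session P) (corr : Finset ℕ), (∀ t, (F t).sent = t.sent ∧
      (F t).secret = t.secret ∧ (F t).output = t.output ∧ (F t).received = t.received) →
      Honest h { g with corrupted := corr, sessions := g.sessions.map F } := by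
    intro F corr hF t ht
    replace ht := List.mem_map.1 ht
    obtain ⟨t, ht, rfl⟩ := ht
    obtain ⟨h1, h2, h3, h4⟩ := hF t
    rw [h1, h2, h3, h4]
    exact hg t ht
  cases hm with
  | establish i j s => exact hpush _ rfl (fun sk' h => by cases h; rfl) rfl
  | respond i j s z => exact hpush _ rfl (fun sk' h => by cases h) rfl
  | mark i s | stateReveal i s | keyReveal i s | expire i s | corrupt i =>
    refine hmap _ _ fun t => ?_
    split_ifs <;> exact ⟨rfl, rfl, rfl, rfl⟩
  | test i s => exact hg
  | complete i j s z t sk' hf hs hp hsrc =>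
    intro u hu
    replace hu := List.mem_map.1 hu
    obtain ⟨u, hu, rfl⟩ := hu
    dsimp only
    split_ifs with hc
    · simp only [Bool.and_eq_true, beq_iff_eq] at hc
      obtain ⟨ht, hto, hts⟩ := find_some hf
      obtain rfl := hI.eq_of_id hu ht (hc.1.trans hto.symm) (hc.2.trans hts.symm)
      obtain ⟨sk₀, h0, h1, h2, -⟩ := hg u hu
      refine ⟨sk₀, h0, h1, (fun _ h => by simp at h), ?_⟩
      rw [h2 sk' hs]
      rfl
    · exact hg u hu

theorem Honest.moves {h : P.R} {sk : P.R × P.R} (hsk : sk ∈ (sampleSecret P).support)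
    {g g' : Game P} (hI : Inv g) (hg : Honest h g)
    (hm : Relation.ReflTransGen (Move sk (pubKey h sk)) g g') : Honest h g' := by
  have : Inv g' ∧ Honest h g' := by
    induction hm with
    | refl => exact ⟨hI, hg⟩
    | tail _ hm ih => exact ⟨ih.1.move hm, ih.2.move hsk ih.1 hm⟩
  exact this.2

theorem Honest.genStep {h : P.R} {sk : P.R × P.R} (hsk : sk ∈ (sampleSecret P).support)
    {g : Game P} (hI : Inv g) (hg : Honest h g) (N : ℕ) (tk : P.R → P.R) (Q : Query P) :
    Honest h (genStep N sk (pubKey h sk) tk g Q).2 :=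
  hg.moves hsk hI (genStep_moves N sk _ tk hI.ne Q)

theorem Honest.output_eq {h : P.R} {g : Game P} (hg : Honest h g) {t u : Session P}
    (ht : t ∈ g.sessions) (hm : t.received = some u.sent) {sk : P.R × P.R}
    (hsk : sk ∈ (sampleSecret P).support) (hs : u.sent = pubKey h sk) :
    t.output = some (sharedKey sk t.sent) := by
  obtain ⟨sk', h1, h2, -, h3⟩ := hg t ht
  rw [h3, hm, h2, hs, Option.map_some, sharedKey_pubKey h1 hsk]

theorem matchingKeysAgree (N : ℕ) : MatchingKeysAgree P N := by
  intro h _ b g hr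
  have key : Inv g ∧ Honest h g := by
    induction hr with
    | init => exact ⟨Inv.init, fun t ht => by cases ht⟩
    | @step g g' Q v _ hs ih =>
      rw [answer_eq] at hs
      obtain ⟨sk, hsk, he⟩ := (PMF.mem_support_map_iff _ _ _).1 hs
      obtain ⟨hI, hH⟩ := ih
      have : g' = (realStep N h b sk g Q).2 := by rw [he]
      rw [this]
      exact ⟨hI.genStep _ _ _ _ _, hH.genStep hsk hI _ _ _⟩
  obtain ⟨-, hH⟩ := key
  intro t ht u hu _ _ hm _ _
  obtain ⟨sk, h1, h2, -, h3⟩ := hH u hu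
  rw [hH.output_eq ht hm.2.1 h1 h2, h3, hm.2.2, Option.map_some]

end Step

/-! ### How one step changes the list of sessions -/

section Steps

variable {P : Params}

/-- Owner, peer and session-id. -/
def Session.key (t : Session P) : ℕ × ℕ × ℕ := (t.owner, t.peer, t.sid)

/-- The key of the partner. -/
def swapKey (x : ℕ × ℕ × ℕ) : ℕ × ℕ × ℕ := (x.2.1, x.1, x.2.2)

@[simp] theorem swapKey_swapKey (x : ℕ × ℕ × ℕ) : swapKey (swapKey x) = x := rfl

theorem partner_iff {t u : Session P} : t.Partner u ↔ u.key = swapKey t.key := by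
  simp only [Session.Partner, Session.key, swapKey, Prod.mk.injEq]
  constructor
  · rintro ⟨h1, h2, h3⟩; exact ⟨h2.symm, h1.symm, h3.symm⟩
  · rintro ⟨h1, h2, h3⟩; exact ⟨h2.symm, h1.symm, h3.symm⟩

/-- The key of the session that a query may create. -/
def newKey (g : Game P) : Query P → Option (ℕ × ℕ × ℕ)
  | .establish i j s => some (i, j, s)
  | .deliver i s => (g.find i s).map fun t => (t.peer, i, s)
  | .inject i j s _ => some (j, i, s)
  | _ => none

/-- Whether the query activates an initiator. -/
def Query.isEstablish : Query P → Bool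
  | .establish _ _ _ => true
  | _ => false

/-- Whether the query is the test. -/
def Query.isTest : Query P → Bool
  | .test _ _ => true
  | _ => false

/-- What is known of a session `t` that the query `Q` creates, with outgoing message `pk`. -/
structure Created (g : Game P) (Q : Query P) (pk : P.R) (t : Session P) : Prop where
  key : newKey g Q = some t.key
  find : g.find t.owner t.sid = none
  owner : t.owner ∉ g.corrupted
  sent : t.sent = pk
  initiator : t.initiator = Q.isEstablish
  exposed : t.exposed = false

theorem Keeps.id : Keeps (fun t : Session P => t) :=
  ⟨fun _ => rfl, fun _ => rfl, fun _ => rfl, fun _ => rfl, fun _ => rfl, fun _ h => h⟩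

theorem Keeps.key {F : Session P → Session P} (hF : Keeps F) (t : Session P) :
    (F t).key = t.key := by
  simp [Session.key, hF.owner, hF.peer, hF.sid]

theorem Keeps.modify {f : Session P → Session P} (hf : Keeps f) (i s : ℕ) :
    Keeps fun t => if t.owner == i && t.sid == s then f t else t :=
  hf.ite fun t => t.owner == i && t.sid == s

theorem find_modify (g : Game P) {f : Session P → Session P} (hf : Keeps f) (i s j s' : ℕ) :
    (g.modify i s f).find j s' = none ↔ g.find j s' = none := by
  rw [find_none, find_none]
  have hF := hf.modify i s
  constructor
  · intro h t ht
    have := h _ (List.mem_map_of_mem ht)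
    rwa [hF.owner, hF.sid] at this
  · intro h t ht
    replace ht := List.mem_map.1 ht
    obtain ⟨t, ht, rfl⟩ := ht
    rw [hF.owner, hF.sid]
    exact h t ht

theorem recvStep_sessions (sk : P.R × P.R) (pk : P.R) (g : Game P) (i j s : ℕ) (z : P.R) :
    ∃ F : Session P → Session P, Keeps F ∧ ((recvStep sk pk g i j s z).2.sessions =
      g.sessions.map F ∨ ∃ t : Session P, (t.key = (j, i, s) ∧ g.find j s = none ∧
        j ∉ g.corrupted ∧ t.sent = pk ∧ t.initiator = false ∧ t.exposed = false) ∧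
        (recvStep sk pk g i j s z).2.sessions = g.sessions.map F ++ [t]) := by
  have hid : g.sessions = g.sessions.map fun t => t := by simp
  unfold recvStep
  split_ifs with h1
  · exact ⟨_, .id, Or.inl hid⟩
  · cases hf : g.find j s with
    | none =>
      refine ⟨_, .id, Or.inr ⟨
        { owner := j, peer := i, sid := s, initiator := false, secret := none,
          sent := pk, received := some z, output := some (sharedKey sk z) },
        ⟨rfl, rfl, h1, rfl, rfl, rfl⟩, ?_⟩⟩
      dsimp only [Game.push]
      rw [← hid]
    | some t =>
      dsimp only
      cases t.secret with
      | none => exact ⟨_, .id, Or.inl hid⟩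
      | some sk' =>
        dsimp only
        split_ifs
        · refine ⟨_, Keeps.modify ?_ j s, Or.inl rfl⟩
          exact ⟨fun _ => rfl, fun _ => rfl, fun _ => rfl, fun _ => rfl, fun _ => rfl, fun _ h => h⟩
        · exact ⟨_, .id, Or.inl hid⟩

/-- The effect of a step on the list of sessions: old ones are updated, and at most one is added. -/
theorem genStep_sessions (N : ℕ) (sk : P.R × P.R) (pk : P.R) (tk : P.R → P.R) (g : Game P)
    (Q : Query P) : ∃ F : Session P → Session P, Keeps F ∧
      ((genStep N sk pk tk g Q).2.sessions = g.sessions.map F ∨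
        ∃ t, Created g Q pk t ∧ (genStep N sk pk tk g Q).2.sessions = g.sessions.map F ++ [t]) := by
  have hid : g.sessions = g.sessions.map fun t => t := by simp
  cases Q with
  | establish i j s =>
    simp only [genStep]
    split_ifs with h
    · refine ⟨_, .id, Or.inr ⟨
      { owner := i, peer := j, sid := s, initiator := true, secret := some sk,
        sent := pk, received := none, output := none },
        ⟨rfl, h.2.2.2.2, h.2.2.2.1, rfl, rfl, rfl⟩, ?_⟩⟩
      dsimp only [Game.push]
      rw [← hid]
    · exact ⟨_, .id, Or.inl hid⟩
  | deliver i s =>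
    simp only [genStep]
    cases hf : g.find i s with
    | none => exact ⟨_, .id, Or.inl hid⟩
    | some t =>
      dsimp only
      split_ifs
      · exact ⟨_, .id, Or.inl hid⟩
      · have hk : Keeps fun t : Session P => { t with delivered := true } :=
          ⟨fun _ => rfl, fun _ => rfl, fun _ => rfl, fun _ => rfl, fun _ => rfl, fun _ h => h⟩
        have hK := hk.modify i s
        obtain ⟨F, hF, h⟩ := recvStep_sessions sk pk
          (g.modify i s fun t => { t with delivered := true }) i t.peer s t.sent
        refine ⟨fun u => F (if u.owner == i && u.sid == s then { u with delivered := true } else u),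
          ⟨fun u => ?_, fun u => ?_, fun u => ?_, fun u => ?_, fun u => ?_, fun u hu => ?_⟩, ?_⟩
        · rw [hF.owner, hK.owner]
        · rw [hF.peer, hK.peer]
        · rw [hF.sid, hK.sid]
        · rw [hF.initiator, hK.initiator]
        · rw [hF.sent, hK.sent]
        · exact hF.exposed _ (hK.exposed _ hu)
        · rcases h with h | ⟨u, ⟨h1, h2, h3, h4, h5, h6⟩, h⟩
          · left
            rw [h, Game.modify, List.map_map]
            rfl
          · right
            refine ⟨u, ⟨?_, ?_, ?_, h4, h5, h6⟩, ?_⟩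
            · simp [newKey, hf, h1]
            · rw [find_modify g hk] at h2
              obtain ⟨e1, e2⟩ := Prod.mk.inj h1
              rw [e1, (Prod.mk.inj e2).2]
              exact h2
            · rw [(Prod.mk.inj h1).1]
              exact h3
            · rw [h, Game.modify, List.map_map]
              rfl
  | inject i j s z =>
    simp only [genStep]
    split_ifs
    · obtain ⟨F, hF, h⟩ := recvStep_sessions sk pk g i j s z
      refine ⟨F, hF, h.imp_right ?_⟩
      rintro ⟨u, ⟨h1, h2, h3, h4, h5, h6⟩, h⟩
      obtain ⟨e1, e2⟩ := Prod.mk.inj h1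
      refine ⟨u, ⟨?_, ?_, ?_, h4, h5, h6⟩, h⟩
      · simp [newKey, h1]
      · rw [e1, (Prod.mk.inj e2).2]
        exact h2
      · rw [e1]
        exact h3
    · exact ⟨_, .id, Or.inl hid⟩
  | stateReveal i s | expire i s =>
    simp only [genStep]
    cases g.find i s with
    | none => exact ⟨_, .id, Or.inl hid⟩
    | some t =>
      dsimp only
      split_ifs
      · refine ⟨_, Keeps.modify ?_ i s, Or.inl rfl⟩
        exact ⟨fun _ => rfl, fun _ => rfl, fun _ => rfl, fun _ => rfl, fun _ => rfl,
          fun _ h => by first | exact h | rfl⟩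
      · exact ⟨_, .id, Or.inl hid⟩
  | keyReveal i s =>
    simp only [genStep]
    cases g.find i s with
    | none => exact ⟨_, .id, Or.inl hid⟩
    | some t =>
      dsimp only
      cases t.output with
      | none => exact ⟨_, .id, Or.inl hid⟩
      | some key =>
        dsimp only
        split_ifs
        · refine ⟨_, Keeps.modify ?_ i s, Or.inl rfl⟩
          exact ⟨fun _ => rfl, fun _ => rfl, fun _ => rfl, fun _ => rfl, fun _ => rfl,
            fun _ _ => rfl⟩
        · exact ⟨_, .id, Or.inl hid⟩
  | corrupt i =>
    simp only [genStep]
    split_ifs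
    · refine ⟨_, Keeps.ite ?_ fun t => t.owner == i && !t.expired, Or.inl rfl⟩
      exact ⟨fun _ => rfl, fun _ => rfl, fun _ => rfl, fun _ => rfl, fun _ => rfl, fun _ _ => rfl⟩
    · exact ⟨_, .id, Or.inl hid⟩
  | test i s =>
    simp only [genStep]
    cases g.find i s with
    | none => exact ⟨_, .id, Or.inl hid⟩
    | some t =>
      dsimp only
      cases t.output with
      | none => exact ⟨_, .id, Or.inl hid⟩
      | some key =>
        dsimp only
        split_ifs <;> exact ⟨_, .id, Or.inl hid⟩

theorem recvStep_test (sk : P.R × P.R) (pk : P.R) (g : Game P) (i j s : ℕ) (z : P.R) :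
    (recvStep sk pk g i j s z).2.test = g.test := by
  unfold recvStep
  split_ifs
  · rfl
  · cases g.find j s with
    | none => rfl
    | some t =>
      dsimp only
      cases t.secret with
      | none => rfl
      | some sk' =>
        dsimp only
        split_ifs <;> rfl

theorem genStep_test (N : ℕ) (sk : P.R × P.R) (pk : P.R) (tk : P.R → P.R) (g : Game P)
    (Q : Query P) (h : Q.isTest = true → g.test ≠ none) :
    (genStep N sk pk tk g Q).2.test = g.test := by
  cases Q with
  | establish i j s =>
    simp only [genStep]
    split_ifs <;> rfl
  | deliver i s =>
    simp only [genStep]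
    cases g.find i s with
    | none => rfl
    | some t =>
      dsimp only
      split_ifs
      · rfl
      · rw [recvStep_test]
        rfl
  | inject i j s z =>
    simp only [genStep]
    split_ifs
    · rw [recvStep_test]
    · rfl
  | stateReveal i s | expire i s =>
    simp only [genStep]
    cases g.find i s with
    | none => rfl
    | some t =>
      dsimp only
      split_ifs <;> rfl
  | keyReveal i s =>
    simp only [genStep]
    cases g.find i s with
    | none => rfl
    | some t =>
      dsimp only
      cases t.output with
      | none => rfl
      | some key =>
        dsimp only
        split_ifs <;> rfl
  | corrupt i =>
    simp only [genStep]
    split_ifs <;> rfl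
  | test i s =>
    simp only [genStep]
    cases g.find i s with
    | none => rfl
    | some t =>
      dsimp only
      cases t.output with
      | none => rfl
      | some key =>
        dsimp only
        rw [if_neg fun hc => h rfl hc.1]

theorem genStep_test_ne_none (N : ℕ) (sk : P.R × P.R) (pk : P.R) (tk : P.R → P.R) {g : Game P}
    (Q : Query P) (h : g.test ≠ none) : (genStep N sk pk tk g Q).2.test ≠ none := by
  rwa [genStep_test N sk pk tk g Q fun _ => h]

/-- Only the answer to a test depends on how keys are tested. -/
theorem genStep_congr_test (N : ℕ) (sk : P.R × P.R) (pk : P.R) {tk tk' : P.R → P.R} (g : Game P)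
    (Q : Query P) (h : ∀ i s t key, Q = .test i s → g.find i s = some t → t.output = some key →
      g.test = none → t.expired = false → g.Fresh t → tk key = tk' key) :
    genStep N sk pk tk g Q = genStep N sk pk tk' g Q := by
  cases Q with
  | test i s =>
    simp only [genStep]
    cases hf : g.find i s with
    | none => rfl
    | some t =>
      dsimp only
      cases ho : t.output with
      | none => rfl
      | some key =>
        dsimp only
        split_ifs with hc
        · rw [h i s t key rfl hf ho hc.1 hc.2.1 hc.2.2]
        · rfl
  | _ => rfl

theorem genStep_snd_congr_test (N : ℕ) (sk : P.R × P.R) (pk : P.R) (tk tk' : P.R → P.R)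
    (g : Game P) (Q : Query P) :
    (genStep N sk pk tk g Q).2 = (genStep N sk pk tk' g Q).2 := by
  cases Q with
  | test i s =>
    simp only [genStep]
    cases hf : g.find i s with
    | none => rfl
    | some t =>
      dsimp only
      cases ho : t.output with
      | none => rfl
      | some key =>
        dsimp only
        split_ifs <;> rfl
  | _ => rfl

/-- The secret pair that is drawn does not matter, unless a new session is created or the query is
the test. -/
theorem genStep_congr_secret (N : ℕ) (sk sk' : P.R × P.R) (pk pk' : P.R) (tk tk' : P.R → P.R)
    (g : Game P) (Q : Query P) (ht : Q.isTest = true → g.test ≠ none)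
    (hk : ∀ y, newKey g Q = some y → g.find y.1 y.2.2 ≠ none) :
    genStep N sk pk tk g Q = genStep N sk' pk' tk' g Q := by
  have hr : ∀ (g : Game P) i j s z, g.find j s ≠ none →
      recvStep sk pk g i j s z = recvStep sk' pk' g i j s z := by
    intro g i j s z h
    unfold recvStep
    split_ifs
    · rfl
    · cases hf : g.find j s with
      | none => exact absurd hf h
      | some t => rfl
  cases Q with
  | establish i j s =>
    simp only [genStep]
    have h := hk _ rfl
    rw [if_neg fun hc => h hc.2.2.2.2, if_neg fun hc => h hc.2.2.2.2]
  | deliver i s =>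
    simp only [genStep]
    cases hf : g.find i s with
    | none => rfl
    | some t =>
      dsimp only
      split_ifs
      · rfl
      · refine hr _ _ _ _ _ ?_
        rw [Ne, find_modify]
        · exact hk (t.peer, i, s) (by simp [newKey, hf])
        · exact ⟨fun _ => rfl, fun _ => rfl, fun _ => rfl, fun _ => rfl, fun _ => rfl, fun _ h => h⟩
  | inject i j s z =>
    simp only [genStep]
    split_ifs
    · exact hr _ _ _ _ _ (hk _ rfl)
    · rfl
  | test i s =>
    simp only [genStep]
    cases g.find i s with
    | none => rfl
    | some t =>
      dsimp only
      cases t.output with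
      | none => rfl
      | some key =>
        dsimp only
        rw [if_neg fun hc => ht rfl hc.1, if_neg fun hc => ht rfl hc.1]
  | _ => rfl

/-- Either the drawn secret pair does not matter, or the session is created. -/
theorem genStep_created (N : ℕ) (sk : P.R × P.R) (pk : P.R) (tk : P.R → P.R) {g : Game P}
    {Q : Query P} {y : ℕ × ℕ × ℕ} (hy : newKey g Q = some y) :
    (∀ sk' pk' tk', genStep N sk' pk' tk' g Q = genStep N sk pk tk g Q) ∨
      ∀ sk' pk' tk', ∃ t, Created g Q pk' t ∧
        t ∈ (genStep N sk' pk' tk' g Q).2.sessions := by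
  have hr : ∀ (g : Game P) i j s z,
      (∀ sk' pk', recvStep sk' pk' g i j s z = recvStep sk pk g i j s z) ∨
      (j ∉ g.corrupted ∧ g.find j s = none ∧ ∀ sk' pk', ∃ t : Session P, t.key = (j, i, s) ∧
        t.sent = pk' ∧ t.initiator = false ∧ t.exposed = false ∧
        t ∈ (recvStep sk' pk' g i j s z).2.sessions) := by
    intro g i j s z
    unfold recvStep
    split_ifs with h1
    · exact Or.inl fun _ _ => rfl
    · cases hf : g.find j s with
      | none =>
        exact Or.inr ⟨h1, rfl, fun sk' pk' => ⟨
          { owner := j, peer := i, sid := s, initiator := false, secret := none,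
            sent := pk', received := some z, output := some (sharedKey sk' z) },
          rfl, rfl, rfl, rfl, List.mem_append_right _ (List.mem_singleton_self _)⟩⟩
      | some t => exact Or.inl fun _ _ => rfl
  cases Q with
  | establish i j s =>
    simp only [genStep]
    split_ifs with h
    · exact Or.inr fun sk' pk' _ => ⟨
      { owner := i, peer := j, sid := s, initiator := true, secret := some sk',
        sent := pk', received := none, output := none },
        ⟨rfl, h.2.2.2.2, h.2.2.2.1, rfl, rfl, rfl⟩,
        List.mem_append_right _ (List.mem_singleton_self _)⟩
    · exact Or.inl fun _ _ _ => rfl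
  | deliver i s =>
    simp only [genStep]
    cases hf : g.find i s with
    | none => exact Or.inl fun _ _ _ => rfl
    | some t =>
      dsimp only
      split_ifs
      · exact Or.inl fun _ _ _ => rfl
      · refine (hr _ _ _ _ _).imp (fun h sk' pk' _ => h sk' pk') ?_
        rintro ⟨h1, h2, h⟩ sk' pk' -
        obtain ⟨u, e, h3, h4, h5, h6⟩ := h sk' pk'
        obtain ⟨e1, e2⟩ := Prod.mk.inj e
        refine ⟨u, ⟨?_, ?_, ?_, h3, h4, h5⟩, h6⟩
        · simp [newKey, hf, e]
        · rw [e1, (Prod.mk.inj e2).2]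
          rwa [find_modify] at h2
          exact ⟨fun _ => rfl, fun _ => rfl, fun _ => rfl, fun _ => rfl, fun _ => rfl, fun _ h => h⟩
        · rw [e1]
          exact h1
  | inject i j s z =>
    simp only [genStep]
    split_ifs
    · refine (hr _ _ _ _ _).imp (fun h sk' pk' _ => h sk' pk') ?_
      rintro ⟨h1, h2, h⟩ sk' pk' -
      obtain ⟨u, e, h3, h4, h5, h6⟩ := h sk' pk'
      obtain ⟨e1, e2⟩ := Prod.mk.inj e
      refine ⟨u, ⟨?_, ?_, ?_, h3, h4, h5⟩, h6⟩
      · simp [newKey, e]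
      · rw [e1, (Prod.mk.inj e2).2]
        exact h2
      · rw [e1]
        exact h1
    · exact Or.inl fun _ _ _ => rfl
  | _ => cases hy

end Steps

/-! ### Guessing the test session -/

section Guess

variable {P : Params}

/-- The keys of the sessions that were activated as initiators, in the order of activation. -/
def initKeys (g : Game P) : List (ℕ × ℕ × ℕ) :=
  (g.sessions.filter fun t => t.initiator).map Session.key

/-- The key is that of the `r`-th initiator or of its partner. -/
def Special (r : ℕ) (g : Game P) (y : ℕ × ℕ × ℕ) : Prop :=
  ∃ x, (initKeys g)[r]? = some x ∧ (y = x ∨ y = swapKey x)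

/-- The guess that the test session is the `r`-th initiator or its partner has failed: another
session is tested, or one of the two is exposed, or the two were already among the earlier
initiators. -/
def Bad (r : ℕ) (g : Game P) : Prop :=
  (∃ t ∈ g.sessions, g.test = some (t.owner, t.sid) ∧ ¬ Special r g t.key) ∨
  (∃ t ∈ g.sessions, Special r g t.key ∧ t.exposed = true) ∨
  (∃ y ∈ (initKeys g).take r, Special r g y)

/-- The guess is correct: there is a test session, and it is the `r`-th initiator or its
partner. -/
def Hit (r : ℕ) (g : Game P) : Prop := g.test ≠ none ∧ ¬ Bad r g

theorem mem_initKeys {g : Game P} {y : ℕ × ℕ × ℕ} :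
    y ∈ initKeys g ↔ ∃ t ∈ g.sessions, t.initiator = true ∧ t.key = y := by
  simp [initKeys, and_assoc]

theorem initKeys_map {L : List (Session P)} {F : Session P → Session P} (hF : Keeps F) :
    ((L.map F).filter fun t => t.initiator).map Session.key =
      (L.filter fun t => t.initiator).map Session.key := by
  rw [List.filter_map, List.map_map]
  have h1 : Session.key ∘ F = Session.key := funext hF.key
  have h2 : (fun t : Session P => t.initiator) ∘ F = fun t => t.initiator :=
    funext hF.initiator
  rw [h1, h2]

theorem initKeys_of_map {g g' : Game P} {F : Session P → Session P} (hF : Keeps F)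
    (h : g'.sessions = g.sessions.map F) : initKeys g' = initKeys g := by
  rw [initKeys, h, initKeys_map hF]
  rfl

theorem initKeys_of_append {g g' : Game P} {F : Session P → Session P} (hF : Keeps F)
    {t : Session P} (h : g'.sessions = g.sessions.map F ++ [t]) :
    initKeys g' = initKeys g ++ if t.initiator then [t.key] else [] := by
  rw [initKeys, h, List.filter_append, List.map_append, initKeys_map hF]
  cases ht : t.initiator <;> simp [initKeys, ht]

theorem getElem?_of_prefix {α : Type} {l l' : List α} (h : l <+: l') {i : ℕ} {x : α}
    (hx : l[i]? = some x) : l'[i]? = some x := by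
  obtain ⟨t, rfl⟩ := h
  rw [List.getElem?_append_left (List.getElem?_eq_some_iff.1 hx).1, hx]

theorem Special.mono {r : ℕ} {g g' : Game P} (h : initKeys g <+: initKeys g') {y : ℕ × ℕ × ℕ}
    (hy : Special r g y) : Special r g' y := by
  obtain ⟨x, hx, hy⟩ := hy
  exact ⟨x, getElem?_of_prefix h hx, hy⟩

theorem initKeys_prefix (N : ℕ) (sk : P.R × P.R) (pk : P.R) (tk : P.R → P.R) (g : Game P)
    (Q : Query P) : initKeys g <+: initKeys (genStep N sk pk tk g Q).2 := by
  obtain ⟨F, hF, h | ⟨t, -, h⟩⟩ := genStep_sessions N sk pk tk g Q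
  · rw [initKeys_of_map hF h]
  · rw [initKeys_of_append hF h]
    exact List.prefix_append _ _

theorem find_ne_none {g : Game P} {t : Session P} (ht : t ∈ g.sessions) :
    g.find t.owner t.sid ≠ none := fun h => find_none.1 h t ht rfl rfl

theorem ne_of_created {g : Game P} {Q : Query P} {pk : P.R} {t : Session P}
    (hc : Created g Q pk t) {u : Session P} (hu : u ∈ g.sessions) : u.key ≠ t.key := by
  intro h
  obtain ⟨h1, h2⟩ := Prod.mk.inj h
  refine find_none.1 hc.find u hu h1 (Prod.mk.inj h2).2

/-- A wrong guess stays wrong. -/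
theorem Bad.step {r : ℕ} {g : Game P} (hI : Inv g) (hb : Bad r g) (N : ℕ) (sk : P.R × P.R)
    (pk : P.R) (tk : P.R → P.R) (Q : Query P) : Bad r (genStep N sk pk tk g Q).2 := by
  have hpre := initKeys_prefix N sk pk tk g Q
  obtain ⟨F, hF, hs⟩ := genStep_sessions N sk pk tk g Q
  have hmem : ∀ t ∈ g.sessions, F t ∈ (genStep N sk pk tk g Q).2.sessions := by
    intro t ht
    rcases hs with h | ⟨u, -, h⟩ <;> rw [h]
    · exact List.mem_map_of_mem ht
    · exact List.mem_append_left _ (List.mem_map_of_mem ht)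
  rcases hb with ⟨t, ht, hts, hn⟩ | ⟨t, ht, hsp, he⟩ | ⟨y, hy, hsp⟩
  · left
    refine ⟨F t, hmem t ht, ?_, ?_⟩
    · rw [genStep_test _ _ _ _ _ _ fun _ => by rw [hts]; exact Option.some_ne_none _, hts,
        hF.owner, hF.sid]
    · rw [hF.key]
      rintro ⟨x, hx, hy⟩
      rcases hs with h | ⟨u, hc, h⟩
      · rw [initKeys_of_map hF h] at hx
        exact hn ⟨x, hx, hy⟩
      · rw [initKeys_of_append hF h] at hx
        split_ifs at hx with hu
        · rw [List.getElem?_append] at hx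
          split_ifs at hx with hr
          · exact hn ⟨x, hx, hy⟩
          · -- the new session is neither the test session nor its partner, which exist already
            have hxu : x = u.key := by
              have := List.mem_of_getElem? hx
              simpa using this
            subst hxu
            obtain ⟨t', ht', h1, h2, -, -, v, hv, hp⟩ := hI.test _ _ hts
            obtain rfl := hI.eq_of_id ht' ht h1 h2
            rw [partner_iff] at hp
            rcases hy with hy | hy
            · exact ne_of_created hc ht hy
            · exact ne_of_created hc hv (by rw [hp, hy, swapKey_swapKey])
        · rw [List.append_nil] at hx
          exact hn ⟨x, hx, hy⟩
  · right; left
    refine ⟨F t, hmem t ht, ?_, hF.exposed t he⟩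
    rw [hF.key]
    exact hsp.mono hpre
  · right; right
    refine ⟨y, ?_, hsp.mono hpre⟩
    exact (hpre.take r).subset hy

theorem Inv.key_eq {g : Game P} (hI : Inv g) {t u : Session P} (ht : t ∈ g.sessions)
    (hu : u ∈ g.sessions) (h : t.key = u.key) : t = u :=
  hI.eq_of_id ht hu (Prod.mk.inj h).1 (Prod.mk.inj (Prod.mk.inj h).2).2

/-- If there is a test session, then exactly one guess is correct: the position of the first
initiator among the test session and its partner. -/
theorem exists_hit {g : Game P} (hI : Inv g) (ht : g.test ≠ none) :
    ∃ r₀ < (initKeys g).length, ∀ r, Hit r g ↔ r = r₀ := by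
  obtain ⟨⟨i, s⟩, hts⟩ := Option.ne_none_iff_exists'.1 ht
  obtain ⟨t, htm, rfl, rfl, he, hpe, u, hu, hp⟩ := hI.test _ _ hts
  have hpk := partner_iff.1 hp
  let p : ℕ × ℕ × ℕ → Bool := fun y => decide (y = t.key ∨ y = swapKey t.key)
  have hex : ∃ y ∈ initKeys g, p y = true := by
    rcases hI.initiator t htm u hu hp with h | h
    · exact ⟨t.key, mem_initKeys.2 ⟨t, htm, h, rfl⟩, by simp [p]⟩
    · exact ⟨u.key, mem_initKeys.2 ⟨u, hu, h, rfl⟩, by simp [p, hpk]⟩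
  have hlt : (initKeys g).findIdx p < (initKeys g).length := List.findIdx_lt_length.2 hex
  have hspec : ∀ y x : ℕ × ℕ × ℕ, (y = x ∨ y = swapKey x) ↔ (x = y ∨ x = swapKey y) := by
    intro y x
    constructor <;> rintro (rfl | rfl) <;> simp
  have hat : (initKeys g)[(initKeys g).findIdx p]? =
      some ((initKeys g)[(initKeys g).findIdx p]) := List.getElem?_eq_getElem hlt
  have hpat : p ((initKeys g)[(initKeys g).findIdx p]) = true := List.findIdx_getElem
  refine ⟨_, hlt, fun r => ⟨?_, ?_⟩⟩
  · rintro ⟨-, hb⟩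
    have hspt : Special r g t.key := by
      by_contra h
      exact hb (Or.inl ⟨t, htm, hts, h⟩)
    obtain ⟨x, hx, hxt⟩ := hspt
    have hpx : p x = true := by simpa [p] using (hspec _ _).1 hxt
    obtain ⟨hr, hxr⟩ := List.getElem?_eq_some_iff.1 hx
    rcases lt_trichotomy r ((initKeys g).findIdx p) with h | h | h
    · have := List.not_of_lt_findIdx h
      rw [hxr, hpx] at this
      cases this
    · exact h
    · refine absurd (Or.inr (Or.inr ⟨_, List.mem_take_iff_getElem.2
        ⟨(initKeys g).findIdx p, lt_min h hlt, rfl⟩, x, hx, ?_⟩)) hb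
      have h1 := of_decide_eq_true hpat
      rcases h1 with h1 | h1 <;> rw [h1] <;> rcases hxt with h2 | h2 <;> rw [h2] <;> simp
  · rintro rfl
    refine ⟨ht, ?_⟩
    have h1 := of_decide_eq_true hpat
    have hsp : ∀ y, Special ((initKeys g).findIdx p) g y ↔ p y = true := by
      intro y
      simp only [Special, hat, Option.some.injEq, exists_eq_left', p, decide_eq_true_eq]
      rcases h1 with h1 | h1 <;> rw [h1]
      rw [swapKey_swapKey, or_comm]
    rintro (⟨v, hv, hvt, hn⟩ | ⟨v, hv, hsv, hev⟩ | ⟨y, hy, hsy⟩)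
    · rw [hts, Option.some.injEq, Prod.mk.injEq] at hvt
      obtain rfl := hI.eq_of_id htm hv hvt.1 hvt.2
      exact hn ((hsp _).2 (by simp [p]))
    · rw [hsp] at hsv
      rcases of_decide_eq_true hsv with h | h
      · rw [hI.key_eq hv htm h, he] at hev
        cases hev
      · rw [hpe v hv (partner_iff.2 h)] at hev
        cases hev
    · obtain ⟨i, hi, rfl⟩ := List.mem_take_iff_getElem.1 hy
      rw [hsp] at hsy
      rw [List.not_of_lt_findIdx (lt_of_lt_of_le hi (min_le_left _ _))] at hsy
      cases hsy

/-! ### Drawing the secrets of the guessed sessions in advance -/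

/-- Which of three secrets a query consumes: `0` for the `r`-th initiator, `1` for its partner, `2`
for the test; `3` for none of them. -/
def slot (r : ℕ) (g : Game P) (Q : Query P) : ℕ :=
  if Q.isTest then 2 else
  match (initKeys g)[r]? with
  | some x => if newKey g Q = some (swapKey x) then 1 else 3
  | none => if Q.isEstablish = true ∧ (initKeys g).length = r then 0 else 3

/-- The secret pair used for a query: `sk`, unless one has been drawn in advance. -/
def pick (f : ℕ → Option (P.R × P.R)) (i : ℕ) (sk : P.R × P.R) : P.R × P.R := (f i).getD sk

/-- The model in which the secrets given by `f` have been drawn in advance. -/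
def eagerOracle (N : ℕ) (h : P.R) (b : Bool) (r : ℕ) (f : ℕ → Option (P.R × P.R)) :
    Oracle P (Game P) := fun v g =>
  (sampleSecret P).map fun sk =>
    realStep N h b (pick f (slot r g (decQuery v)) sk) g (decQuery v)

/-- Whether the secret number `i` has been consumed. -/
def Used (r : ℕ) (i : ℕ) (g : Game P) : Prop :=
  match i with
  | 0 => r < (initKeys g).length
  | 1 => ∃ x, (initKeys g)[r]? = some x ∧ g.find x.2.1 x.2.2 ≠ none
  | _ => g.test ≠ none

/-- A value may be drawn in advance if it is used at most once. -/
theorem interp_eager {S : Type} {α : Type} (μ : PMF α) (O : Oracle P S) (O' : α → Oracle P S)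
    (used : S → Prop) (h1 : ∀ s, used s → ∀ x q, O' x q s = O q s)
    (h2 : ∀ s, used s → ∀ q, ∀ w ∈ (O q s).support, used w.2)
    (h3 : ∀ s, ¬ used s → ∀ q, (∀ x, O' x q s = O q s) ∨
      (O q s = μ.bind fun x => O' x q s) ∧ ∀ x, ∀ w ∈ (O' x q s).support, used w.2)
    (t : Tree P.K) (s : S) :
    (μ.bind fun x => interp (O' x) t s) = interp O t s := by
  have hused : ∀ (t : Tree P.K) s, used s → ∀ x, interp (O' x) t s = interp O t s := by
    intro t
    induction t with
    | ret v c => exact fun _ _ _ => rfl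
    | samp d k ih =>
      intro s hs x
      simp only [interp]
      refine congrArg _ (funext fun v => ?_)
      exact ih v s hs x
    | call q k ih =>
      intro s hs x
      simp only [interp]
      rw [h1 s hs]
      exact bind_congr_support fun w hw => ih _ _ (h2 s hs q w hw) x
  induction t generalizing s with
  | ret v c => simp only [interp, PMF.bind_const]
  | samp d k ih =>
    simp only [interp]
    rw [PMF.bind_comm]
    refine congrArg _ (funext fun v => ?_)
    exact ih v s
  | call q k ih =>
    by_cases hs : used s
    · simp only [hused _ _ hs, PMF.bind_const]
    · simp only [interp]
      rcases h3 s hs q with h | ⟨h, hu⟩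
      · simp only [h]
        rw [PMF.bind_comm]
        refine congrArg _ (funext fun w => ?_)
        exact ih _ _
      · rw [h, PMF.bind_bind]
        refine congrArg _ (funext fun x => ?_)
        exact bind_congr_support fun w hw => hused _ _ (hu x w hw) x

theorem Used.step {r i : ℕ} {g : Game P} (hu : Used r i g) (N : ℕ) (sk : P.R × P.R)
    (pk : P.R) (tk : P.R → P.R) (Q : Query P) : Used r i (genStep N sk pk tk g Q).2 := by
  have hpre := initKeys_prefix N sk pk tk g Q
  match i with
  | 0 => exact lt_of_lt_of_le hu hpre.length_le
  | 1 =>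
    obtain ⟨x, hx, hf⟩ := hu
    refine ⟨x, getElem?_of_prefix hpre hx, ?_⟩
    obtain ⟨F, hF, hs⟩ := genStep_sessions N sk pk tk g Q
    rw [Ne, find_none] at hf ⊢
    push Not at hf ⊢
    obtain ⟨t, ht, h1, h2⟩ := hf
    refine ⟨F t, ?_, by rw [hF.owner, h1], by rw [hF.sid, h2]⟩
    rcases hs with h | ⟨u, -, h⟩ <;> rw [h]
    · exact List.mem_map_of_mem ht
    · exact List.mem_append_left _ (List.mem_map_of_mem ht)
  | i + 2 => exact genStep_test_ne_none _ _ _ _ _ hu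

theorem slot_eq_zero_iff {r : ℕ} {g : Game P} {Q : Query P} : slot r g Q = 0 ↔
    (initKeys g)[r]? = none ∧ Q.isEstablish = true ∧ (initKeys g).length = r := by
  unfold slot
  cases hQ : Q.isTest with
  | true =>
    have : Q.isEstablish = false := by cases Q <;> first | rfl | cases hQ
    simp [this]
  | false =>
    cases (initKeys g)[r]? with
    | none => simp
    | some x =>
      simp only [Bool.false_eq_true, if_false]
      split_ifs <;> simp

theorem slot_eq_zero {r : ℕ} {g : Game P} {Q : Query P} (h : slot r g Q = 0) :
    Q.isEstablish = true ∧ (initKeys g).length = r := (slot_eq_zero_iff.1 h).2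

theorem slot_eq_one_iff {r : ℕ} {g : Game P} {Q : Query P} : slot r g Q = 1 ↔
    ∃ x, (initKeys g)[r]? = some x ∧ newKey g Q = some (swapKey x) := by
  unfold slot
  cases hQ : Q.isTest with
  | true =>
    have : newKey g Q = none := by cases Q <;> first | rfl | cases hQ
    simp [this]
  | false =>
    cases (initKeys g)[r]? with
    | none =>
      simp only [Bool.false_eq_true, if_false]
      split_ifs <;> simp
    | some x => simp

theorem slot_eq_one {r : ℕ} {g : Game P} {Q : Query P} (h : slot r g Q = 1) :
    Q.isTest = false ∧ ∃ x, (initKeys g)[r]? = some x ∧ newKey g Q = some (swapKey x) := by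
  refine ⟨?_, slot_eq_one_iff.1 h⟩
  by_contra hQ
  rw [slot, if_pos (by simpa using hQ)] at h
  cases h

theorem slot_eq_two {r : ℕ} {g : Game P} {Q : Query P} : slot r g Q = 2 ↔ Q.isTest = true := by
  unfold slot
  constructor
  · intro h
    by_contra h1
    rw [if_neg h1] at h
    cases hx : (initKeys g)[r]? with
    | some x =>
      simp only [hx] at h
      split_ifs at h
      all_goals cases h
    | none =>
      simp only [hx] at h
      split_ifs at h
      all_goals cases h
  · intro h
    rw [if_pos h]

/-- A secret that has been consumed does not matter any more. -/
theorem realStep_used {N : ℕ} {h : P.R} {b : Bool} {r i : ℕ} (hi : i < 3) {g : Game P}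
    (hu : Used r i g) {Q : Query P} (hs : slot r g Q = i) (sk sk' : P.R × P.R) :
    realStep N h b sk g Q = realStep N h b sk' g Q := by
  match i, hi with
  | 0, _ =>
    have : r < (initKeys g).length := hu
    have := (slot_eq_zero hs).2
    omega
  | 1, _ =>
    obtain ⟨x, hx, hf⟩ := hu
    obtain ⟨ht, y, hy, hk⟩ := slot_eq_one hs
    rw [hx] at hy
    cases hy
    refine genStep_congr_secret _ _ _ _ _ _ _ _ _ (fun h => by rw [ht] at h; cases h) ?_
    intro y hy
    rw [hk] at hy
    cases hy
    exact hf
  | 2, _ =>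
    refine genStep_congr_secret _ _ _ _ _ _ _ _ _ (fun _ => hu) ?_
    intro y hy
    have := slot_eq_two.1 hs
    cases Q with
    | test => cases hy
    | _ => cases this

/-- A step either does not depend on the secret of its slot, or consumes it. -/
theorem realStep_consumes {N : ℕ} {h : P.R} {b : Bool} {r i : ℕ} (hi : i < 3) {g : Game P}
    {Q : Query P} (hs : slot r g Q = i) :
    (∀ sk sk', realStep N h b sk g Q = realStep N h b sk' g Q) ∨
      ∀ sk, Used r i (realStep N h b sk g Q).2 := by
  match i, hi with
  | 0, _ =>
    obtain ⟨he, hr⟩ := slot_eq_zero hs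
    cases Q with
    | establish a c s =>
      simp only [realStep, genStep]
      split_ifs
      · right
        intro sk
        change r < (initKeys _).length
        simp only [initKeys, Game.push, List.filter_append, List.map_append, List.length_append]
        rw [← hr, initKeys]
        simp
      · exact Or.inl fun _ _ => rfl
    | _ => cases he
  | 1, _ =>
    obtain ⟨ht, x, hx, hk⟩ := slot_eq_one hs
    rcases genStep_created N (0, 0) 0 id hk with hc | hc
    · exact Or.inl fun sk sk' => (hc _ _ _).trans (hc _ _ _).symm
    · right
      intro sk
      obtain ⟨t, h1, h2⟩ := hc sk (pubKey h sk) (fun key => if b then pubKey h sk else key)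
      have hk' := h1.key
      rw [hk, Option.some.injEq] at hk'
      refine ⟨x, getElem?_of_prefix (initKeys_prefix _ _ _ _ _ _) hx, ?_⟩
      have := find_ne_none h2
      have e1 : x.2.1 = t.owner := congrArg Prod.fst hk'
      have e2 : x.2.2 = t.sid := congrArg (fun y => y.2.2) hk'
      rwa [e1, e2]
  | 2, _ =>
    have := slot_eq_two.1 hs
    cases Q with
    | test i s =>
      simp only [realStep, genStep]
      cases g.find i s with
      | none => exact Or.inl fun _ _ => rfl
      | some t =>
        dsimp only
        cases t.output with
        | none => exact Or.inl fun _ _ => rfl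
        | some key =>
          dsimp only
          by_cases hc : g.test = none ∧ t.expired = false ∧ g.Fresh t
          · simp only [if_pos hc]
            exact Or.inr fun _ => Option.some_ne_none _
          · simp only [if_neg hc]
            exact Or.inl fun _ _ => trivial
    | _ => cases this

/-- One more secret may be drawn in advance. -/
theorem interp_eagerOracle (N : ℕ) (h : P.R) (b : Bool) (r : ℕ) (f : ℕ → Option (P.R × P.R))
    {i : ℕ} (hi : i < 3) (hf : f i = none) (t : Tree P.K) (g : Game P) :
    ((sampleSecret P).bind fun sk =>
      interp (eagerOracle N h b r (Function.update f i (some sk))) t g) =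
    interp (eagerOracle N h b r f) t g := by
  have hother : ∀ (g : Game P) q, slot r g (decQuery q) ≠ i → ∀ sk,
      eagerOracle N h b r (Function.update f i (some sk)) q g = eagerOracle N h b r f q g := by
    intro g q hs sk
    unfold eagerOracle pick
    rw [Function.update_of_ne hs]
  have hself : ∀ (g : Game P) q, slot r g (decQuery q) = i → ∀ sk,
      eagerOracle N h b r (Function.update f i (some sk)) q g =
        PMF.pure (realStep N h b sk g (decQuery q)) := by
    intro g q hs sk
    unfold eagerOracle pick
    rw [hs, Function.update_self]
    exact pmf_map_const (sampleSecret P) (realStep N h b sk g (decQuery q))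
  have hselfO : ∀ (g : Game P) q, slot r g (decQuery q) = i → eagerOracle N h b r f q g =
      (sampleSecret P).map fun sk => realStep N h b sk g (decQuery q) := by
    intro g q hs
    unfold eagerOracle pick
    rw [hs, hf]
    rfl
  refine interp_eager _ _ _ (Used r i) ?_ ?_ ?_ t g
  · intro g hu sk q
    by_cases hs : slot r g (decQuery q) = i
    · rw [hself g q hs, hselfO g q hs, ← pmf_map_const (sampleSecret P)]
      refine congrArg _ (funext fun sk' => ?_)
      exact congrArg PMF.pure (realStep_used hi hu hs _ _)
    · exact hother g q hs sk
  · intro g hu q w hw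
    obtain ⟨sk, -, rfl⟩ := (PMF.mem_support_map_iff _ _ _).1 hw
    exact hu.step _ _ _ _ _
  · intro g _ q
    by_cases hs : slot r g (decQuery q) = i
    · rcases realStep_consumes (N := N) (h := h) (b := b) hi hs with hc | hc
      · left
        intro sk
        rw [hself g q hs, hselfO g q hs, ← pmf_map_const (sampleSecret P)]
        refine congrArg _ (funext fun sk' => ?_)
        exact congrArg PMF.pure (hc _ _)
      · right
        constructor
        · simp only [hself g q hs]
          rw [hselfO g q hs]
          rfl
        · intro sk w hw
          rw [hself g q hs, PMF.mem_support_pure_iff] at hw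
          rw [hw]
          exact hc sk
    · exact Or.inl (hother g q hs)

/-- The three secrets drawn in advance. -/
def three (sk₁ sk₂ sk₃ : P.R × P.R) : ℕ → Option (P.R × P.R)
  | 0 => some sk₁
  | 1 => some sk₂
  | 2 => some sk₃
  | _ => none

theorem interp_amOracle_eager (N : ℕ) (h : P.R) (b : Bool) (r : ℕ) (t : Tree P.K) (g : Game P) :
    interp (amOracle N h b) t g = (sampleSecret P).bind fun sk₁ => (sampleSecret P).bind fun sk₂ =>
      (sampleSecret P).bind fun sk₃ =>
        interp (eagerOracle N h b r (three sk₁ sk₂ sk₃)) t g := by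
  have h0 : amOracle N h b = eagerOracle N h b r fun _ => none := by
    funext v g
    exact answer_eq _ _ _ _ _
  have h3 : ∀ sk₁ sk₂ sk₃ : P.R × P.R, three sk₁ sk₂ sk₃ = Function.update (Function.update
      (Function.update (fun _ => none) 0 (some sk₁)) 1 (some sk₂)) 2 (some sk₃) := by
    intro sk₁ sk₂ sk₃
    funext i
    match i with
    | 0 => rfl
    | 1 => rfl
    | 2 => rfl
    | i + 3 => rfl
  rw [h0, ← interp_eagerOracle N h b r _ (i := 0) (by omega) rfl]
  refine congrArg _ (funext fun sk₁ => ?_)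
  rw [← interp_eagerOracle N h b r _ (i := 1) (by omega) rfl]
  refine congrArg _ (funext fun sk₂ => ?_)
  rw [← interp_eagerOracle N h b r _ (i := 2) (by omega) rfl]
  refine congrArg _ (funext fun sk₃ => ?_)
  rw [h3]

end Guess

/-! ### Forgetting the secrets of the guessed sessions -/

section Mask

variable {P : Params}

open Classical in
/-- Forget the secret pair and the key of a session if its key is in `S`; that they are there is
not forgotten. -/
def maskS (S : ℕ × ℕ × ℕ → Prop) (t : Session P) : Session P :=
  if S t.key then { t with secret := t.secret.map fun _ => 0, output := t.output.map fun _ => 0 }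
  else t

/-- Forget the secrets of all sessions with keys in `S`. -/
def mask (S : ℕ × ℕ × ℕ → Prop) (g : Game P) : Game P :=
  { g with sessions := g.sessions.map (maskS S) }

variable (S : ℕ × ℕ × ℕ → Prop)

section fields

variable (t : Session P)

@[simp] theorem maskS_owner : (maskS S t).owner = t.owner := by unfold maskS; split_ifs <;> rfl

@[simp] theorem maskS_peer : (maskS S t).peer = t.peer := by unfold maskS; split_ifs <;> rfl

@[simp] theorem maskS_sid : (maskS S t).sid = t.sid := by unfold maskS; split_ifs <;> rfl

@[simp] theorem maskS_initiator : (maskS S t).initiator = t.initiator := by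
  unfold maskS; split_ifs <;> rfl

@[simp] theorem maskS_sent : (maskS S t).sent = t.sent := by unfold maskS; split_ifs <;> rfl

@[simp] theorem maskS_delivered : (maskS S t).delivered = t.delivered := by
  unfold maskS; split_ifs <;> rfl

@[simp] theorem maskS_received : (maskS S t).received = t.received := by
  unfold maskS; split_ifs <;> rfl

@[simp] theorem maskS_expired : (maskS S t).expired = t.expired := by
  unfold maskS; split_ifs <;> rfl

@[simp] theorem maskS_stopped : (maskS S t).stopped = t.stopped := by
  unfold maskS; split_ifs <;> rfl

@[simp] theorem maskS_exposed : (maskS S t).exposed = t.exposed := by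
  unfold maskS; split_ifs <;> rfl

@[simp] theorem maskS_key : (maskS S t).key = t.key := by simp [Session.key]

end fields

theorem maskS_of {t : Session P} (h : S t.key) :
    maskS S t = { t with secret := t.secret.map fun _ => 0, output := t.output.map fun _ => 0 } :=
  if_pos h

theorem maskS_of_not {t : Session P} (h : ¬ S t.key) : maskS S t = t := if_neg h

theorem maskS_output_isSome (t : Session P) : (maskS S t).output.isSome = t.output.isSome := by
  unfold maskS; split_ifs <;> simp

theorem maskS_maskS {S S' : ℕ × ℕ × ℕ → Prop} (h : ∀ y, S' y → S y) (t : Session P) :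
    maskS S (maskS S' t) = maskS S t := by
  by_cases h' : S' t.key
  · rw [maskS_of S' h', maskS_of S (h _ h'), maskS_of S (by exact h _ h')]
    simp [Function.comp_def]
  · rw [maskS_of_not S' h']

theorem keeps_maskS : Keeps (maskS (P := P) S) :=
  ⟨maskS_owner S, maskS_peer S, maskS_sid S, maskS_initiator S, maskS_sent S,
    fun t h => by rw [maskS_exposed, h]⟩

theorem mask_mask {S S' : ℕ × ℕ × ℕ → Prop} (h : ∀ y, S' y → S y) (g : Game P) :
    mask S (mask S' g) = mask S g := by
  unfold mask
  simp only [List.map_map, Game.mk.injEq, and_true]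
  exact List.map_congr_left fun t _ => maskS_maskS h t

theorem initKeys_mask (g : Game P) : initKeys (mask S g) = initKeys g :=
  initKeys_of_map (keeps_maskS S) rfl

theorem mask_find (g : Game P) (i s : ℕ) : (mask S g).find i s = (g.find i s).map (maskS S) := by
  unfold Game.find mask
  simp [List.find?_map]

theorem mask_protected (g : Game P) (u : Session P) :
    (mask S g).Protected (maskS S u) ↔ g.Protected u := by
  simp [Game.Protected, mask, Session.Partner]

theorem mask_fresh (g : Game P) (u : Session P) :
    (mask S g).Fresh (maskS S u) ↔ g.Fresh u := by
  simp [Game.Fresh, mask, Session.Partner, Session.Matching]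

theorem bad_mask (r : ℕ) (g : Game P) : Bad r (mask S g) ↔ Bad r g := by
  unfold Bad Special
  rw [initKeys_mask]
  simp [mask]

theorem mask_push {g g' : Game P} (h : mask S g = mask S g') {t t' : Session P}
    (ht : maskS S t = maskS S t') : mask S (g.push t) = mask S (g'.push t') := by
  unfold mask at h
  simp only [Game.mk.injEq] at h
  simp [mask, Game.push, h, ht]

theorem mask_idem (g : Game P) : mask S (mask S g) = mask S g := mask_mask (fun _ h => h) g

theorem mask_modify (g : Game P) {i s : ℕ} {f f' : Session P → Session P}
    (h : ∀ t ∈ g.sessions, t.owner = i → t.sid = s →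
      maskS S (f t) = maskS S (f' (maskS S t))) :
    mask S (g.modify i s f) = mask S ((mask S g).modify i s f') := by
  simp only [mask, Game.modify, List.map_map, Game.mk.injEq, and_true]
  refine List.map_congr_left fun t ht => ?_
  simp only [Function.comp_apply, maskS_owner, maskS_sid]
  split_ifs with hc
  · simp only [Bool.and_eq_true, beq_iff_eq] at hc
    exact h t ht hc.1 hc.2
  · exact (maskS_maskS (fun _ h => h) t).symm

theorem modify_mask (g : Game P) {i s : ℕ} {f : Session P → Session P}
    (h : ∀ t, maskS S (f t) = f (maskS S t)) :
    (mask S g).modify i s f = mask S (g.modify i s f) := by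
  simp only [mask, Game.modify, List.map_map, Game.mk.injEq, and_true]
  refine List.map_congr_left fun t ht => ?_
  simp only [Function.comp_apply, maskS_owner, maskS_sid]
  split_ifs with hc
  · exact (h t).symm
  · rfl

/-- A received message has the same visible effect whether or not secrets have been forgotten: the
answer contains neither secrets nor keys. -/
theorem mask_recvStep {g : Game P} (hI : Inv g) {sk sk' : P.R × P.R} (pk : P.R) {i j s : ℕ}
    (z : P.R) (hS : sk = sk' ∨ S (j, i, s)) :
    mask S (recvStep sk pk g i j s z).2 = mask S (recvStep sk' pk (mask S g) i j s z).2 ∧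
      (recvStep sk pk g i j s z).1 = (recvStep sk' pk (mask S g) i j s z).1 := by
  unfold recvStep
  have hc : (mask S g).corrupted = g.corrupted := rfl
  rw [hc, mask_find]
  split_ifs with h1
  · exact ⟨(mask_idem S g).symm, rfl⟩
  · cases hf : g.find j s with
    | none =>
      refine ⟨mask_push S (mask_idem S g).symm ?_, rfl⟩
      rcases hS with rfl | hS
      · rfl
      · rw [maskS_of S (by exact hS), maskS_of S (by exact hS)]
        simp only [Option.map_some]
    | some t =>
      simp only [Option.map_some]
      obtain ⟨ht, hto, hts⟩ := find_some hf
      by_cases hSt : S t.key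
      · rw [maskS_of S hSt]
        cases hsk : t.secret with
        | none => exact ⟨(mask_idem S g).symm, rfl⟩
        | some sk₁ =>
          simp only [Option.map_some]
          split_ifs with hc'
          · refine ⟨mask_modify S g fun u hu h2 h3 => ?_, rfl⟩
            obtain rfl := hI.eq_of_id hu ht (h2.trans hto.symm) (h3.trans hts.symm)
            rw [maskS_of S hSt, maskS_of S (by exact hSt), maskS_of S (by exact hSt)]
            simp only [Option.map_some]
          · exact ⟨(mask_idem S g).symm, rfl⟩
      · rw [maskS_of_not S hSt]
        cases hsk : t.secret with
        | none => exact ⟨(mask_idem S g).symm, rfl⟩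
        | some sk₁ =>
          simp only
          split_ifs with hc'
          · refine ⟨mask_modify S g fun u hu h2 h3 => ?_, rfl⟩
            obtain rfl := hI.eq_of_id hu ht (h2.trans hto.symm) (h3.trans hts.symm)
            rw [maskS_of_not S hSt]
          · exact ⟨(mask_idem S g).symm, rfl⟩

/-- A step does not depend on forgotten secrets, unless it exposes a session whose secrets have
been forgotten. -/
theorem mask_genStep {g : Game P} (hI : Inv g) (N : ℕ) {sk sk' : P.R × P.R} (pk K : P.R)
    (Q : Query P) (hS : sk = sk' ∨ ∀ y, newKey g Q = some y → S y) :
    mask S (genStep N sk pk (fun _ => K) g Q).2 =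
      mask S (genStep N sk' pk (fun _ => K) (mask S g) Q).2 ∧
    ((genStep N sk pk (fun _ => K) g Q).1 = (genStep N sk' pk (fun _ => K) (mask S g) Q).1 ∨
      ∃ t ∈ (genStep N sk pk (fun _ => K) g Q).2.sessions, S t.key ∧ t.exposed = true) := by
  have hd : ∀ t : Session P, maskS S { t with delivered := true } =
      { maskS S t with delivered := true } := by
    intro t
    by_cases h : S t.key
    · rw [maskS_of S h, maskS_of S (by exact h)]
    · rw [maskS_of_not S h, maskS_of_not S (by exact h)]
  have hst : ∀ t : Session P, maskS S { t with stopped := true, exposed := true } =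
      { maskS S t with stopped := true, exposed := true } := by
    intro t
    by_cases h : S t.key
    · rw [maskS_of S h, maskS_of S (by exact h)]
    · rw [maskS_of_not S h, maskS_of_not S (by exact h)]
  have hex : ∀ t : Session P, maskS S { t with exposed := true } =
      { maskS S t with exposed := true } := by
    intro t
    by_cases h : S t.key
    · rw [maskS_of S h, maskS_of S (by exact h)]
    · rw [maskS_of_not S h, maskS_of_not S (by exact h)]
  have he : ∀ t : Session P, maskS S { t with expired := true } =
      { maskS S t with expired := true } := by
    intro t
    by_cases h : S t.key
    · rw [maskS_of S h, maskS_of S (by exact h)]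
    · rw [maskS_of_not S h, maskS_of_not S (by exact h)]
  have hid := mask_idem S g
  have hmem : ∀ {i s : ℕ} {t : Session P} {f : Session P → Session P}, g.find i s = some t →
      f t ∈ (g.modify i s f).sessions := by
    intro i s t f hf
    obtain ⟨ht, hto, hts⟩ := find_some hf
    exact List.mem_map.2 ⟨t, ht, by simp [hto, hts]⟩
  cases Q with
  | establish i j s =>
    simp only [genStep]
    have hc : (mask S g).corrupted = g.corrupted := rfl
    rw [mask_find, hc]
    simp only [Option.map_eq_none_iff]
    split_ifs with h
    · refine ⟨mask_push S hid.symm ?_, Or.inl rfl⟩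
      rcases hS with rfl | hS
      · rfl
      · have := hS _ rfl
        rw [maskS_of S (by exact this), maskS_of S (by exact this)]
        simp only [Option.map_some]
    · exact ⟨hid.symm, Or.inl rfl⟩
  | deliver i s =>
    simp only [genStep]
    rw [mask_find]
    cases hf : g.find i s with
    | none => exact ⟨hid.symm, Or.inl rfl⟩
    | some t =>
      simp only [Option.map_some, maskS_delivered, maskS_peer, maskS_sent]
      split_ifs
      · exact ⟨hid.symm, Or.inl rfl⟩
      · rw [modify_mask S g hd]
        have hI' : Inv (g.modify i s fun t => { t with delivered := true }) :=
          hI.move (.mark (sk := sk) (pk := pk) i s)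
        obtain ⟨h1, h2⟩ := mask_recvStep S hI' pk t.sent (i := i) (j := t.peer) (s := s)
          (hS.imp_right fun h => h _ (by simp [newKey, hf]))
        exact ⟨h1, Or.inl h2⟩
  | inject i j s z =>
    simp only [genStep]
    have hc : (mask S g).corrupted = g.corrupted := rfl
    have hc' : (∃ t, (mask S g).find i s = some t ∧ t.stopped = true ∧ t.peer = j) ↔
        ∃ t, g.find i s = some t ∧ t.stopped = true ∧ t.peer = j := by
      rw [mask_find]
      cases g.find i s <;> simp
    simp only [hc, hc']
    split_ifs
    · obtain ⟨h1, h2⟩ := mask_recvStep S hI pk z (i := i) (j := j) (s := s)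
        (hS.imp_right fun h => h _ rfl)
      exact ⟨h1, Or.inl h2⟩
    · exact ⟨hid.symm, Or.inl rfl⟩
  | stateReveal i s =>
    simp only [genStep]
    rw [mask_find]
    cases hf : g.find i s with
    | none => exact ⟨hid.symm, Or.inl rfl⟩
    | some t =>
      simp only [Option.map_some]
      have hp : ((maskS S t).expired = false ∧ ¬ (mask S g).Protected (maskS S t)) ↔
          t.expired = false ∧ ¬ g.Protected t := by rw [maskS_expired, mask_protected]
      by_cases hc : t.expired = false ∧ ¬ g.Protected t
      · rw [if_pos hc, if_pos (hp.2 hc)]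
        rw [modify_mask S g hst, mask_idem]
        refine ⟨rfl, ?_⟩
        by_cases hSt : S t.key
        · exact Or.inr ⟨_, hmem hf, hSt, rfl⟩
        · rw [maskS_of_not S hSt]
          exact Or.inl rfl
      · rw [if_neg hc, if_neg (mt hp.1 hc)]
        exact ⟨hid.symm, Or.inl rfl⟩
  | keyReveal i s =>
    simp only [genStep]
    rw [mask_find]
    cases hf : g.find i s with
    | none => exact ⟨hid.symm, Or.inl rfl⟩
    | some t =>
      simp only [Option.map_some]
      have hp : ((maskS S t).expired = false ∧ ¬ (mask S g).Protected (maskS S t)) ↔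
          t.expired = false ∧ ¬ g.Protected t := by rw [maskS_expired, mask_protected]
      by_cases hc : t.expired = false ∧ ¬ g.Protected t
      swap
      · simp only [if_neg hc, if_neg (mt hp.1 hc)]
        cases t.output <;> cases (maskS S t).output <;> exact ⟨hid.symm, Or.inl rfl⟩
      simp only [if_pos hc, if_pos (hp.2 hc)]
      by_cases hSt : S t.key
      · rw [maskS_of S hSt]
        cases ho : t.output with
        | none => exact ⟨hid.symm, Or.inl rfl⟩
        | some key =>
          simp only [Option.map_some]
          rw [modify_mask S g hex, mask_idem]
          exact ⟨rfl, Or.inr ⟨_, hmem hf, hSt, rfl⟩⟩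
      · rw [maskS_of_not S hSt]
        cases ho : t.output with
        | none => exact ⟨hid.symm, Or.inl rfl⟩
        | some key =>
          simp only
          rw [modify_mask S g hex, mask_idem]
          exact ⟨rfl, Or.inl trivial⟩
  | expire i s =>
    simp only [genStep]
    rw [mask_find]
    cases hf : g.find i s with
    | none => exact ⟨hid.symm, Or.inl rfl⟩
    | some t =>
      simp only [Option.map_some, maskS_output_isSome]
      split_ifs
      · rw [modify_mask S g he, mask_idem]
        exact ⟨rfl, Or.inl rfl⟩
      · exact ⟨hid.symm, Or.inl rfl⟩
  | corrupt i =>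
    simp only [genStep]
    have hp : (∀ t ∈ (mask S g).sessions, t.owner = i → (mask S g).Protected t →
        t.expired = true) ↔ ∀ t ∈ g.sessions, t.owner = i → g.Protected t → t.expired = true := by
      have : (mask S g).sessions = g.sessions.map (maskS S) := rfl
      rw [this, List.forall_mem_map]
      simp only [maskS_owner, maskS_expired, mask_protected]
    by_cases hc : i < N ∧ i ∉ g.corrupted ∧
        ∀ t ∈ g.sessions, t.owner = i → g.Protected t → t.expired = true
    · rw [if_pos hc, if_pos ⟨hc.1, hc.2.1, hp.2 hc.2.2⟩]
      constructor
      · simp only [mask, List.map_map, Game.mk.injEq, and_true]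
        refine List.map_congr_left fun t ht => ?_
        dsimp only [Function.comp_apply]
        by_cases hb : (t.owner == i && !t.expired) = true
        · rw [if_pos hb, if_pos (by simpa using hb)]
          exact (hex t).trans (by
            have h := hex (maskS S t)
            rw [maskS_maskS fun _ h => h] at h
            exact h.symm)
        · rw [if_neg hb, if_neg (by simpa using hb)]
          exact (maskS_maskS (fun _ h => h) t).symm
      · by_cases hall : ∃ t ∈ g.sessions, S t.key ∧ t.owner = i ∧ t.expired = false
        · obtain ⟨t, ht, hSt, ho, he⟩ := hall
          refine Or.inr ⟨{ t with exposed := true }, List.mem_map.2 ⟨t, ht, ?_⟩, hSt, rfl⟩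
          simp [ho, he]
        · left
          push Not at hall
          simp only
          congr 1
          have : (mask S g).sessions = g.sessions.map (maskS S) := rfl
          rw [this, List.filter_map, List.map_map]
          have hp : ((fun t : Session P => t.owner == i && !t.expired) ∘ maskS S) =
              fun t => t.owner == i && !t.expired := by
            funext t; simp
          rw [hp]
          refine List.map_congr_left fun t ht => ?_
          obtain ⟨ht, hb⟩ := List.mem_filter.1 ht
          simp only [Bool.and_eq_true, beq_iff_eq, Bool.not_eq_true'] at hb
          rw [Function.comp_apply, maskS_of_not S fun h => hall t ht h hb.1 hb.2]
    · rw [if_neg hc, if_neg fun h => hc ⟨h.1, h.2.1, hp.1 h.2.2⟩]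
      exact ⟨hid.symm, Or.inl rfl⟩
  | test i s =>
    simp only [genStep]
    rw [mask_find]
    cases hf : g.find i s with
    | none => exact ⟨hid.symm, Or.inl rfl⟩
    | some t =>
      simp only [Option.map_some]
      have hp : ((mask S g).test = none ∧ (maskS S t).expired = false ∧
          (mask S g).Fresh (maskS S t)) ↔
          g.test = none ∧ t.expired = false ∧ g.Fresh t := by
        rw [maskS_expired, mask_fresh]
        rfl
      have ho := maskS_output_isSome S t
      cases ho' : t.output with
      | none =>
        rw [ho', Option.isSome_none, Option.isSome_eq_false_iff, Option.isNone_iff_eq_none] at ho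
        rw [ho]
        exact ⟨hid.symm, Or.inl rfl⟩
      | some key =>
        rw [ho', Option.isSome_some, Option.isSome_iff_exists] at ho
        obtain ⟨key', ho⟩ := ho
        rw [ho]
        simp only
        by_cases hc : g.test = none ∧ t.expired = false ∧ g.Fresh t
        · rw [if_pos hc, if_pos (hp.2 hc)]
          refine ⟨?_, Or.inl rfl⟩
          have := mask_idem S g
          unfold mask at this ⊢
          simp only [Game.mk.injEq, and_true] at this ⊢
          exact this.symm
        · rw [if_neg hc, if_neg (mt hp.1 hc)]
          exact ⟨hid.symm, Or.inl rfl⟩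

end Mask

/-! ### Coupling two oracles -/

section Coupling

variable {P : Params}

/-- If the state is dead, the observable `φ` is constant. -/
theorem interp_dead {S Ω γ : Type} (μ : PMF Ω) (f : Val P.K → S → Ω → Val P.K × S)
    (D : S → Prop) (hD : ∀ s, D s → ∀ q, ∀ ω ∈ μ.support, D (f q s ω).2) (φ : Val P.K → S → γ)
    (c : γ) (hφ : ∀ v s, D s → φ v s = c) (t : Tree P.K) {s : S} (hs : D s) :
    (interp (fun q s => μ.map (f q s)) t s).map (fun w => φ w.1 w.2.1) = PMF.pure c := by
  induction t generalizing s with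
  | ret v e => simp [interp, PMF.pure_map, hφ v s hs]
  | samp d k ih =>
    simp only [interp, PMF.map_bind]
    simp only [ih _ hs, PMF.bind_const]
  | call q k ih =>
    simp only [interp, PMF.map_bind, PMF.bind_map, Function.comp_def]
    rw [bind_congr_support (g := fun _ => PMF.pure c) fun ω hω => ih _ (hD s hs q ω hω),
      PMF.bind_const]

/-- Two oracles that use the same randomness, give the same answers, and stay related, have the
same observable outcome; it does not matter what happens once both states are dead. -/
theorem interp_couple {S₁ S₂ Ω γ : Type} (μ : PMF Ω) (f₁ : Val P.K → S₁ → Ω → Val P.K × S₁)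
    (f₂ : Val P.K → S₂ → Ω → Val P.K × S₂) (R : ℕ → S₁ → S₂ → Prop) (D₁ : S₁ → Prop)
    (D₂ : S₂ → Prop)
    (step : ∀ B s₁ s₂, R (B + 1) s₁ s₂ → ∀ q, ∀ ω ∈ μ.support,
      ((f₁ q s₁ ω).1 = (f₂ q s₂ ω).1 ∧ R B (f₁ q s₁ ω).2 (f₂ q s₂ ω).2) ∨
        D₁ (f₁ q s₁ ω).2 ∧ D₂ (f₂ q s₂ ω).2)
    (hD₁ : ∀ s, D₁ s → ∀ q, ∀ ω ∈ μ.support, D₁ (f₁ q s ω).2)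
    (hD₂ : ∀ s, D₂ s → ∀ q, ∀ ω ∈ μ.support, D₂ (f₂ q s ω).2)
    (φ₁ : Val P.K → S₁ → γ) (φ₂ : Val P.K → S₂ → γ) (c : γ)
    (h₁ : ∀ v s, D₁ s → φ₁ v s = c) (h₂ : ∀ v s, D₂ s → φ₂ v s = c)
    (hR : ∀ B s₁ s₂, R B s₁ s₂ → ∀ v, φ₁ v s₁ = φ₂ v s₂)
    {t : Tree P.K} {B : ℕ} (ht : t.Bounded B) {s₁ : S₁} {s₂ : S₂} (hs : R B s₁ s₂) :
    (interp (fun q s => μ.map (f₁ q s)) t s₁).map (fun w => φ₁ w.1 w.2.1) =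
      (interp (fun q s => μ.map (f₂ q s)) t s₂).map (fun w => φ₂ w.1 w.2.1) := by
  induction t generalizing B s₁ s₂ with
  | ret v e => simp only [interp, PMF.pure_map, hR B s₁ s₂ hs v]
  | samp d k ih =>
    simp only [interp, PMF.map_bind]
    exact bind_congr_support fun v hv => ih v (ht v hv) hs
  | call q k ih =>
    obtain ⟨hB, hk⟩ := ht
    obtain ⟨B, rfl⟩ := Nat.exists_eq_add_of_lt hB
    rw [zero_add] at hs hk
    simp only [interp, PMF.map_bind, PMF.bind_map, Function.comp_def]
    refine bind_congr_support fun ω hω => ?_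
    rcases step B s₁ s₂ hs q ω hω with ⟨he, h⟩ | ⟨hd₁, hd₂⟩
    · rw [he]
      exact ih _ (hk _) h
    · rw [interp_dead μ f₁ D₁ hD₁ φ₁ c h₁ _ hd₁, interp_dead μ f₂ D₂ hD₂ φ₂ c h₂ _ hd₂]

end Coupling

/-! ### The simulation -/

section Simulation

variable {P : Params}

/-- The outgoing message of the new session in the simulation: that of one of the two guessed
sessions is given. -/
def simPk (h : P.R) (r : ℕ) (pk₁ pk₂ : P.R) (sk : P.R × P.R) (g : Game P) (Q : Query P) : P.R :=
  if slot r g Q = 0 then pk₁ else if slot r g Q = 1 then pk₂ else pubKey h sk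

/-- A step of the simulation: the guessed sessions send `pk₁` and `pk₂`, and the test is answered
with `key`. -/
def simStep (N : ℕ) (h : P.R) (r : ℕ) (pk₁ pk₂ key : P.R) (sk : P.R × P.R) (g : Game P)
    (Q : Query P) : Val P.K × Game P :=
  genStep N sk (simPk h r pk₁ pk₂ sk g Q) (fun _ => key) g Q

/-- The guessed sessions have sent `pk₁` and `pk₂`. -/
structure Sent (r : ℕ) (pk₁ pk₂ : P.R) (g : Game P) : Prop where
  fst : ∀ t ∈ g.sessions, (initKeys g)[r]? = some t.key → t.sent = pk₁
  snd : ∀ t ∈ g.sessions, (initKeys g)[r]? = some (swapKey t.key) → t.sent = pk₂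

theorem initKeys_getElem? {r : ℕ} {g g' : Game P} {F : Session P → Session P} (hF : Keeps F)
    {t : Session P} (h : g'.sessions = g.sessions.map F ++ [t]) {x : ℕ × ℕ × ℕ}
    (hx : (initKeys g')[r]? = some x) :
    (initKeys g)[r]? = some x ∨ (t.initiator = true ∧ t.key = x ∧ (initKeys g).length = r) := by
  rw [initKeys_of_append hF h] at hx
  split_ifs at hx with ht
  · rw [List.getElem?_append] at hx
    split_ifs at hx with hr
    · exact Or.inl hx
    · right
      have h1 := (List.getElem?_eq_some_iff.1 hx).1
      have h2 := List.mem_of_getElem? hx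
      rw [List.mem_singleton] at h2
      rw [List.length_singleton] at h1
      exact ⟨ht, h2.symm, by omega⟩
  · rw [List.append_nil] at hx
    exact Or.inl hx

/-- Once the guessed sessions are there, no later session has the same key. -/
theorem Sent.step {r : ℕ} {pk₁ pk₂ : P.R} {g : Game P} (hI : Inv g) (hs : Sent r pk₁ pk₂ g)
    (N : ℕ) (sk : P.R × P.R) (pk : P.R) (tk : P.R → P.R) (Q : Query P)
    (h0 : slot r g Q = 0 → pk = pk₁) (h1 : slot r g Q = 1 → pk = pk₂)
    (hb : ¬ Bad r (genStep N sk pk tk g Q).2) : Sent r pk₁ pk₂ (genStep N sk pk tk g Q).2 := by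
  obtain ⟨F, hF, h | ⟨u, hc, h⟩⟩ := genStep_sessions N sk pk tk g Q
  · have hk := initKeys_of_map hF h
    constructor <;> intro t ht hx <;> rw [hk] at hx <;> rw [h] at ht <;>
      replace ht := List.mem_map.1 ht <;> obtain ⟨t, ht, rfl⟩ := ht <;>
      rw [hF.key] at hx <;> rw [hF.sent]
    exacts [hs.fst t ht hx, hs.snd t ht hx]
  · constructor
    · intro t ht hx
      rw [h] at ht
      replace ht := List.mem_append.1 ht
      rcases ht with ht | ht
      · replace ht := List.mem_map.1 ht
        obtain ⟨t, ht, rfl⟩ := ht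
        rw [hF.key] at hx
        rw [hF.sent]
        rcases initKeys_getElem? hF h hx with hx | ⟨-, hx, -⟩
        · exact hs.fst t ht hx
        · exact absurd hx.symm (ne_of_created hc ht)
      · rw [List.mem_singleton] at ht
        subst ht
        rw [hc.sent]
        rcases initKeys_getElem? hF h hx with hx | ⟨h2, -, hr⟩
        · obtain ⟨v, hv, -, hv'⟩ := mem_initKeys.1 (List.mem_of_getElem? hx)
          exact absurd hv' (ne_of_created hc hv)
        · exact h0 (slot_eq_zero_iff.2 ⟨List.getElem?_eq_none hr.le, hc.initiator ▸ h2, hr⟩)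
    · intro t ht hx
      have htm := ht
      rw [h] at ht
      replace ht := List.mem_append.1 ht
      rcases ht with ht | ht
      · replace ht := List.mem_map.1 ht
        obtain ⟨t, ht, rfl⟩ := ht
        have hx' := hx
        rw [hF.key] at hx
        rw [hF.sent]
        rcases initKeys_getElem? hF h hx with hx | ⟨hu, hx, hr⟩
        · exact hs.snd t ht hx
        · -- a partner that is older than the `r`-th initiator was itself an initiator
          exfalso
          have hti : t.initiator = true := by
            by_contra hti
            rcases hI.responder t ht (by simpa using hti) with hp | ⟨v, hv, hp⟩
            · have : t.peer = u.owner := (congrArg Prod.fst hx).symm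
              exact hc.owner (this ▸ hp)
            · rw [partner_iff, ← hx] at hp
              exact ne_of_created hc hv hp
          refine hb (Or.inr (Or.inr ⟨t.key, ?_, _, hx', Or.inr ?_⟩))
          · rw [initKeys_of_append hF h, List.take_append_of_le_length hr.ge,
              List.take_of_length_le hr.le]
            exact mem_initKeys.2 ⟨t, ht, hti, rfl⟩
          · rw [hF.key, swapKey_swapKey]
      · rw [List.mem_singleton] at ht
        subst ht
        rw [hc.sent]
        rcases initKeys_getElem? hF h hx with hx | ⟨-, hx, -⟩
        · exact h1 (slot_eq_one_iff.2 ⟨_, hx, hc.key⟩)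
        · -- no session is its own partner
          exfalso
          obtain ⟨e1, e2⟩ := Prod.mk.inj hx
          have hI' := hI.genStep N sk pk tk Q
          exact hI'.ne t htm e1

/-- The relation between the model, with the secrets of the guessed sessions drawn in advance, and
the simulation. -/
structure Linked (h : P.R) (r : ℕ) (pk₁ pk₂ : P.R) (g g' : Game P) : Prop where
  inv : Inv g
  inv' : Inv g'
  honest : Honest h g
  sent : Sent r pk₁ pk₂ g
  not_bad : ¬ Bad r g
  masked : mask (Special r g) g = mask (Special r g) g'

theorem newKey_mask (S : ℕ × ℕ × ℕ → Prop) (g : Game P) (Q : Query P) :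
    newKey (mask S g) Q = newKey g Q := by
  cases Q with
  | deliver i s =>
    simp only [newKey, mask_find]
    cases g.find i s <;> simp
  | _ => rfl

theorem slot_mask (S : ℕ × ℕ × ℕ → Prop) (r : ℕ) (g : Game P) (Q : Query P) :
    slot r (mask S g) Q = slot r g Q := by
  simp only [slot, initKeys_mask, newKey_mask]

/-- A tested session among the guessed ones has the key of the DSDP instance. -/
theorem test_key {h : P.R} {r : ℕ} {sk₁ sk₂ : P.R × P.R} (h₁ : sk₁ ∈ (sampleSecret P).support)
    (h₂ : sk₂ ∈ (sampleSecret P).support) {g : Game P} (hI : Inv g) (hH : Honest h g)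
    (hs : Sent r (pubKey h sk₁) (pubKey h sk₂) g) {t : Session P} (ht : t ∈ g.sessions)
    (hf : g.Fresh t) {key : P.R} (ho : t.output = some key) (hsp : Special r g t.key) :
    key = sharedKey sk₂ (pubKey h sk₁) := by
  obtain ⟨u, hu, hp, hr⟩ := hI.exists_partner ht (by rw [ho]; rfl) hf
  rw [partner_iff] at hp
  obtain ⟨x, hx, hxt | hxt⟩ := hsp
  · have ht1 := hs.fst t ht (hxt ▸ hx)
    have hu2 := hs.snd u hu (by rw [hp, swapKey_swapKey, hxt]; exact hx)
    have := hH.output_eq ht hr h₂ hu2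
    rw [ho, ht1] at this
    exact Option.some.inj this
  · have ht2 := hs.snd t ht (by rw [hxt, swapKey_swapKey]; exact hx)
    have hu1 := hs.fst u hu (by rw [hp, hxt, swapKey_swapKey]; exact hx)
    have := hH.output_eq ht hr h₁ hu1
    rw [ho, ht2] at this
    rw [Option.some.inj this, sharedKey_pubKey h₁ h₂]

/-- A step of the model and of the simulation give the same answer and lead to related states,
unless the guess fails, in which case it fails on both sides. A session created in slot `0` or `1`
sends the same message on both sides and differs only in what is forgotten; in slot `2` the answer
to the test is the key of the DSDP instance; elsewhere both sides use the same secret. -/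
theorem Linked.step {N : ℕ} {h : P.R} {b : Bool} {r : ℕ} {sk₁ sk₂ sk₃ : P.R × P.R}
    (h₁ : sk₁ ∈ (sampleSecret P).support) (h₂ : sk₂ ∈ (sampleSecret P).support)
    (h₃ : sk₃ ∈ (sampleSecret P).support) {key : P.R}
    (hkey : key = if b then pubKey h sk₃ else sharedKey sk₂ (pubKey h sk₁))
    {g g' : Game P} (hl : Linked h r (pubKey h sk₁) (pubKey h sk₂) g g') (Q : Query P)
    {sk : P.R × P.R} (hsk : sk ∈ (sampleSecret P).support) :
    ((realStep N h b (pick (three sk₁ sk₂ sk₃) (slot r g Q) sk) g Q).1 =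
        (simStep N h r (pubKey h sk₁) (pubKey h sk₂) key sk g' Q).1 ∧
      Linked h r (pubKey h sk₁) (pubKey h sk₂)
        (realStep N h b (pick (three sk₁ sk₂ sk₃) (slot r g Q) sk) g Q).2
        (simStep N h r (pubKey h sk₁) (pubKey h sk₂) key sk g' Q).2) ∨
    (Inv (realStep N h b (pick (three sk₁ sk₂ sk₃) (slot r g Q) sk) g Q).2 ∧
      Bad r (realStep N h b (pick (three sk₁ sk₂ sk₃) (slot r g Q) sk) g Q).2) ∧
    (Inv (simStep N h r (pubKey h sk₁) (pubKey h sk₂) key sk g' Q).2 ∧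
      Bad r (simStep N h r (pubKey h sk₁) (pubKey h sk₂) key sk g' Q).2) := by
  obtain ⟨hI, hI', hH, hS, hnb, hm⟩ := hl
  have hslot : slot r g' Q = slot r g Q := by
    rw [← slot_mask (Special r g) r g', ← hm, slot_mask]
  set skr := pick (three sk₁ sk₂ sk₃) (slot r g Q) sk with hskr
  set pk := simPk h r (pubKey h sk₁) (pubKey h sk₂) sk g' Q with hpk
  have hskr_mem : skr ∈ (sampleSecret P).support := by
    rw [hskr]
    unfold pick
    match slot r g Q with
    | 0 => exact h₁
    | 1 => exact h₂
    | 2 => exact h₃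
    | _ + 3 => exact hsk
  set tk : P.R → P.R := fun key => if b then pubKey h skr else key with htk
  change ((genStep N skr (pubKey h skr) tk g Q).1 = (genStep N sk pk (fun _ => key) g' Q).1 ∧
    Linked h r _ _ (genStep N skr (pubKey h skr) tk g Q).2
      (genStep N sk pk (fun _ => key) g' Q).2) ∨
    (Inv (genStep N skr (pubKey h skr) tk g Q).2 ∧ Bad r (genStep N skr (pubKey h skr) tk g Q).2) ∧
    (Inv (genStep N sk pk (fun _ => key) g' Q).2 ∧ Bad r (genStep N sk pk (fun _ => key) g' Q).2)
  have hI1 := hI.genStep N skr (pubKey h skr) tk Q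
  have hI1' := hI'.genStep N sk pk (fun _ => key) Q
  have hH1 := hH.genStep hskr_mem hI N tk Q
  have hS1 : ¬ Bad r (genStep N skr (pubKey h skr) tk g Q).2 →
      Sent r (pubKey h sk₁) (pubKey h sk₂) (genStep N skr (pubKey h skr) tk g Q).2 :=
    hS.step hI N skr _ tk Q (fun hs => by rw [hskr, hs]; rfl) (fun hs => by rw [hskr, hs]; rfl)
  set g1 := (genStep N skr (pubKey h skr) tk g Q).2 with hg1
  set g1' := (genStep N sk pk (fun _ => key) g' Q).2 with hg1'
  have hpre : initKeys g <+: initKeys g1 := initKeys_prefix _ _ _ _ _ _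
  -- the secret of the model may be replaced by that of the simulation, or the session is special
  obtain ⟨sk', hsk', hsp⟩ : ∃ sk', (∀ tk, genStep N skr (pubKey h skr) tk g Q =
      genStep N sk' pk tk g Q) ∧ (sk' = sk ∨ ∀ y, newKey g Q = some y → Special r g1 y) := by
    rcases lt_or_ge (slot r g Q) 3 with hlt | hge
    · interval_cases hs : slot r g Q
      · have e1 : skr = sk₁ := by rw [hskr]; rfl
        have e2 : pk = pubKey h sk₁ := by rw [hpk, simPk, hslot, if_pos rfl]
        obtain ⟨he, hr⟩ := slot_eq_zero hs
        cases Q with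
        | establish i j s =>
          rcases genStep_created N skr (pubKey h skr) tk (y := (i, j, s)) (g := g)
            (Q := .establish i j s) rfl with hc | hc
          · exact ⟨sk, fun tk' => (hc _ _ _).trans (hc _ _ _).symm, Or.inl rfl⟩
          · refine ⟨skr, fun tk' => by rw [e1, e2], Or.inr fun y hy => ?_⟩
            obtain ⟨F, hF, hL | ⟨t, hc', hL⟩⟩ :=
              genStep_sessions N skr (pubKey h skr) tk g (.establish i j s)
            · obtain ⟨t, hc', ht⟩ := hc skr (pubKey h skr) tk
              rw [hL] at ht
              replace ht := List.mem_map.1 ht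
              obtain ⟨u, hu, rfl⟩ := ht
              exact absurd (hF.key u).symm (ne_of_created hc' hu)
            · refine ⟨y, ?_, Or.inl rfl⟩
              have hy' := hc'.key
              rw [hy, Option.some.injEq] at hy'
              have hti : t.initiator = true := hc'.initiator
              rw [hg1, initKeys_of_append hF hL, hti, if_pos rfl, hy', ← hr]
              simp
        | _ => cases he
      · have e1 : skr = sk₂ := by rw [hskr]; rfl
        have e2 : pk = pubKey h sk₂ := by rw [hpk, simPk, hslot, if_neg (by omega), if_pos rfl]
        refine ⟨skr, fun tk' => by rw [e1, e2], Or.inr fun y hy => ?_⟩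
        obtain ⟨-, x, hx, hk⟩ := slot_eq_one hs
        rw [hk, Option.some.injEq] at hy
        exact ⟨x, getElem?_of_prefix hpre hx, Or.inr hy.symm⟩
      · refine ⟨sk, fun tk' => ?_, Or.inl rfl⟩
        have := slot_eq_two.1 hs
        cases Q with
        | test i s => simp only [genStep]
        | _ => cases this
    · have e1 : skr = sk := by
        rw [hskr]
        unfold pick
        match slot r g Q, hge with
        | _ + 3, _ => rfl
      have e2 : pk = pubKey h sk := by
        rw [hpk, simPk, hslot, if_neg (by omega), if_neg (by omega)]
      exact ⟨sk, fun tk' => by rw [e1, e2], Or.inl rfl⟩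
  have hg1K : g1 = (genStep N sk' pk (fun _ => key) g Q).2 := by
    rw [← hsk', hg1]
    exact genStep_snd_congr_test _ _ _ _ _ _ _
  have hmS : mask (Special r g1) g = mask (Special r g1) g' := by
    rw [← mask_mask (S := Special r g1) (S' := Special r g) fun y hy => hy.mono hpre, hm,
      mask_mask (S := Special r g1) (S' := Special r g) fun y hy => hy.mono hpre]
  obtain ⟨ha, hb⟩ := mask_genStep (Special r g1) hI N pk key Q hsp
  obtain ⟨ha', hb'⟩ := mask_genStep (Special r g1) hI' N (sk := sk) (sk' := sk) pk key Q
    (Or.inl rfl)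
  rw [← hg1K, hmS, ← ha'] at ha
  change mask _ g1 = mask _ g1' at ha
  have hbad : Bad r g1 ↔ Bad r g1' := by
    rw [← bad_mask (Special r g1), ha, bad_mask]
  have hkeys : initKeys g1' = initKeys g1 := by
    rw [← initKeys_mask (Special r g1) g1', ← ha, initKeys_mask]
  by_cases hB : Bad r g1
  · exact Or.inr ⟨⟨hI1, hB⟩, hI1', hbad.1 hB⟩
  left
  refine ⟨?_, hI1, hI1', hH1, hS1 hB, hB, ha⟩
  have htest : genStep N skr (pubKey h skr) tk g Q = genStep N sk' pk (fun _ => key) g Q := by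
    rw [← hsk']
    refine genStep_congr_test _ _ _ _ _ ?_
    intro i s t key' hQ hf ho hn hexp hfr
    subst hQ
    have hslot2 : slot r g (.test i s) = 2 := slot_eq_two.2 rfl
    obtain ⟨ht, hto, hts⟩ := find_some hf
    rw [htk, hkey]
    cases b with
    | true =>
      simp only [if_true]
      rw [hskr, hslot2]
      rfl
    | false =>
      simp only [Bool.false_eq_true, if_false]
      have hg1e : g1 = { g with test := some (i, s) } := by
        rw [hg1]
        simp only [genStep, hf, ho]
        rw [if_pos ⟨hn, hexp, hfr⟩]
      refine test_key h₁ h₂ hI hH hS ht hfr ho ?_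
      by_contra hns
      refine hB (Or.inl ⟨t, ?_, ?_, ?_⟩)
      · rw [hg1e]; exact ht
      · rw [hg1e, hto, hts]
      · rw [hg1e]; exact hns
  rw [htest]
  rcases hb with hb | ⟨t, ht, hsp, he⟩
  · rcases hb' with hb' | ⟨t, ht, hsp, he⟩
    · rw [hb, hb', hmS]
    · refine absurd (hbad.2 (Or.inr (Or.inl ⟨t, ht, ?_, he⟩))) hB
      unfold Special at hsp ⊢
      rwa [hkeys]
  · refine absurd (Or.inr (Or.inl ⟨t, ?_, hsp, he⟩)) hB
    rw [hg1K]
    exact ht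

open Classical in
/-- With the right guess, the model and the simulation have the same outcome. -/
theorem interp_sim (N : ℕ) (h : P.R) (b : Bool) (r : ℕ) {t : Tree P.K} {B : ℕ} (ht : t.Bounded B) :
    (interp (amOracle N h b) t (Game.init P)).map
      (fun w => w.1.toBool && decide (Hit r w.2.1)) =
    (sampleSecret P).bind fun sk₁ => (sampleSecret P).bind fun sk₂ => (sampleSecret P).bind
      fun sk₃ => (interp (fun q g => (sampleSecret P).map fun sk =>
        simStep N h r (pubKey h sk₁) (pubKey h sk₂)
          (if b then pubKey h sk₃ else sharedKey sk₂ (pubKey h sk₁)) sk g (decQuery q)) t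
        (Game.init P)).map (fun w => w.1.toBool && decide (Hit r w.2.1)) := by
  rw [interp_amOracle_eager N h b r, PMF.map_bind]
  refine bind_congr_support fun sk₁ h₁ => ?_
  rw [PMF.map_bind]
  refine bind_congr_support fun sk₂ h₂ => ?_
  rw [PMF.map_bind]
  refine bind_congr_support fun sk₃ h₃ => ?_
  refine interp_couple (sampleSecret P)
    (fun q g sk => realStep N h b (pick (three sk₁ sk₂ sk₃) (slot r g (decQuery q)) sk) g
      (decQuery q))
    (fun q g sk => simStep N h r (pubKey h sk₁) (pubKey h sk₂)
          (if b then pubKey h sk₃ else sharedKey sk₂ (pubKey h sk₁)) sk g (decQuery q))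
    (fun _ g g' => Linked h r (pubKey h sk₁) (pubKey h sk₂) g g')
    (fun g => Inv g ∧ Bad r g) (fun g => Inv g ∧ Bad r g)
    (fun _ g g' hl q sk hsk => hl.step h₁ h₂ h₃ rfl (decQuery q) hsk)
    (fun g hg q sk _ => ⟨hg.1.genStep _ _ _ _ _, hg.2.step hg.1 _ _ _ _ _⟩)
    (fun g hg q sk _ => ⟨hg.1.genStep _ _ _ _ _, hg.2.step hg.1 _ _ _ _ _⟩)
    (fun v g => v.toBool && decide (Hit r g)) (fun v g => v.toBool && decide (Hit r g)) false
    ?_ ?_ ?_ ht ?_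
  · intro v g hg
    simp [Hit, hg.2]
  · intro v g hg
    simp [Hit, hg.2]
  · intro _ g g' hl v
    have h1 : Bad r g ↔ Bad r g' := by
      rw [← bad_mask (Special r g), hl.masked, bad_mask]
    have h2 : g.test = g'.test := by
      have := congrArg Game.test hl.masked
      exact this
    have h3 : Hit r g ↔ Hit r g' := by rw [Hit, Hit, h1, h2]
    rw [decide_eq_decide.2 h3]
  · refine ⟨Inv.init, Inv.init, fun t ht => (by cases ht), ⟨fun t ht => (by cases ht),
      fun t ht => (by cases ht)⟩, ?_, rfl⟩
    rintro (⟨t, ht, -⟩ | ⟨t, ht, -⟩ | ⟨y, hy, -⟩)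
    · cases ht
    · cases ht
    · simp [initKeys, Game.init] at hy

end Simulation

/-! ### The advantage as a sum over the guesses -/

section Sum

theorem map_apply_true {W : Type} (μ : PMF W) (f : W → Bool) :
    (μ.map f) true = ∑' w, if f w = true then μ w else 0 := by
  classical
  rw [PMF.map_apply]
  refine tsum_congr fun w => ?_
  simp only [eq_comm (a := true)]

/-- The probability of an event that is split into disjoint events. -/
theorem map_true_eq_sum {W ι : Type} (μ : PMF W) (s : Finset ι) (f : W → Bool) (g : ι → W → Bool)
    (f₀ : W → Bool) (h : ∀ w ∈ μ.support, (if f w = true then (1 : ENNReal) else 0) =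
      (∑ i ∈ s, if g i w = true then 1 else 0) + if f₀ w = true then 1 else 0) :
    (μ.map f) true = (∑ i ∈ s, (μ.map (g i)) true) + (μ.map f₀) true := by
  simp only [map_apply_true]
  rw [← Summable.tsum_finsetSum fun i _ => ENNReal.summable, ← ENNReal.tsum_add]
  refine tsum_congr fun w => ?_
  by_cases hw : w ∈ μ.support
  · have := congrArg (μ w * ·) (h w hw)
    simpa only [mul_add, Finset.mul_sum, mul_ite, mul_one, mul_zero] using this
  · simp [(μ.apply_eq_zero_iff w).2 hw]

theorem bind_true_eq_sum {α ι : Type} (p : PMF α) (s : Finset ι) (q : α → PMF Bool)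
    (q' : ι → α → PMF Bool) (q₀ : α → PMF Bool)
    (h : ∀ a ∈ p.support, q a true = (∑ i ∈ s, q' i a true) + q₀ a true) :
    (p.bind q) true = (∑ i ∈ s, (p.bind (q' i)) true) + (p.bind q₀) true := by
  simp only [PMF.bind_apply]
  rw [← Summable.tsum_finsetSum fun i _ => ENNReal.summable, ← ENNReal.tsum_add]
  refine tsum_congr fun a => ?_
  by_cases ha : a ∈ p.support
  · rw [h a ha, mul_add, Finset.mul_sum]
  · simp [(p.apply_eq_zero_iff a).2 ha]

theorem pmf_bool_false (μ : PMF Bool) : (μ false).toReal = 1 - (μ true).toReal := by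
  have h := μ.tsum_coe
  rw [tsum_fintype, Fintype.sum_bool] at h
  have := congrArg ENNReal.toReal h
  rw [ENNReal.toReal_add (μ.apply_ne_top _) (μ.apply_ne_top _), ENNReal.toReal_one] at this
  linarith

theorem uniformBelow_bind_apply {k : ℕ} (hk : 0 < k) (q : ℕ → PMF Bool) :
    k * (((uniformBelow k).bind q) true).toReal = ∑ r ∈ Finset.range k, (q r true).toReal := by
  rw [uniformBelow, dif_pos hk, PMF.bind_apply, tsum_eq_sum (s := Finset.range k)]
  · rw [ENNReal.toReal_sum, Finset.mul_sum]
    · refine Finset.sum_congr rfl fun r hr => ?_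
      rw [PMF.uniformOfFinset_apply_of_mem _ hr, ENNReal.toReal_mul, Finset.card_range,
        ENNReal.toReal_inv, ENNReal.toReal_natCast, ← mul_assoc, mul_inv_cancel₀, one_mul]
      exact_mod_cast hk.ne'
    · intro r _
      exact ENNReal.mul_ne_top (PMF.apply_ne_top _ _) (PMF.apply_ne_top _ _)
  · intro r hr
    rw [PMF.uniformOfFinset_apply_of_notMem _ hr, zero_mul]

variable {P : Params}

/-- A property that is preserved by the oracle holds at the end of the interaction. -/
theorem interp_invariant {S : Type} {O : Oracle P S} {I : S → Prop}
    (h : ∀ s, I s → ∀ q, ∀ w ∈ (O q s).support, I w.2) (t : Tree P.K) {s : S} (hs : I s)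
    {w : Val P.K × S × ℕ} (hw : w ∈ (interp O t s).support) : I w.2.1 := by
  induction t generalizing s with
  | ret v c =>
    rw [interp, PMF.mem_support_pure_iff] at hw
    rw [hw]
    exact hs
  | samp d k ih =>
    obtain ⟨v, -, hv⟩ := (PMF.mem_support_bind_iff _ _ _).1 hw
    exact ih v hs hv
  | call q k ih =>
    obtain ⟨r, hr, hr'⟩ := (PMF.mem_support_bind_iff _ _ _).1 hw
    exact ih _ (h s hs q r hr) hr'

/-- The output bit of the adversary, if its public element is random and the test bit is `b`. -/
def outDist (P : Params) (k N : ℕ) (A : Prog) (b : Bool) : PMF Bool :=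
  (samplePublic P).bind fun h => (amRun P k N A h b).map fun w => w.1.toBool

open Classical in
/-- Whether the adversary outputs `1` and the `r`-th guess is correct. -/
def hitDist (P : Params) (k N : ℕ) (A : Prog) (b : Bool) (r : ℕ) : PMF Bool :=
  (samplePublic P).bind fun h => (amRun P k N A h b).map fun w =>
    w.1.toBool && decide (Hit r w.2.1)

/-- Without a test, the test bit has no effect. -/
theorem noTest_indep (N : ℕ) (h : P.R) {t : Tree P.K} {B : ℕ} (ht : t.Bounded B) :
    (interp (amOracle N h true) t (Game.init P)).map
      (fun w => w.1.toBool && decide (w.2.1.test = none)) =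
    (interp (amOracle N h false) t (Game.init P)).map
      (fun w => w.1.toBool && decide (w.2.1.test = none)) := by
  have hO : ∀ b, amOracle N h b = fun v g => (sampleSecret P).map fun sk =>
      realStep N h b sk g (decQuery v) := fun b => by
    funext v g
    exact answer_eq _ _ _ _ _
  rw [hO, hO]
  refine interp_couple (sampleSecret P) (fun v g sk => realStep N h true sk g (decQuery v))
    (fun v g sk => realStep N h false sk g (decQuery v)) (fun _ g g' => g = g')
    (fun g => g.test ≠ none) (fun g => g.test ≠ none) ?_ ?_ ?_
    (fun v g => v.toBool && decide (g.test = none)) (fun v g => v.toBool && decide (g.test = none))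
    false ?_ ?_ ?_ ht rfl
  · rintro _ g _ rfl v sk -
    have h2 : (realStep N h true sk g (decQuery v)).2 = (realStep N h false sk g (decQuery v)).2 :=
      genStep_snd_congr_test _ _ _ _ _ _ _
    by_cases hn : (realStep N h true sk g (decQuery v)).2.test = none
    · left
      refine ⟨?_, h2⟩
      have : realStep N h true sk g (decQuery v) = realStep N h false sk g (decQuery v) := by
        refine genStep_congr_test _ _ _ _ _ ?_
        intro i s t key hQ hf ho hnt hexp hfr
        rw [hQ] at hn
        simp only [realStep, genStep, hf, ho] at hn
        rw [if_pos ⟨hnt, hexp, hfr⟩] at hn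
        cases hn
      rw [this]
    · exact Or.inr ⟨hn, h2 ▸ hn⟩
  · exact fun g hg v sk _ => genStep_test_ne_none _ _ _ _ _ hg
  · exact fun g hg v sk _ => genStep_test_ne_none _ _ _ _ _ hg
  · intro v g hg
    simp [hg]
  · intro v g hg
    simp [hg]
  · rintro _ g _ rfl v
    rfl

theorem outDist_eq {pp : ℕ → Params} {N : ℕ[X]} {A : Prog} {l : ℕ[X]}
    (hl : SessionBound pp N A l) (k : ℕ) (b : Bool) :
    outDist (pp k) k (N.eval k) A b true =
      (∑ r ∈ Finset.range (l.eval k), hitDist (pp k) k (N.eval k) A b r true) +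
      ((samplePublic (pp k)).bind fun h => (amRun (pp k) k (N.eval k) A h b).map fun w =>
        w.1.toBool && decide (w.2.1.test = none)) true := by
  classical
  refine bind_true_eq_sum _ _ _ _ _ fun h hh => map_true_eq_sum _ _ _ _ _ fun w hw => ?_
  have hI : Inv w.2.1 := by
    unfold amRun at hw
    rw [run_eq_interp] at hw
    refine interp_invariant (I := Inv) ?_ _ Inv.init hw
    intro g hg q w hw
    rw [amOracle, answer_eq] at hw
    obtain ⟨sk, -, rfl⟩ := (PMF.mem_support_map_iff _ _ _).1 hw
    exact hg.genStep _ _ _ _ _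
  have hlen : (initKeys w.2.1).length ≤ l.eval k := by
    rw [initKeys, List.length_map]
    exact hl k h hh b w hw
  cases w.1.toBool with
  | false => simp
  | true =>
    by_cases ht : w.2.1.test = none
    · simp [Hit, ht]
    · obtain ⟨r₀, h0, h1⟩ := exists_hit hI ht
      simp only [Bool.true_and, decide_eq_true_eq, h1, if_true]
      rw [Finset.sum_ite_eq' , if_pos (Finset.mem_range.2 (h0.trans_le hlen)), if_neg ht, add_zero]

/-- The probability of guessing a random bit, in terms of the two values of the bit. -/
theorem two_skAdv (pp : ℕ → Params) (N : ℕ[X]) (A : Prog) (k : ℕ) :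
    2 * skAdv pp N A k = |(outDist (pp k) k (N.eval k) A true true).toReal -
      (outDist (pp k) k (N.eval k) A false true).toReal| := by
  have h1 : skGame (pp k) k (N.eval k) A = (PMF.uniformOfFintype Bool).bind fun b =>
      (outDist (pp k) k (N.eval k) A b).map fun o => o == b := by
    unfold skGame outDist
    simp only [pmf_bind_eq, pmf_pure_eq]
    rw [PMF.bind_comm]
    simp only [PMF.map_bind, PMF.map_comp]
    rfl
  have h2 : ∀ μ : PMF Bool, (μ.map fun o => o == true) true = μ true := by
    intro μ
    rw [map_apply_true, tsum_fintype, Fintype.sum_bool]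
    simp
  have h3 : ∀ μ : PMF Bool, (μ.map fun o => o == false) true = μ false := by
    intro μ
    rw [map_apply_true, tsum_fintype, Fintype.sum_bool]
    simp
  rw [skAdv, h1, PMF.bind_apply, tsum_fintype, Fintype.sum_bool, h2, h3]
  simp only [PMF.uniformOfFintype_apply, Fintype.card_bool]
  rw [ENNReal.toReal_add (ENNReal.mul_ne_top (by simp) (PMF.apply_ne_top _ _))
    (ENNReal.mul_ne_top (by simp) (PMF.apply_ne_top _ _)), ENNReal.toReal_mul, ENNReal.toReal_mul,
    pmf_bool_false]
  have : ((2 : ENNReal)⁻¹).toReal = 1 / 2 := by simp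
  have e : ((2 : ℕ) : ENNReal) = 2 := by norm_num
  rw [e, this, ← abs_two, ← abs_mul, abs_two]
  congr 1
  ring

/-- The reduction, for a DSDP adversary whose output is that of the simulation with a random
guess. -/
theorem two_skAdv_eq {pp : ℕ → Params} {N : ℕ[X]} {A : Prog} {l : ℕ[X]} {D : Prog}
    (hA : EfficientAM pp N A) (hl : SessionBound pp N A l) (k : ℕ)
    (hD : ∀ b, dsdpExp (pp k) k D b = (uniformBelow (l.eval k)).bind
      (hitDist (pp k) k (N.eval k) A b)) :
    2 * skAdv pp N A k = ((l.eval k : ℕ) : ℝ) * dsdpAdv pp D k := by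
  obtain ⟨T, hT⟩ := hA
  have hnone : ((samplePublic (pp k)).bind fun h => (amRun (pp k) k (N.eval k) A h true).map
        fun w => w.1.toBool && decide (w.2.1.test = none)) =
      (samplePublic (pp k)).bind fun h => (amRun (pp k) k (N.eval k) A h false).map
        fun w => w.1.toBool && decide (w.2.1.test = none) := by
    congr 1; funext h
    unfold amRun
    rw [run_eq_interp, run_eq_interp]
    refine noTest_indep _ _ ((tree_callsLe A _).bounded (T := T.eval k) fun s w hw => ?_)
    rw [← run_eq_interp] at hw
    exact hT k _ ⟨h, rfl⟩ _ _ s w hw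
  rw [two_skAdv, outDist_eq hl, outDist_eq hl, hnone]
  rw [ENNReal.toReal_add (ENNReal.sum_ne_top.2 fun _ _ => PMF.apply_ne_top _ _)
      (PMF.apply_ne_top _ _),
    ENNReal.toReal_add (ENNReal.sum_ne_top.2 fun _ _ => PMF.apply_ne_top _ _)
      (PMF.apply_ne_top _ _), add_sub_add_right_eq_sub,
    ENNReal.toReal_sum fun _ _ => PMF.apply_ne_top _ _,
    ENNReal.toReal_sum fun _ _ => PMF.apply_ne_top _ _]
  rcases Nat.eq_zero_or_pos (l.eval k) with h0 | hpos
  · simp [h0]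
  · rw [← uniformBelow_bind_apply hpos, ← uniformBelow_bind_apply hpos, ← hD, ← hD, ← mul_sub,
      abs_mul, dsdpAdv, abs_sub_comm, Nat.abs_cast]

end Sum

/-! ### The state of the model as a value -/

/-- Replace the entry at position `k` of a list. -/
def Val.setAt {K : Type} : ℕ → Val K → Val K → Val K
  | 0, x, v => .pair x v.snd
  | k + 1, x, v => .pair v.fst (setAt k x v.snd)

instance DC.setAt {d e : ∀ P : Params, ℕ → Val P.K → Val P.K} [hd : DC d] [he : DC e] (k : ℕ) :
    DC fun P M v => (d P M v).setAt k (e P M v) := by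
  induction k generalizing e with
  | zero => exact DC.pair (hd := hd) (he := inferInstance)
  | succ k ih =>
    exact DC.pair (hd := DC.fst (hd := he)) (he := ih (e := fun P M v => (e P M v).snd))

instance DC.ofBool {b : ∀ P : Params, ℕ → Val P.K → Bool} [hb : BC b] :
    DC fun P M v => Val.ofBool (b P M v) := hb

instance DC.nat {i : ∀ P : Params, ℕ → Val P.K → ℕ} [hi : NC i] :
    DC fun P M v => Val.nat (i P M v) := hi

section Encode

variable {P : Params}

/-- The record of a session as a value. -/
def encS (t : Session P) : Val P.K :=
  .ofList [.nat t.owner, .nat t.peer, .nat t.sid, .ofBool t.initiator, .ofOption encSk t.secret,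
    encR t.sent, .ofBool t.delivered, .ofOption encR t.received, .ofOption encR t.output,
    .ofBool t.expired, .ofBool t.stopped, .ofBool t.exposed]

/-- The test session as a value. -/
def encTest : Option (ℕ × ℕ) → Val P.K := .ofOption fun x => .pair (.nat x.1) (.nat x.2)

/-- The value `v` represents the state `g`, and within the bound `M` on the length of lists there
is room for `B` more sessions and corruptions. The order in which parties were corrupted is not
determined by `g`. -/
def Rep (M B : ℕ) (v : Val P.K) (g : Game P) : Prop :=
  ∃ c : List ℕ, v = .pair (.ofList (g.sessions.map encS))
      (.pair (.ofList (c.map .nat)) (encTest g.test)) ∧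
    (∀ i, i ∈ c ↔ i ∈ g.corrupted) ∧ g.sessions.length + B ≤ M ∧ c.length + B ≤ M

theorem Rep.mono {M B : ℕ} {v : Val P.K} {g : Game P} (h : Rep M (B + 1) v g) : Rep M B v g := by
  obtain ⟨c, h1, h2, h3, h4⟩ := h
  exact ⟨c, h1, h2, by omega, by omega⟩

theorem Val.toNat_nat {K : Type} (k : ℕ) : (Val.nat k : Val K).toNat = k := rfl

section get

variable (t : Session P)

theorem encS_owner : ((encS t).get 0).toNat = t.owner := rfl

theorem encS_peer : ((encS t).get 1).toNat = t.peer := rfl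

theorem encS_sid : ((encS t).get 2).toNat = t.sid := rfl

theorem encS_initiator : ((encS t).get 3).toBool = t.initiator := Val.toBool_ofBool _

theorem encS_sent : (encS t).get 5 = encR t.sent := rfl

theorem encS_delivered : ((encS t).get 6).toBool = t.delivered := Val.toBool_ofBool _

theorem encS_received : (encS t).get 7 = .ofOption encR t.received := rfl

theorem encS_output : (encS t).get 8 = .ofOption encR t.output := rfl

theorem encS_expired : ((encS t).get 9).toBool = t.expired := Val.toBool_ofBool _

theorem encS_stopped : ((encS t).get 10).toBool = t.stopped := Val.toBool_ofBool _

theorem encS_exposed : ((encS t).get 11).toBool = t.exposed := Val.toBool_ofBool _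

end get

end Encode

/-! ### Programs for the parts of a step -/

/-- Whether a value encodes `some`. -/
def isSomeV {K : Type} (v : Val K) : Bool := decide (v.tag = 2)

theorem isSomeV_ofOption {K α : Type} (f : α → Val K) (o : Option α) :
    isSomeV (Val.ofOption f o) = o.isSome := by
  cases o <;> rfl

instance BC.isSomeV {d : ∀ P : Params, ℕ → Val P.K → Val P.K} [hd : DC d] :
    BC fun P M v => isSomeV (d P M v) := by
  unfold SkewDihedral.isSomeV
  infer_instance

/-- The session with owner `i` and session-id `s` in a list. -/
def findV (P : Params) (M : ℕ) (L i s : Val P.K) : Val P.K :=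
  Val.ofOption id ((L.toList M).find? fun t =>
    (t.get 0).toNat == i.toNat && (t.get 2).toNat == s.toNat)

/-- Overwrite a field, unless the new value is missing. -/
def orV {K : Type} (o x : Val K) : Val K := bif isSomeV o then o.snd else x

/-- Overwrite the fields of a session that may change. -/
def updV {K : Type} (u t : Val K) : Val K :=
  Val.setAt 4 (orV (u.get 0) (t.get 4)) <| Val.setAt 6 (orV (u.get 1) (t.get 6)) <|
  Val.setAt 7 (orV (u.get 2) (t.get 7)) <| Val.setAt 8 (orV (u.get 3) (t.get 8)) <|
  Val.setAt 9 (orV (u.get 4) (t.get 9)) <| Val.setAt 10 (orV (u.get 5) (t.get 10)) <|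
  Val.setAt 11 (orV (u.get 6) (t.get 11)) t

/-- Overwrite the fields of the session with owner `i` and session-id `s`. -/
def modV (P : Params) (M : ℕ) (L i s u : Val P.K) : Val P.K :=
  Val.ofList ((L.toList M).map fun t =>
    bif (t.get 0).toNat == i.toNat && (t.get 2).toNat == s.toNat then updV u t else t)

/-- Whether two sessions are partners. -/
def partnerV {K : Type} (t u : Val K) : Bool :=
  (t.get 0).toNat == (u.get 1).toNat && (t.get 1).toNat == (u.get 0).toNat &&
    (t.get 2).toNat == (u.get 2).toNat

/-- Whether a number is in a list. -/
def memV (P : Params) (M : ℕ) (C i : Val P.K) : Bool :=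
  (C.toList M).any fun x => x.toNat == i.toNat

/-- Whether a session is protected by the test; `T` encodes the test session. -/
def protV (P : Params) (M : ℕ) (L T u : Val P.K) : Bool :=
  (L.toList M).any fun t =>
    isSomeV T && T.snd.fst.toNat == (t.get 0).toNat && T.snd.snd.toNat == (t.get 2).toNat &&
      ((u.get 0).toNat == (t.get 0).toNat && (u.get 2).toNat == (t.get 2).toNat || partnerV t u)

/-- Whether a session matches another one. -/
def matchV (P : Params) (M : ℕ) (n t u : Val P.K) : Bool :=
  partnerV t u && (isSomeV (t.get 7) && eqV P M n (t.get 7).snd (u.get 5)) &&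
    (isSomeV (u.get 7) && eqV P M n (u.get 7).snd (t.get 5))

/-- Whether a session is fresh. -/
def freshV (P : Params) (M : ℕ) (n L C t : Val P.K) : Bool :=
  !(t.get 11).toBool && !((L.toList M).any fun u => partnerV t u && (u.get 11).toBool) &&
    (!memV P M C (t.get 1) || (L.toList M).any fun u => matchV P M n t u)

section DCinst

variable {a b c d e : ∀ P : Params, ℕ → Val P.K → Val P.K}

instance DC.findV [DC b] [DC c] [DC d] :
    DC fun P M v => findV P M (b P M v) (c P M v) (d P M v) := by
  refine DC.comp₃ (F := SkewDihedral.findV) ?_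
  unfold SkewDihedral.findV
  infer_instance

instance DC.updV [DC b] [DC c] : DC fun P M v => updV (b P M v) (c P M v) := by
  unfold SkewDihedral.updV SkewDihedral.orV
  infer_instance

instance DC.modV [DC b] [DC c] [DC d] [DC e] :
    DC fun P M v => modV P M (b P M v) (c P M v) (d P M v) (e P M v) := by
  refine DC.comp₄ (F := SkewDihedral.modV) ?_
  unfold SkewDihedral.modV
  infer_instance

instance BC.partnerV [DC b] [DC c] : BC fun P M v => partnerV (b P M v) (c P M v) := by
  unfold SkewDihedral.partnerV
  infer_instance

instance BC.memV [DC b] [DC c] : BC fun P M v => memV P M (b P M v) (c P M v) := by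
  refine DC.comp₂ (F := fun P M a b => .ofBool (SkewDihedral.memV P M a b)) ?_
  unfold SkewDihedral.memV
  infer_instance

instance BC.protV [DC b] [DC c] [DC d] :
    BC fun P M v => protV P M (b P M v) (c P M v) (d P M v) := by
  refine DC.comp₃ (F := fun P M a b c => .ofBool (SkewDihedral.protV P M a b c)) ?_
  unfold SkewDihedral.protV
  infer_instance

instance BC.matchV [DC b] [DC c] [DC d] :
    BC fun P M v => matchV P M (b P M v) (c P M v) (d P M v) := by
  unfold SkewDihedral.matchV
  infer_instance

instance BC.freshV [DC b] [DC c] [DC d] [DC e] :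
    BC fun P M v => freshV P M (b P M v) (c P M v) (d P M v) (e P M v) := by
  refine DC.comp₄ (F := fun P M a b c d => .ofBool (SkewDihedral.freshV P M a b c d)) ?_
  unfold SkewDihedral.freshV
  infer_instance

end DCinst

section Enc

variable {P : Params} {M : ℕ}

theorem findV_enc {L : List (Session P)} (hL : L.length ≤ M) (i s : ℕ) :
    findV P M (.ofList (L.map encS)) (.nat i) (.nat s) =
      .ofOption encS (L.find? fun t => t.owner == i && t.sid == s) := by
  unfold findV
  rw [Val.toList_ofList_of_le (by simpa using hL), List.find?_map]
  simp only [Function.comp_def, encS_owner, encS_sid, Val.toNat_nat]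
  cases L.find? fun t => t.owner == i && t.sid == s <;> rfl

theorem modV_enc {L : List (Session P)} (hL : L.length ≤ M) (i s : ℕ) {u : Val P.K}
    {f : Session P → Session P} (hf : ∀ t, updV u (encS t) = encS (f t)) :
    modV P M (.ofList (L.map encS)) (.nat i) (.nat s) u =
      .ofList ((L.map fun t => if t.owner == i && t.sid == s then f t else t).map encS) := by
  unfold modV
  rw [Val.toList_ofList_of_le (by simpa using hL), List.map_map, List.map_map]
  congr 1
  refine List.map_congr_left fun t _ => ?_
  simp only [Function.comp_apply, encS_owner, encS_sid, Val.toNat_nat]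
  cases t.owner == i && t.sid == s
  · rfl
  · exact hf t

theorem partnerV_enc (t u : Session P) : partnerV (encS t) (encS u) = true ↔ t.Partner u := by
  simp only [partnerV, encS_owner, encS_peer, encS_sid, Bool.and_eq_true, beq_iff_eq,
    Session.Partner, and_assoc]

theorem memV_enc {c : List ℕ} (hc : c.length ≤ M) (i : ℕ) :
    memV P M (.ofList (c.map .nat)) (.nat i) = true ↔ i ∈ c := by
  unfold memV
  rw [Val.toList_ofList_of_le (by simpa using hc)]
  simp [Val.toNat]

theorem protV_enc {g : Game P} (hL : g.sessions.length ≤ M) (u : Session P) :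
    protV P M (.ofList (g.sessions.map encS)) (encTest g.test) (encS u) = true ↔
      g.Protected u := by
  unfold protV Game.Protected
  rw [Val.toList_ofList_of_le (by simpa using hL)]
  simp only [List.any_map, List.any_eq_true, Function.comp_apply, Bool.and_eq_true,
    Bool.or_eq_true, partnerV_enc, encS_owner, encS_sid, beq_iff_eq]
  refine exists_congr fun t => and_congr_right fun _ => and_congr_left fun _ => ?_
  cases g.test with
  | none => simp [encTest, Val.ofOption, isSomeV, Val.tag]
  | some x =>
    obtain ⟨a, b⟩ := x
    simp [encTest, Val.ofOption, isSomeV, Val.tag, Val.snd, Val.fst, Val.toNat]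

theorem matchV_enc (hM : P.n + P.n ≤ M) (t u : Session P) :
    matchV P M (.nat P.n) (encS t) (encS u) = true ↔ t.Matching u := by
  have key : ∀ (o : Option P.R) (a : P.R), (isSomeV (Val.ofOption encR o) &&
      eqV P M (.nat P.n) (Val.ofOption encR o).snd (encR a)) = true ↔ o = some a := by
    intro o a
    cases o with
    | none => simp [Val.ofOption, isSomeV, Val.tag]
    | some b => simp [Val.ofOption, isSomeV, Val.tag, Val.snd, eqV_encR hM]
  unfold matchV Session.Matching
  rw [Bool.and_eq_true, Bool.and_eq_true, partnerV_enc, encS_received, encS_received, encS_sent,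
    encS_sent, key, key, and_assoc]

theorem freshV_enc (hM : P.n + P.n ≤ M) {g : Game P} (hL : g.sessions.length ≤ M) {c : List ℕ}
    (hc : c.length ≤ M) (hcc : ∀ i, i ∈ c ↔ i ∈ g.corrupted) (t : Session P) :
    freshV P M (.nat P.n) (.ofList (g.sessions.map encS)) (.ofList (c.map .nat)) (encS t) = true ↔
      g.Fresh t := by
  unfold freshV Game.Fresh
  rw [Val.toList_ofList_of_le (by simpa using hL)]
  have h1 : (encS t).get 1 = .nat t.peer := rfl
  have h2 : (!memV P M (.ofList (c.map .nat)) ((encS t).get 1)) = true ↔ t.peer ∉ g.corrupted := by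
    rw [h1, Bool.not_eq_true', ← Bool.not_eq_true, memV_enc hc, hcc]
  rw [Bool.and_eq_true, Bool.and_eq_true, Bool.or_eq_true, h2]
  simp only [List.any_map, List.any_eq_true, Function.comp_apply, matchV_enc hM, encS_exposed,
    Bool.not_eq_true', ← Bool.not_eq_true, Bool.and_eq_true, partnerV_enc]
  rw [and_assoc]
  refine and_congr_right fun _ => and_congr ?_ ?_
  · push Not
    simp
  · rw [imp_iff_not_or]

end Enc

/-! ### The step of the simulation as a program -/

instance DC.ofList_nil : DC fun _ _ _ => Val.ofList [] := NC.const 0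

instance DC.ofList_cons {d : ∀ P : Params, ℕ → Val P.K → Val P.K}
    {l : ∀ P : Params, ℕ → Val P.K → List (Val P.K)} [hd : DC d]
    [hl : DC fun P M v => Val.ofList (l P M v)] :
    DC fun P M v => Val.ofList (d P M v :: l P M v) := DC.pair (hd := hd) (he := hl)

section Defs

variable {K : Type}

/-- The encoding of `some`. -/
def someV (x : Val K) : Val K := .pair (.nat 1) x

/-- A new session, with owner `i`, peer `j`, session-id `s`. -/
def newV (i j s init secret sent received output : Val K) : Val K :=
  .ofList [i, j, s, init, secret, sent, .nat 0, received, output, .nat 0, .nat 0, .nat 0]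

/-- What the memory contains about a session. -/
def contentsV (t : Val K) : Val K := .ofList [t.get 1, t.get 2, t.get 4, t.get 8]

end Defs

/-- The key computed from a secret pair and an incoming message. -/
def shareV (P : Params) (M : ℕ) (n sk z : Val P.K) : Val P.K :=
  mulV P M n (mulV P M n sk.fst z) (adjV P M n sk.snd)

/-- `recvStep` on the list `[n, sk, pk, state, i, j, s, z]`. -/
def recvV (P : Params) (M : ℕ) (a : Val P.K) : Val P.K :=
  bif memV P M (a.get 3).snd.fst (a.get 5) then .pair (.nat 0) (a.get 3) else
  bif isSomeV (findV P M (a.get 3).fst (a.get 5) (a.get 6)) then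
    (bif isSomeV ((findV P M (a.get 3).fst (a.get 5) (a.get 6)).snd.get 4) &&
        (((findV P M (a.get 3).fst (a.get 5) (a.get 6)).snd.get 1).toNat == (a.get 4).toNat &&
        !((findV P M (a.get 3).fst (a.get 5) (a.get 6)).snd.get 10).toBool) then
      .pair (.nat 1) (.pair (modV P M (a.get 3).fst (a.get 5) (a.get 6)
        (.ofList [someV (.nat 0), .nat 0, someV (someV (a.get 7)),
          someV (someV (shareV P M (a.get 0)
            ((findV P M (a.get 3).fst (a.get 5) (a.get 6)).snd.get 4).snd (a.get 7))),
          .nat 0, .nat 0, .nat 0])) (a.get 3).snd)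
    else .pair (.nat 0) (a.get 3))
  else .pair (.pair (.nat 1) (a.get 2)) (.pair (.ofList (((a.get 3).fst.toList M) ++
    [newV (a.get 5) (a.get 4) (a.get 6) (.nat 0) (.nat 0) (a.get 2) (someV (a.get 7))
      (someV (shareV P M (a.get 0) (a.get 1) (a.get 7)))])) (a.get 3).snd)

/-- The number at position `k` of the query, in the list `[sk, pk, query, n, N, key, state]`. -/
def argV {K : Type} (k : ℕ) (a : Val K) : Val K := .nat ((a.get 2).get k).toNat

/-- The session that the query is about. -/
def curV (P : Params) (M : ℕ) (a : Val P.K) : Val P.K :=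
  findV P M (a.get 6).fst (argV 1 a) (argV 2 a)

/-- The answer to a query that is not admissible. -/
def refuseV {K : Type} (a : Val K) : Val K := .pair (.nat 0) (a.get 6)

/-- Update the session that the query is about. -/
def updateV (P : Params) (M : ℕ) (a u : Val P.K) : Val P.K :=
  .pair (modV P M (a.get 6).fst (argV 1 a) (argV 2 a) u) (a.get 6).snd

/-- The step for a query that activates an initiator. -/
def establishV (P : Params) (M : ℕ) (a : Val P.K) : Val P.K :=
  bif decide ((argV 1 a).toNat < (a.get 4).toNat) && (decide ((argV 3 a).toNat < (a.get 4).toNat) &&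
      (!((argV 1 a).toNat == (argV 3 a).toNat) && (!memV P M (a.get 6).snd.fst (argV 1 a) &&
        !isSomeV (curV P M a)))) then
    .pair (.pair (.nat 1) (a.get 1)) (.pair (.ofList (((a.get 6).fst.toList M) ++
      [newV (argV 1 a) (argV 3 a) (argV 2 a) (.nat 1) (someV (a.get 0)) (a.get 1) (.nat 0)
        (.nat 0)])) (a.get 6).snd)
  else refuseV a

/-- The step for a query that delivers a message. -/
def deliverV (P : Params) (M : ℕ) (a : Val P.K) : Val P.K :=
  bif isSomeV (curV P M a) && !((curV P M a).snd.get 6).toBool then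
    recvV P M (.ofList [a.get 3, a.get 0, a.get 1,
      updateV P M a (.ofList [.nat 0, someV (.nat 1), .nat 0, .nat 0, .nat 0, .nat 0, .nat 0]),
      argV 1 a, (curV P M a).snd.get 1, argV 2 a, (curV P M a).snd.get 5])
  else refuseV a

/-- The step for a query that sends a message on behalf of a corrupted party or session. -/
def injectV (P : Params) (M : ℕ) (a : Val P.K) : Val P.K :=
  bif decide ((argV 1 a).toNat < (a.get 4).toNat) && (decide ((argV 3 a).toNat < (a.get 4).toNat) &&
      (!((argV 1 a).toNat == (argV 3 a).toNat) && (memV P M (a.get 6).snd.fst (argV 1 a) ||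
        (isSomeV (curV P M a) && (((curV P M a).snd.get 10).toBool &&
          ((curV P M a).snd.get 1).toNat == (argV 3 a).toNat))))) then
    recvV P M (.ofList [a.get 3, a.get 0, a.get 1, a.get 6, argV 1 a, argV 3 a, argV 2 a,
      canonV P M (a.get 3) ((a.get 2).get 4)])
  else refuseV a

/-- Whether the session of the query is neither expired nor protected. -/
def openV (P : Params) (M : ℕ) (a : Val P.K) : Bool :=
  !((curV P M a).snd.get 9).toBool &&
    !protV P M (a.get 6).fst (a.get 6).snd.snd (curV P M a).snd

/-- The step for a query that reveals a state. -/
def stateRevealV (P : Params) (M : ℕ) (a : Val P.K) : Val P.K :=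
  bif isSomeV (curV P M a) && openV P M a then
    .pair (contentsV (curV P M a).snd) (updateV P M a
      (.ofList [.nat 0, .nat 0, .nat 0, .nat 0, .nat 0, someV (.nat 1), someV (.nat 1)]))
  else refuseV a

/-- The step for a query that reveals a key. -/
def keyRevealV (P : Params) (M : ℕ) (a : Val P.K) : Val P.K :=
  bif isSomeV (curV P M a) && (isSomeV ((curV P M a).snd.get 8) && openV P M a) then
    .pair ((curV P M a).snd.get 8).snd (updateV P M a
      (.ofList [.nat 0, .nat 0, .nat 0, .nat 0, .nat 0, .nat 0, someV (.nat 1)]))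
  else refuseV a

/-- The step for a query that expires a session. -/
def expireV (P : Params) (M : ℕ) (a : Val P.K) : Val P.K :=
  bif isSomeV (curV P M a) && isSomeV ((curV P M a).snd.get 8) then
    .pair (.nat 1) (updateV P M a
      (.ofList [.nat 0, .nat 0, .nat 0, .nat 0, someV (.nat 1), .nat 0, .nat 0]))
  else refuseV a

/-- Whether a session is owned by `i` and unexpired. -/
def ownedV {K : Type} (t i : Val K) : Bool := (t.get 0).toNat == i.toNat && !(t.get 9).toBool

/-- The memory of a party. -/
def memoryV (P : Params) (M : ℕ) (L i : Val P.K) : Val P.K :=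
  .ofList (((L.toList M).filter fun t => ownedV t i).map fun t => contentsV t)

/-- Expose the unexpired sessions of a party. -/
def exposeV (P : Params) (M : ℕ) (L i : Val P.K) : Val P.K :=
  .ofList ((L.toList M).map fun t => bif ownedV t i then updV
    (.ofList [.nat 0, .nat 0, .nat 0, .nat 0, .nat 0, .nat 0, someV (.nat 1)]) t else t)

/-- Whether an unexpired session of a party is protected. -/
def ownProtV (P : Params) (M : ℕ) (L T i : Val P.K) : Bool :=
  (L.toList M).any fun t => ownedV t i && protV P M L T t

/-- The step for a query that corrupts a party. -/
def corruptV (P : Params) (M : ℕ) (a : Val P.K) : Val P.K :=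
  bif decide ((argV 1 a).toNat < (a.get 4).toNat) && (!memV P M (a.get 6).snd.fst (argV 1 a) &&
      !ownProtV P M (a.get 6).fst (a.get 6).snd.snd (argV 1 a)) then
    .pair (memoryV P M (a.get 6).fst (argV 1 a))
      (.pair (exposeV P M (a.get 6).fst (argV 1 a))
        (.pair (.pair (argV 1 a) (a.get 6).snd.fst) (a.get 6).snd.snd))
  else refuseV a

/-- The step for a query that tests a session. -/
def testV (P : Params) (M : ℕ) (a : Val P.K) : Val P.K :=
  bif isSomeV (curV P M a) && (isSomeV ((curV P M a).snd.get 8) &&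
      (!isSomeV (a.get 6).snd.snd && (!((curV P M a).snd.get 9).toBool &&
        freshV P M (a.get 3) (a.get 6).fst (a.get 6).snd.fst (curV P M a).snd))) then
    .pair (a.get 5) (.pair (a.get 6).fst (.pair (a.get 6).snd.fst
      (someV (.pair (argV 1 a) (argV 2 a)))))
  else refuseV a

/-- The answer to the query in the list `[sk, pk, query, n, N, key, state]`, and the next state. -/
def genStepV (P : Params) (M : ℕ) (a : Val P.K) : Val P.K :=
  bif ((a.get 2).get 0).toNat == 0 then establishV P M a else
  bif ((a.get 2).get 0).toNat == 1 then deliverV P M a else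
  bif ((a.get 2).get 0).toNat == 2 then injectV P M a else
  bif ((a.get 2).get 0).toNat == 3 then stateRevealV P M a else
  bif ((a.get 2).get 0).toNat == 4 then keyRevealV P M a else
  bif ((a.get 2).get 0).toNat == 5 then expireV P M a else
  bif ((a.get 2).get 0).toNat == 6 then corruptV P M a else testV P M a

section DCinst

variable {a b c d : ∀ P : Params, ℕ → Val P.K → Val P.K}

instance DC.someV [DC b] : DC fun P M v => someV (b P M v) := by
  unfold SkewDihedral.someV
  infer_instance

instance DC.contentsV [DC b] : DC fun P M v => contentsV (b P M v) := by
  unfold SkewDihedral.contentsV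
  infer_instance

instance DC.shareV [DC b] [DC c] [DC d] :
    DC fun P M v => shareV P M (b P M v) (c P M v) (d P M v) := by
  unfold SkewDihedral.shareV
  infer_instance

instance DC.argV [DC b] (k : ℕ) : DC fun P M v => argV k (b P M v) := by
  unfold SkewDihedral.argV
  infer_instance

instance DC.refuseV [DC b] : DC fun P M v => refuseV (b P M v) := by
  unfold SkewDihedral.refuseV
  infer_instance

instance DC.curV [DC b] : DC fun P M v => curV P M (b P M v) := by
  unfold SkewDihedral.curV
  infer_instance

instance DC.updateV [DC b] [DC c] : DC fun P M v => updateV P M (b P M v) (c P M v) := by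
  unfold SkewDihedral.updateV
  infer_instance

instance BC.openV [DC b] : BC fun P M v => openV P M (b P M v) := by
  unfold SkewDihedral.openV
  infer_instance

instance BC.ownedV [DC b] [DC c] : BC fun P M v => ownedV (b P M v) (c P M v) := by
  unfold SkewDihedral.ownedV
  infer_instance

instance DC.memoryV [DC b] [DC c] : DC fun P M v => memoryV P M (b P M v) (c P M v) := by
  refine DC.comp₂ (F := SkewDihedral.memoryV) ?_
  exact DC.filter_map (p := fun P M t v => SkewDihedral.ownedV t v.snd)
    (f := fun P M t v => SkewDihedral.contentsV t) inferInstance inferInstance inferInstance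

instance DC.exposeV [DC b] [DC c] : DC fun P M v => exposeV P M (b P M v) (c P M v) := by
  refine DC.comp₂ (F := SkewDihedral.exposeV) ?_
  unfold SkewDihedral.exposeV
  infer_instance

instance BC.ownProtV [DC b] [DC c] [DC d] :
    BC fun P M v => ownProtV P M (b P M v) (c P M v) (d P M v) := by
  refine DC.comp₃ (F := fun P M a b c => .ofBool (SkewDihedral.ownProtV P M a b c)) ?_
  unfold SkewDihedral.ownProtV
  infer_instance

instance DC.newV {e f g h i : ∀ P : Params, ℕ → Val P.K → Val P.K} [DC b] [DC c] [DC d] [DC e]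
    [DC f] [DC g] [DC h] [DC i] : DC fun P M v => newV (b P M v) (c P M v) (d P M v) (e P M v)
      (f P M v) (g P M v) (h P M v) (i P M v) := by
  unfold SkewDihedral.newV
  infer_instance

set_option synthInstance.maxHeartbeats 200000 in
set_option synthInstance.maxSize 1000 in
instance DC.recvV [DC b] : DC fun P M v => recvV P M (b P M v) := by
  unfold SkewDihedral.recvV
  infer_instance

instance DC.genStepV [hb : DC b] : DC fun P M v => genStepV P M (b P M v) := by
  have h : ∀ F : ∀ P : Params, ℕ → Val P.K → Val P.K, (DC fun P M v => F P M v) →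
      DC fun P M v => F P M (b P M v) := fun F hF => DC.comp hb hF
  have h0 : DC establishV := by
    unfold SkewDihedral.establishV
    infer_instance
  have h1 : DC deliverV := by
    unfold SkewDihedral.deliverV
    infer_instance
  have h2 : DC injectV := by
    unfold SkewDihedral.injectV
    infer_instance
  have h3 : DC stateRevealV := by
    unfold SkewDihedral.stateRevealV
    infer_instance
  have h4 : DC keyRevealV := by
    unfold SkewDihedral.keyRevealV
    infer_instance
  have h5 : DC expireV := by
    unfold SkewDihedral.expireV
    infer_instance
  have h6 : DC corruptV := by
    unfold SkewDihedral.corruptV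
    infer_instance
  have h7 : DC testV := by
    unfold SkewDihedral.testV
    infer_instance
  refine h _ ?_
  unfold SkewDihedral.genStepV
  infer_instance

end DCinst

/-! ### Correctness of the step of the simulation -/

section Correct

variable {P : Params}

theorem Val.get_cons_zero {K : Type} (x : Val K) (l : List (Val K)) :
    (Val.ofList (x :: l)).get 0 = x := rfl

theorem Val.get_cons_succ {K : Type} (x : Val K) (l : List (Val K)) (k : ℕ) :
    (Val.ofList (x :: l)).get (k + 1) = (Val.ofList l).get k := rfl

/-- The value `v` consists of the answer in `w` and a representation of the state in `w`. -/
def RepOut (M B : ℕ) (v : Val P.K) (w : Val P.K × Game P) : Prop :=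
  v.fst = w.1 ∧ Rep M B v.snd w.2

theorem RepOut.cond {M B : ℕ} {b : Bool} {p : Prop} {_ : Decidable p} (h : b = true ↔ p)
    {x y : Val P.K} {w w' : Val P.K × Game P} (h1 : p → RepOut M B x w)
    (h2 : ¬ p → RepOut M B y w') : RepOut M B (bif b then x else y) (if p then w else w') := by
  by_cases hp : p
  · rw [if_pos hp, h.2 hp]
    exact h1 hp
  · rw [if_neg hp, Bool.eq_false_iff.2 (mt h.1 hp)]
    exact h2 hp

theorem RepOut.cond_false {M B : ℕ} {b : Bool} (h : b = false)
    {x y : Val P.K} {w : Val P.K × Game P} (h1 : RepOut M B y w) :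
    RepOut M B (bif b then x else y) w := by
  rw [h]
  exact h1

theorem RepOut.cond_true {M B : ℕ} {b : Bool} (h : b = true)
    {x y : Val P.K} {w : Val P.K × Game P} (h1 : RepOut M B x w) :
    RepOut M B (bif b then x else y) w := by
  rw [h]
  exact h1

theorem Rep.refuse {M B : ℕ} {gs : Val P.K} {g : Game P} (hg : Rep M (B + 1) gs g) :
    RepOut M B (.pair (.nat 0) gs) (.nat 0, g) := ⟨rfl, hg.mono⟩

theorem Rep.find {M B : ℕ} {gs : Val P.K} {g : Game P} (hg : Rep M B gs g) (i s : ℕ) :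
    findV P M gs.fst (.nat i) (.nat s) = .ofOption encS (g.find i s) := by
  obtain ⟨c, rfl, -, h, -⟩ := hg
  exact findV_enc (by omega) i s

theorem Rep.mem {M B : ℕ} {gs : Val P.K} {g : Game P} (hg : Rep M B gs g) (i : ℕ) :
    memV P M gs.snd.fst (.nat i) = true ↔ i ∈ g.corrupted := by
  obtain ⟨c, rfl, hc, -, h⟩ := hg
  exact (memV_enc (by omega) i).trans (hc i)

theorem Rep.prot {M B : ℕ} {gs : Val P.K} {g : Game P} (hg : Rep M B gs g) (u : Session P) :
    protV P M gs.fst gs.snd.snd (encS u) = true ↔ g.Protected u := by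
  obtain ⟨c, rfl, -, h, -⟩ := hg
  exact protV_enc (by omega) u

theorem Rep.fresh {M B : ℕ} (hM : P.n + P.n ≤ M) {gs : Val P.K} {g : Game P} (hg : Rep M B gs g)
    (t : Session P) : freshV P M (.nat P.n) gs.fst gs.snd.fst (encS t) = true ↔ g.Fresh t := by
  obtain ⟨c, rfl, hc, h, h'⟩ := hg
  exact freshV_enc hM (by omega) (by omega) hc t

theorem Rep.modify {M B : ℕ} {gs : Val P.K} {g : Game P} (hg : Rep M B gs g) (i s : ℕ)
    {u : Val P.K} {f : Session P → Session P} (hf : ∀ t, updV u (encS t) = encS (f t)) :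
    Rep M B (.pair (modV P M gs.fst (.nat i) (.nat s) u) gs.snd) (g.modify i s f) := by
  obtain ⟨c, rfl, hc, h, h'⟩ := hg
  refine ⟨c, ?_, hc, ?_, h'⟩
  · exact congrArg (fun x => Val.pair x _) (modV_enc (by omega) i s hf)
  · simpa [Game.modify] using h

theorem Rep.push {M B : ℕ} {gs : Val P.K} {g : Game P} (hg : Rep M (B + 1) gs g) (t : Session P)
    {v : Val P.K} (hv : v = encS t) :
    Rep M B (.pair (.ofList (gs.fst.toList M ++ [v])) gs.snd) (g.push t) := by
  obtain ⟨c, rfl, hc, h, h'⟩ := hg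
  refine ⟨c, ?_, hc, ?_, by omega⟩
  · have h1 : ((Val.ofList (g.sessions.map encS)).toList M) = g.sessions.map encS :=
      Val.toList_ofList_of_le (by rw [List.length_map]; omega)
    have h2 : (g.push t).sessions.map encS = g.sessions.map encS ++ [encS t] := by
      simp [Game.push]
    rw [h2, hv]
    exact congrArg (fun x => Val.pair (Val.ofList (x ++ _)) _) h1
  · simp only [Game.push, List.length_append, List.length_singleton]
    omega

theorem shareV_enc {M : ℕ} (hM : P.n + P.n ≤ M) (sk : P.R × P.R) (z : P.R) :
    shareV P M (.nat P.n) (encSk sk) (encR z) = encR (sharedKey sk z) := by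
  unfold shareV encSk
  simp only [Val.fst, Val.snd]
  rw [mulV_encR hM, adjV_encR hM, mulV_encR hM]
  rfl

theorem recvV_enc {M B : ℕ} (hM : P.n + P.n ≤ M) {gs : Val P.K} {g : Game P}
    (hg : Rep M (B + 1) gs g) (sk : P.R × P.R) (pk : P.R) (i j s : ℕ) (z : P.R) :
    RepOut M B (recvV P M (.ofList [.nat P.n, encSk sk, encR pk, gs, .nat i, .nat j, .nat s,
      encR z])) (recvStep sk pk g i j s z) := by
  unfold recvV recvStep
  simp only [Val.get_cons_zero, Val.get_cons_succ]
  refine RepOut.cond (hg.mem j) (fun _ => hg.refuse) fun _ => ?_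
  rw [hg.find]
  cases g.find j s with
  | none =>
    refine RepOut.cond_false rfl ⟨rfl, hg.push _ ?_⟩
    rw [shareV_enc hM]
    rfl
  | some t =>
    refine RepOut.cond_true rfl ?_
    have h4 : (Val.ofOption encS (some t)).snd.get 4 = .ofOption encSk t.secret := rfl
    rw [h4, isSomeV_ofOption]
    simp only
    cases hsk : t.secret with
    | none => exact RepOut.cond_false (by simp) hg.refuse
    | some sk' =>
      refine RepOut.cond ?_ (fun _ => ⟨rfl, hg.mono.modify j s fun u => ?_⟩) fun _ => hg.refuse
      · have h10 : ((Val.ofOption encS (some t)).snd.get 10).toBool = t.stopped := encS_stopped t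
        rw [Bool.and_eq_true, Bool.and_eq_true, h10, beq_iff_eq, Bool.not_eq_true']
        exact and_iff_right rfl
      · have h : shareV P M (.nat P.n) (Val.ofOption encSk (some sk')).snd (encR z) =
            encR (sharedKey sk' z) := shareV_enc hM sk' z
        rw [h]
        rfl

variable {M B N : ℕ} (hM : P.n + P.n ≤ M) {gs : Val P.K} {g : Game P}
  (hg : Rep M (B + 1) gs g) (sk : P.R × P.R) (pk K : P.R) (q : Val P.K)

/-- The input of the step. -/
def stepArg (sk : P.R × P.R) (pk K : P.R) (q : Val P.K) (N : ℕ) (gs : Val P.K) : Val P.K :=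
  .ofList [encSk sk, encR pk, q, .nat P.n, .nat N, encR K, gs]

include hg in
theorem curV_enc : curV P M (stepArg sk pk K q N gs) =
    .ofOption encS (g.find (q.get 1).toNat (q.get 2).toNat) := hg.find _ _

include hg in
theorem refuseV_enc : RepOut M B (refuseV (stepArg sk pk K q N gs)) (.nat 0, g) := hg.refuse

include hg in
theorem openV_enc {t : Session P} (ht : g.find (q.get 1).toNat (q.get 2).toNat = some t) :
    openV P M (stepArg sk pk K q N gs) = true ↔ t.expired = false ∧ ¬ g.Protected t := by
  unfold openV
  rw [curV_enc hg, ht]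
  rw [Bool.and_eq_true, Bool.not_eq_true', Bool.not_eq_true', ← Bool.not_eq_true (protV _ _ _ _ _)]
  refine and_congr ?_ (not_congr (hg.prot t))
  exact Eq.congr_left (encS_expired t)

include hg in
theorem updateV_enc {u : Val P.K} {f : Session P → Session P}
    (hf : ∀ t, updV u (encS t) = encS (f t)) :
    Rep M (B + 1) (updateV P M (stepArg sk pk K q N gs) u)
      (g.modify (q.get 1).toNat (q.get 2).toNat f) := hg.modify _ _ hf

include hg in
theorem establishV_enc : RepOut M B (establishV P M (stepArg sk pk K q N gs))
    (genStep N sk pk (fun _ => K) g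
      (.establish (q.get 1).toNat (q.get 3).toNat (q.get 2).toNat)) := by
  simp only [establishV, genStep]
  refine RepOut.cond ?_ (fun _ => ⟨rfl, hg.push _ rfl⟩) fun _ => refuseV_enc hg sk pk K q
  rw [curV_enc hg, isSomeV_ofOption]
  have h := hg.mem (q.get 1).toNat
  simp only [Bool.and_eq_true, decide_eq_true_eq, Bool.not_eq_true', beq_eq_false_iff_ne,
    Option.isSome_eq_false_iff, Option.isNone_iff_eq_none]
  refine and_congr Iff.rfl (and_congr Iff.rfl (and_congr Iff.rfl (and_congr ?_ Iff.rfl)))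
  rw [← h, ← Bool.not_eq_true]
  rfl

include hM hg in
theorem deliverV_enc : RepOut M B (deliverV P M (stepArg sk pk K q N gs))
    (genStep N sk pk (fun _ => K) g (.deliver (q.get 1).toNat (q.get 2).toNat)) := by
  simp only [deliverV, genStep]
  rw [curV_enc hg]
  cases hf : g.find (q.get 1).toNat (q.get 2).toNat with
  | none => exact RepOut.cond_false rfl (refuseV_enc hg sk pk K q)
  | some t =>
    have key : ∀ (b : Bool) (x y : Val P.K × Game P), (if b = true then x else y) =
        if b = false then y else x := by
      intro b x y
      cases b <;> rfl
    simp only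
    rw [key]
    refine RepOut.cond ?_ (fun _ => ?_) fun _ => refuseV_enc hg sk pk K q
    · have h6 : ((Val.ofOption encS (some t)).snd.get 6).toBool = t.delivered := encS_delivered t
      rw [Bool.and_eq_true, h6, Bool.not_eq_true']
      exact and_iff_right rfl
    · exact recvV_enc hM (updateV_enc hg sk pk K q fun _ => rfl) sk pk _ _ _ _

include hM hg in
theorem injectV_enc : RepOut M B (injectV P M (stepArg sk pk K q N gs))
    (genStep N sk pk (fun _ => K) g (.inject (q.get 1).toNat (q.get 3).toNat (q.get 2).toNat
      (decR (q.get 4)))) := by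
  simp only [injectV, genStep]
  refine RepOut.cond ?_ (fun _ => ?_) fun _ => refuseV_enc hg sk pk K q
  · rw [curV_enc hg]
    simp only [Bool.and_eq_true, decide_eq_true_eq, Bool.not_eq_true', beq_eq_false_iff_ne]
    refine and_congr Iff.rfl (and_congr Iff.rfl (and_congr Iff.rfl ?_))
    rw [Bool.or_eq_true]
    refine or_congr (hg.mem _) ?_
    cases g.find (q.get 1).toNat (q.get 2).toNat with
    | none => simp [isSomeV, Val.ofOption, Val.tag]
    | some t =>
      simp only [Val.ofOption, Val.snd,
        encS_stopped, encS_peer, Bool.and_eq_true, beq_iff_eq, Option.some.injEq, exists_eq_left']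
      exact (and_iff_right rfl).trans Iff.rfl
  · have h : canonV P M ((stepArg sk pk K q N gs).get 3) (((stepArg sk pk K q N gs).get 2).get 4) =
        encR (decR (q.get 4)) := canonV_eq hM _
    rw [h]
    exact recvV_enc hM hg sk pk _ _ _ _

include hg in
theorem stateRevealV_enc : RepOut M B (stateRevealV P M (stepArg sk pk K q N gs))
    (genStep N sk pk (fun _ => K) g (.stateReveal (q.get 1).toNat (q.get 2).toNat)) := by
  simp only [stateRevealV, genStep]
  cases hf : g.find (q.get 1).toNat (q.get 2).toNat with
  | none => exact RepOut.cond_false (by rw [curV_enc hg, hf]; rfl) (refuseV_enc hg sk pk K q)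
  | some t =>
    refine RepOut.cond ?_ (fun _ => ⟨?_, (updateV_enc hg sk pk K q fun _ => rfl).mono⟩)
      fun _ => refuseV_enc hg sk pk K q
    · rw [Bool.and_eq_true, openV_enc hg sk pk K q hf, curV_enc hg, hf]
      exact and_iff_right rfl
    · rw [curV_enc hg, hf]
      rfl

include hg in
theorem keyRevealV_enc : RepOut M B (keyRevealV P M (stepArg sk pk K q N gs))
    (genStep N sk pk (fun _ => K) g (.keyReveal (q.get 1).toNat (q.get 2).toNat)) := by
  simp only [keyRevealV, genStep]
  cases hf : g.find (q.get 1).toNat (q.get 2).toNat with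
  | none => exact RepOut.cond_false (by rw [curV_enc hg, hf]; rfl) (refuseV_enc hg sk pk K q)
  | some t =>
    have ht : (curV P M (stepArg sk pk K q N gs)).snd.get 8 = .ofOption encR t.output := by
      rw [curV_enc hg, hf]
      rfl
    rw [ht, isSomeV_ofOption]
    simp only
    cases t.output with
    | none => exact RepOut.cond_false (by simp) (refuseV_enc hg sk pk K q)
    | some key =>
      refine RepOut.cond ?_ (fun _ => ⟨rfl, (updateV_enc hg sk pk K q fun _ => rfl).mono⟩)
        fun _ => refuseV_enc hg sk pk K q
      rw [Bool.and_eq_true, Bool.and_eq_true, openV_enc hg sk pk K q hf, curV_enc hg, hf]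
      exact (and_iff_right rfl).trans (and_iff_right rfl)

include hg in
theorem expireV_enc : RepOut M B (expireV P M (stepArg sk pk K q N gs))
    (genStep N sk pk (fun _ => K) g (.expire (q.get 1).toNat (q.get 2).toNat)) := by
  simp only [expireV, genStep]
  cases hf : g.find (q.get 1).toNat (q.get 2).toNat with
  | none => exact RepOut.cond_false (by rw [curV_enc hg, hf]; rfl) (refuseV_enc hg sk pk K q)
  | some t =>
    refine RepOut.cond ?_ (fun _ => ⟨rfl, (updateV_enc hg sk pk K q fun _ => rfl).mono⟩)
      fun _ => refuseV_enc hg sk pk K q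
    rw [Bool.and_eq_true, curV_enc hg, hf]
    refine (and_iff_right rfl).trans ?_
    have h : ((Val.ofOption encS (some t)).snd.get 8 : Val P.K) = .ofOption encR t.output := rfl
    rw [h, isSomeV_ofOption]

theorem ownedV_enc (t : Session P) (i : ℕ) :
    ownedV (encS t) (.nat i) = (t.owner == i && !t.expired) := by
  simp only [ownedV, encS_owner, encS_expired, Val.toNat_nat]

include hg in
theorem corruptV_enc : RepOut M B (corruptV P M (stepArg sk pk K q N gs))
    (genStep N sk pk (fun _ => K) g (.corrupt (q.get 1).toNat)) := by
  simp only [corruptV, genStep]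
  have hmem := hg.mem (q.get 1).toNat
  have hprot := fun u => hg.prot u
  have href := refuseV_enc (N := N) hg sk pk K q
  obtain ⟨c, rfl, hc, h, h'⟩ := hg
  have hL : ((Val.ofList (g.sessions.map encS)).toList M) = g.sessions.map encS :=
    Val.toList_ofList_of_le (by rw [List.length_map]; omega)
  have hown : ∀ T, (∀ u, protV P M (.ofList (g.sessions.map encS)) T (encS u) = true ↔
      g.Protected u) → (ownProtV P M (.ofList (g.sessions.map encS)) T (.nat (q.get 1).toNat) =
        false ↔ ∀ t ∈ g.sessions, t.owner = (q.get 1).toNat → g.Protected t →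
          t.expired = true) := by
    intro T hT
    unfold ownProtV
    rw [hL]
    simp only [List.any_map, List.any_eq_false, Function.comp_apply, ownedV_enc, Bool.and_eq_true,
      hT, beq_iff_eq, Bool.not_eq_true']
    refine forall_congr' fun t => forall_congr' fun _ => ?_
    cases t.expired <;> simp
  refine RepOut.cond ?_ (fun _ => ⟨?_, (q.get 1).toNat :: c, ?_, ?_, ?_, ?_⟩) fun _ => href
  · simp only [Bool.and_eq_true, decide_eq_true_eq, Bool.not_eq_true']
    refine and_congr Iff.rfl (and_congr ?_ (hown _ hprot))
    rw [← hmem, ← Bool.not_eq_true]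
    rfl
  · change memoryV P M (.ofList (g.sessions.map encS)) (.nat (q.get 1).toNat) = _
    unfold memoryV
    rw [hL, List.filter_map, List.map_map]
    have : ((fun t => ownedV t (.nat (q.get 1).toNat)) ∘ encS) =
        fun t : Session P => t.owner == (q.get 1).toNat && !t.expired :=
      funext fun t => ownedV_enc t _
    rw [this]
    rfl
  · have : exposeV P M (.ofList (g.sessions.map encS)) (.nat (q.get 1).toNat) =
        .ofList ((g.sessions.map fun t => if t.owner == (q.get 1).toNat && !t.expired then
          { t with exposed := true } else t).map encS) := by
      unfold exposeV
      rw [hL, List.map_map, List.map_map]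
      congr 1
      refine List.map_congr_left fun t _ => ?_
      simp only [Function.comp_apply, ownedV_enc]
      cases t.owner == (q.get 1).toNat && !t.expired <;> rfl
    exact congrArg (fun x => Val.pair x _) this
  · intro i
    simp [hc]
  · rw [List.length_map]
    omega
  · rw [List.length_cons]
    omega

include hM hg in
theorem testV_enc : RepOut M B (testV P M (stepArg sk pk K q N gs))
    (genStep N sk pk (fun _ => K) g (.test (q.get 1).toNat (q.get 2).toNat)) := by
  simp only [testV, genStep]
  cases hf : g.find (q.get 1).toNat (q.get 2).toNat with
  | none => exact RepOut.cond_false (by rw [curV_enc hg, hf]; rfl) (refuseV_enc hg sk pk K q)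
  | some t =>
    have hcur : curV P M (stepArg sk pk K q N gs) = .pair (.nat 1) (encS t) := by
      rw [curV_enc hg, hf]
      rfl
    rw [hcur]
    simp only [Val.snd, encS_output, encS_expired, isSomeV_ofOption]
    cases t.output with
    | none => exact RepOut.cond_false (by simp) (refuseV_enc hg sk pk K q)
    | some key =>
      refine RepOut.cond ?_ (fun _ => ⟨rfl, ?_⟩) fun _ => refuseV_enc hg sk pk K q
      · have h1 := hg.fresh hM t
        have h2 : isSomeV gs.snd.snd = g.test.isSome := by
          obtain ⟨c, rfl, -⟩ := hg
          exact isSomeV_ofOption _ _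
        have h3 : (!isSomeV gs.snd.snd) = true ↔ g.test = none := by
          rw [h2]
          cases g.test <;> simp
        rw [Bool.and_eq_true, Bool.and_eq_true, Bool.and_eq_true, Bool.and_eq_true,
          Bool.not_eq_true' t.expired]
        exact (and_iff_right rfl).trans ((and_iff_right rfl).trans
          (and_congr h3 (and_congr Iff.rfl h1)))
      · obtain ⟨c, rfl, hc, h, h'⟩ := hg
        exact ⟨c, rfl, hc, by dsimp only; omega, by omega⟩

include hM hg in
theorem genStepV_enc : RepOut M B (genStepV P M (stepArg sk pk K q N gs))
    (genStep N sk pk (fun _ => K) g (decQuery q)) := by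
  unfold decQuery genStepV
  change RepOut M B (bif (q.get 0).toNat == 0 then _ else _) _
  simp only
  match (q.get 0).toNat with
  | 0 => exact establishV_enc hg sk pk K q
  | 1 => exact deliverV_enc hM hg sk pk K q
  | 2 => exact injectV_enc hM hg sk pk K q
  | 3 => exact stateRevealV_enc hg sk pk K q
  | 4 => exact keyRevealV_enc hg sk pk K q
  | 5 => exact expireV_enc hg sk pk K q
  | 6 => exact corruptV_enc hg sk pk K q
  | k + 7 => exact testV_enc hM hg sk pk K q

end Correct

/-! ### The simulation as a program -/

section Defs

variable {K : Type}

/-- The key of a session as a value. -/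
def encKey (x : ℕ × ℕ × ℕ) : Val K := .pair (.nat x.1) (.pair (.nat x.2.1) (.nat x.2.2))

/-- The key of a session. -/
def keyV (t : Val K) : Val K :=
  .pair (.nat (t.get 0).toNat) (.pair (.nat (t.get 1).toNat) (.nat (t.get 2).toNat))

/-- The key of the partner. -/
def swapV (x : Val K) : Val K := .pair x.snd.fst (.pair x.fst x.snd.snd)

/-- Equality of keys. -/
def eqKeyV (x y : Val K) : Bool :=
  x.fst.toNat == y.fst.toNat && (x.snd.fst.toNat == y.snd.fst.toNat &&
    x.snd.snd.toNat == y.snd.snd.toNat)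

/-- Whether the key `y` is that of the guessed session, if there is one, or of its partner. -/
def specialV (o y : Val K) : Bool :=
  isSomeV o && (eqKeyV y o.snd || eqKeyV y (swapV o.snd))

end Defs

/-- The keys of the initiators. -/
def initKeysV (P : Params) (M : ℕ) (L : Val P.K) : Val P.K :=
  .ofList (((L.toList M).filter fun t => (t.get 3).toBool).map fun t => keyV t)

/-- The key of the `r`-th initiator, if there is one. -/
def guessV (P : Params) (M : ℕ) (L r : Val P.K) : Val P.K :=
  bif decide (r.toNat < ((initKeysV P M L).toList M).length) then
    someV ((initKeysV P M L).get (min r.toNat M)) else .nat 0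

/-- The key of the session that a query may create. -/
def newKeyV (P : Params) (M : ℕ) (L q : Val P.K) : Val P.K :=
  bif (q.get 0).toNat == 0 then
    someV (.pair (.nat (q.get 1).toNat) (.pair (.nat (q.get 3).toNat) (.nat (q.get 2).toNat))) else
  bif (q.get 0).toNat == 1 then
    bif isSomeV (findV P M L (.nat (q.get 1).toNat) (.nat (q.get 2).toNat)) then
      someV (.pair ((findV P M L (.nat (q.get 1).toNat) (.nat (q.get 2).toNat)).snd.get 1)
        (.pair (.nat (q.get 1).toNat) (.nat (q.get 2).toNat))) else .nat 0 else
  bif (q.get 0).toNat == 2 then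
    someV (.pair (.nat (q.get 3).toNat) (.pair (.nat (q.get 1).toNat) (.nat (q.get 2).toNat))) else
  .nat 0

/-- Whether the query activates the guessed session. -/
def slotZeroV (P : Params) (M : ℕ) (L r q : Val P.K) : Bool :=
  !isSomeV (guessV P M L r) && ((q.get 0).toNat == 0 &&
    ((initKeysV P M L).toList M).length == r.toNat)

/-- Whether the query may create the partner of the guessed session. -/
def slotOneV (P : Params) (M : ℕ) (L r q : Val P.K) : Bool :=
  isSomeV (guessV P M L r) && (isSomeV (newKeyV P M L q) &&
    eqKeyV (newKeyV P M L q).snd (swapV (guessV P M L r).snd))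

/-- Whether the guess is correct, in a state `v`. -/
def hitV (P : Params) (M : ℕ) (r v : Val P.K) : Bool :=
  isSomeV v.snd.snd && (!((v.fst.toList M).any fun t =>
      (v.snd.snd.snd.fst.toNat == (t.get 0).toNat && v.snd.snd.snd.snd.toNat == (t.get 2).toNat) &&
        !specialV (guessV P M v.fst r) (keyV t)) &&
    (!((v.fst.toList M).any fun t => specialV (guessV P M v.fst r) (keyV t) && (t.get 11).toBool) &&
    !(((initKeysV P M v.fst).toList (min r.toNat M)).any fun y =>
      specialV (guessV P M v.fst r) y)))

/-- The outgoing message of the new session; the argument is the list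
`[sk, query, state, n, N, h, pk₁, pk₂, key, r]`. -/
def simPkV (P : Params) (M : ℕ) (a : Val P.K) : Val P.K :=
  bif slotZeroV P M (a.get 2).fst (a.get 9) (a.get 1) then a.get 6 else
  bif slotOneV P M (a.get 2).fst (a.get 9) (a.get 1) then a.get 7 else
  mulV P M (a.get 3) (mulV P M (a.get 3) (a.get 0).fst (a.get 5)) (a.get 0).snd

/-- The step of the simulation on the list `[sk, query, state, n, N, h, pk₁, pk₂, key, r]`. -/
def simStepV (P : Params) (M : ℕ) (a : Val P.K) : Val P.K :=
  genStepV P M (.ofList [a.get 0, simPkV P M a, a.get 1, a.get 3, a.get 4, a.get 8, a.get 2])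

/-- The oracle of the simulation as a randomized function. The argument consists of the query, the
list `[n, N, h, pk₁, pk₂, key, r]`, and the state. -/
def simV (P : Params) (M : ℕ) (x : Val P.K) : PMF (Val P.K) :=
  (sampleV P M (x.snd.fst.get 0)).map fun sk =>
    .pair (simStepV P M (.pair sk (.pair x.fst (.pair x.snd.snd x.snd.fst)))).fst
      (.pair x.snd.fst (simStepV P M (.pair sk (.pair x.fst (.pair x.snd.snd x.snd.fst)))).snd)

section DCinst

variable {a b c d : ∀ P : Params, ℕ → Val P.K → Val P.K}

instance DC.keyV [DC b] : DC fun P M v => keyV (b P M v) := by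
  unfold SkewDihedral.keyV
  infer_instance

instance DC.swapV [DC b] : DC fun P M v => swapV (b P M v) := by
  unfold SkewDihedral.swapV
  infer_instance

instance BC.eqKeyV [DC b] [DC c] : BC fun P M v => eqKeyV (b P M v) (c P M v) := by
  unfold SkewDihedral.eqKeyV
  infer_instance

instance BC.specialV [DC b] [DC c] : BC fun P M v => specialV (b P M v) (c P M v) := by
  unfold SkewDihedral.specialV
  infer_instance

instance DC.initKeysV [hb : DC b] : DC fun P M v => initKeysV P M (b P M v) :=
  DC.filter_map (p := fun _ _ t _ => (t.get 3).toBool)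
    (f := fun _ _ t _ => SkewDihedral.keyV t) inferInstance inferInstance hb

instance DC.guessV [DC b] [DC c] : DC fun P M v => guessV P M (b P M v) (c P M v) := by
  unfold SkewDihedral.guessV
  infer_instance

instance DC.newKeyV [DC b] [DC c] : DC fun P M v => newKeyV P M (b P M v) (c P M v) := by
  unfold SkewDihedral.newKeyV
  infer_instance

instance BC.slotZeroV [DC b] [DC c] [DC d] :
    BC fun P M v => slotZeroV P M (b P M v) (c P M v) (d P M v) := by
  unfold SkewDihedral.slotZeroV
  infer_instance

instance BC.slotOneV [DC b] [DC c] [DC d] :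
    BC fun P M v => slotOneV P M (b P M v) (c P M v) (d P M v) := by
  unfold SkewDihedral.slotOneV
  infer_instance

instance BC.hitV [DC b] [DC c] : BC fun P M v => hitV P M (b P M v) (c P M v) := by
  refine DC.comp₂ (F := fun P M a b => .ofBool (SkewDihedral.hitV P M a b)) ?_
  unfold SkewDihedral.hitV
  infer_instance

instance DC.simPkV [DC b] : DC fun P M v => simPkV P M (b P M v) := by
  unfold SkewDihedral.simPkV
  infer_instance

instance DC.simStepV [DC b] : DC fun P M v => simStepV P M (b P M v) := by
  unfold SkewDihedral.simStepV
  infer_instance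

theorem RC.simV : RC simV := by
  have h := RC.bind (RC.sampleV (d := fun P M v => v.snd.fst.get 0) inferInstance)
    (g := fun P M x => PMF.pure (.pair (SkewDihedral.simStepV P M (.pair x.fst (.pair x.snd.fst
      (.pair x.snd.snd.snd x.snd.snd.fst)))).fst (.pair x.snd.snd.fst
      (SkewDihedral.simStepV P M (.pair x.fst (.pair x.snd.fst
        (.pair x.snd.snd.snd x.snd.snd.fst)))).snd))) inferInstance
  exact h.congr fun P M v => PMF.bind_pure_comp _ _

end DCinst

section Correct

variable {P : Params} {M B : ℕ} {gs : Val P.K} {g : Game P}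

theorem eqKeyV_enc (x y : ℕ × ℕ × ℕ) :
    eqKeyV (encKey x : Val P.K) (encKey y) = true ↔ x = y := by
  simp [eqKeyV, encKey, Val.fst, Val.snd, Val.toNat, Prod.ext_iff]

theorem Rep.toList (hg : Rep M B gs g) : gs.fst.toList M = g.sessions.map encS := by
  obtain ⟨c, rfl, -, h, -⟩ := hg
  exact Val.toList_ofList_of_le (by rw [List.length_map]; omega)

theorem initKeysV_enc (hg : Rep M B gs g) :
    initKeysV P M gs.fst = .ofList ((initKeys g).map encKey) := by
  unfold initKeysV initKeys
  rw [hg.toList, List.filter_map, List.map_map, List.map_map]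
  simp only [Function.comp_def, encS_initiator]
  rfl

theorem length_initKeys_le (hg : Rep M B gs g) : (initKeys g).length ≤ M := by
  obtain ⟨c, -, -, h, -⟩ := hg
  have : (initKeys g).length ≤ g.sessions.length := by
    rw [initKeys, List.length_map]
    exact List.length_filter_le _ _
  omega

theorem initKeysV_toList (hg : Rep M B gs g) :
    (initKeysV P M gs.fst).toList M = (initKeys g).map encKey := by
  rw [initKeysV_enc hg]
  exact Val.toList_ofList_of_le (by rw [List.length_map]; exact length_initKeys_le hg)

theorem guessV_enc (hg : Rep M B gs g) (r : ℕ) :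
    guessV P M gs.fst (.nat r) = .ofOption encKey (initKeys g)[r]? := by
  unfold guessV
  rw [initKeysV_toList hg, initKeysV_enc hg, List.length_map, Val.toNat_nat]
  have hl := length_initKeys_le hg
  by_cases hr : r < (initKeys g).length
  · rw [decide_eq_true hr, List.getElem?_eq_getElem hr, min_eq_left (by omega), Val.get_ofList]
    simp only [cond_true, Val.ofOption, someV]
    congr 1
    rw [List.getD_eq_getElem _ _ (by rwa [List.length_map]), List.getElem_map]
  · rw [decide_eq_false hr, List.getElem?_eq_none (by omega)]
    rfl

theorem newKeyV_enc (hg : Rep M B gs g) (q : Val P.K) :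
    newKeyV P M gs.fst q = .ofOption encKey (newKey g (decQuery q)) := by
  unfold newKeyV decQuery
  rw [hg.find]
  simp only
  match (q.get 0).toNat with
  | 0 => rfl
  | 1 =>
    change (bif isSomeV _ then _ else _) =
      Val.ofOption encKey ((g.find (q.get 1).toNat (q.get 2).toNat).map _)
    cases g.find (q.get 1).toNat (q.get 2).toNat <;> rfl
  | 2 => rfl
  | 3 => rfl
  | 4 => rfl
  | 5 => rfl
  | 6 => rfl
  | k + 7 => rfl

theorem specialV_enc (hg : Rep M B gs g) (r : ℕ) (y : ℕ × ℕ × ℕ) :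
    specialV (guessV P M gs.fst (.nat r)) (encKey y) = true ↔ Special r g y := by
  rw [guessV_enc hg, specialV, isSomeV_ofOption, Special]
  cases (initKeys g)[r]? with
  | none => simp
  | some x =>
    have h : swapV (Val.ofOption encKey (some x)).snd = (encKey (swapKey x) : Val P.K) := rfl
    rw [h]
    simp only [Option.isSome_some, Bool.true_and, Bool.or_eq_true, Option.some.injEq,
      exists_eq_left']
    exact or_congr (eqKeyV_enc _ _) (eqKeyV_enc _ _)

theorem isEstablish_decQuery (q : Val P.K) :
    (decQuery q).isEstablish = true ↔ (q.get 0).toNat = 0 := by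
  unfold decQuery
  simp only
  match (q.get 0).toNat with
  | 0 => simp [Query.isEstablish]
  | 1 => simp [Query.isEstablish]
  | 2 => simp [Query.isEstablish]
  | 3 => simp [Query.isEstablish]
  | 4 => simp [Query.isEstablish]
  | 5 => simp [Query.isEstablish]
  | 6 => simp [Query.isEstablish]
  | k + 7 => simp [Query.isEstablish]

theorem slotZeroV_enc (hg : Rep M B gs g) (r : ℕ) (q : Val P.K) :
    slotZeroV P M gs.fst (.nat r) q = true ↔ slot r g (decQuery q) = 0 := by
  rw [slotZeroV, guessV_enc hg, initKeysV_toList hg, isSomeV_ofOption, slot_eq_zero_iff,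
    isEstablish_decQuery, List.length_map]
  simp [Val.toNat]

theorem slotOneV_enc (hg : Rep M B gs g) (r : ℕ) (q : Val P.K) :
    slotOneV P M gs.fst (.nat r) q = true ↔ slot r g (decQuery q) = 1 := by
  rw [slotOneV, guessV_enc hg, newKeyV_enc hg, isSomeV_ofOption, isSomeV_ofOption, slot_eq_one_iff]
  cases (initKeys g)[r]? with
  | none => simp
  | some x =>
    cases newKey g (decQuery q) with
    | none => simp
    | some y =>
      have h : swapV (Val.ofOption encKey (some x)).snd = (encKey (swapKey x) : Val P.K) := rfl
      rw [h]
      simp only [Option.isSome_some, Bool.true_and, Option.some.injEq, exists_eq_left']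
      exact eqKeyV_enc _ _

theorem hitV_enc (hg : Rep M B gs g) (r : ℕ) : hitV P M (.nat r) gs = true ↔ Hit r g := by
  have htest : gs.snd.snd = encTest g.test := by
    obtain ⟨c, rfl, -⟩ := hg
    rfl
  have htake : (initKeysV P M gs.fst).toList (min r M) = ((initKeys g).take r).map encKey := by
    rw [initKeysV_enc hg, Val.toList_ofList, ← List.map_take, ← List.take_take,
      List.take_of_length_le (length_initKeys_le hg)]
  have h1 : ∀ t : Session P, specialV (guessV P M gs.fst (.nat r)) (keyV (encS t)) = true ↔
      Special r g t.key := fun t => specialV_enc hg r t.key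
  unfold hitV Hit Bad
  rw [Bool.and_eq_true, htest]
  have h0 : isSomeV (encTest g.test : Val P.K) = true ↔ g.test ≠ none := by
    rw [encTest, isSomeV_ofOption]
    exact Option.isSome_iff_ne_none
  rw [h0]
  refine and_congr_right fun ht => ?_
  obtain ⟨⟨i, s⟩, hts⟩ := Option.ne_none_iff_exists'.1 ht
  rw [hts, Val.toNat_nat, hg.toList, htake, not_or, not_or, Bool.and_eq_true, Bool.and_eq_true,
    Bool.not_eq_true', Bool.not_eq_true', Bool.not_eq_true', ← Bool.not_eq_true,
    ← Bool.not_eq_true, ← Bool.not_eq_true]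
  simp only [List.any_map, List.any_eq_true, Function.comp_apply, Bool.and_eq_true, h1,
    specialV_enc hg, encS_exposed, Bool.not_eq_true', ← Bool.not_eq_true, encS_owner, encS_sid,
    beq_iff_eq, Option.some.injEq, Prod.mk.injEq]
  rfl

theorem simPkV_enc (hM : P.n + P.n ≤ M) (hg : Rep M B gs g) (h : P.R) (r N : ℕ)
    (pk₁ pk₂ key : P.R) (sk : P.R × P.R) (q : Val P.K) :
    simPkV P M (.ofList [encSk sk, q, gs, .nat P.n, .nat N, encR h, encR pk₁, encR pk₂, encR key,
      .nat r]) = encR (simPk h r pk₁ pk₂ sk g (decQuery q)) := by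
  unfold simPkV simPk
  simp only [Val.get_cons_zero, Val.get_cons_succ]
  have h0 := slotZeroV_enc hg r q
  have h1 := slotOneV_enc hg r q
  split_ifs with hs hs'
  · rw [h0.2 hs]
    rfl
  · rw [Bool.eq_false_iff.2 (mt h0.1 hs), h1.2 hs']
    rfl
  · rw [Bool.eq_false_iff.2 (mt h0.1 hs), Bool.eq_false_iff.2 (mt h1.1 hs')]
    simp only [cond_false, encSk, Val.fst, Val.snd]
    rw [mulV_encR hM, mulV_encR hM]
    rfl

/-- The part of the state of the simulation that does not change. -/
def simEnv (h pk₁ pk₂ key : P.R) (N r : ℕ) : Val P.K :=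
  .ofList [.nat P.n, .nat N, encR h, encR pk₁, encR pk₂, encR key, .nat r]

theorem simStepV_enc (hM : P.n + P.n ≤ M) (hg : Rep M (B + 1) gs g) (h : P.R) (r N : ℕ)
    (pk₁ pk₂ key : P.R) (sk : P.R × P.R) (q : Val P.K) :
    RepOut M B (simStepV P M (.pair (encSk sk) (.pair q (.pair gs (simEnv h pk₁ pk₂ key N r)))))
      (simStep N h r pk₁ pk₂ key sk g (decQuery q)) := by
  have h1 := simPkV_enc hM hg h r N pk₁ pk₂ key sk q
  have h2 := genStepV_enc hM hg (N := N) sk (simPk h r pk₁ pk₂ sk g (decQuery q)) key q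
  unfold stepArg at h2
  rw [← h1] at h2
  exact h2

/-- The oracle of the simulation on values. -/
def simOracleV (P : Params) (M : ℕ) : Oracle P (Val P.K) := fun q s =>
  (simV P M (.pair q s)).map fun x => (x.fst, x.snd)

theorem interp_congr_inv {S : Type} {O O' : Oracle P S} (I : S → Prop)
    (hO : ∀ q s, I s → O q s = O' q s) (hI : ∀ q s, I s → ∀ w ∈ (O q s).support, I w.2)
    (t : Tree P.K) {s : S} (hs : I s) : interp O t s = interp O' t s := by
  induction t generalizing s with
  | ret v c => rfl
  | samp d k ih => exact congrArg _ (funext fun v => ih v hs)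
  | call q k ih =>
    rw [interp, interp, ← hO q s hs]
    exact bind_congr_support fun w hw => ih _ (hI q s hs w hw)

/-- The simulation on values has the same outcome as the simulation on states of the model. -/
theorem interp_simOracleV (hM : P.n + P.n ≤ M) (h : P.R) (r N : ℕ) (pk₁ pk₂ key : P.R)
    {t : Tree P.K} (ht : t.Bounded B) (hB : B ≤ M) [DecidablePred (Hit (P := P) r)] :
    (interp (fun q g => (sampleSecret P).map fun sk =>
      simStep N h r pk₁ pk₂ key sk g (decQuery q)) t (Game.init P)).map
        (fun w => w.1.toBool && decide (Hit r w.2.1)) =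
    (interp (simOracleV P M) t (.pair (simEnv h pk₁ pk₂ key N r)
      (.pair (.nat 0) (.pair (.nat 0) (.nat 0))))).map
        (fun w => w.1.toBool && hitV P M (w.2.1.fst.get 6) w.2.1.snd) := by
  have hO : simOracleV P M = fun q s => (sampleV P M (s.fst.get 0)).map fun sk =>
      ((simStepV P M (.pair sk (.pair q (.pair s.snd s.fst)))).fst, Val.pair s.fst
        (simStepV P M (.pair sk (.pair q (.pair s.snd s.fst)))).snd) := by
    funext q s
    rw [simOracleV, simV, PMF.map_comp]
    rfl
  -- the two oracles, as functions of the sampled secret pair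
  obtain ⟨f₁, hf₁⟩ : ∃ f : Val P.K → Game P → P.R × P.R → Val P.K × Game P,
      ∀ q g sk, f q g sk = simStep N h r pk₁ pk₂ key sk g (decQuery q) := ⟨_, fun _ _ _ => rfl⟩
  obtain ⟨f₂, hf₂⟩ : ∃ f : Val P.K → Val P.K → P.R × P.R → Val P.K × Val P.K,
      ∀ q s sk, f q s sk = ((simStepV P M (.pair (encSk sk) (.pair q (.pair s.snd s.fst)))).fst,
        Val.pair s.fst (simStepV P M (.pair (encSk sk) (.pair q (.pair s.snd s.fst)))).snd) :=
    ⟨_, fun _ _ _ => rfl⟩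
  simp only [← hf₁]
  rw [hO, interp_congr_inv (fun s => s.fst = simEnv h pk₁ pk₂ key N r)
    (O' := fun q s => (sampleSecret P).map (f₂ q s)) ?_ ?_ t rfl]
  · have hR : ∀ B (g : Game P) (s : Val P.K), (s.fst = simEnv h pk₁ pk₂ key N r ∧
        Rep M B s.snd g) → ∀ v : Val P.K, (v.toBool && decide (Hit r g)) =
          (v.toBool && hitV P M (s.fst.get 6) s.snd) := by
      rintro B g s ⟨h1, h2⟩ v
      have : s.fst.get 6 = .nat r := by
        rw [h1]
        rfl
      rw [this]
      congr 1
      rw [Bool.eq_iff_iff, decide_eq_true_iff, hitV_enc h2]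
    refine interp_couple (sampleSecret P) f₁ f₂
      (fun B g s => s.fst = simEnv h pk₁ pk₂ key N r ∧ Rep M B s.snd g)
      (fun _ => False) (fun _ => False) ?_ (fun _ h => h.elim) (fun _ h => h.elim)
      (fun v g => v.toBool && decide (Hit r g))
      (fun v s => v.toBool && hitV P M (s.fst.get 6) s.snd) false (fun _ _ h => h.elim)
      (fun _ _ h => h.elim) hR ht ⟨rfl, [], rfl, ?_, ?_, ?_⟩
    · rintro B g s ⟨h1, h2⟩ q sk -
      left
      have := simStepV_enc hM h2 h r N pk₁ pk₂ key sk q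
      rw [← h1, ← hf₁] at this
      rw [hf₂]
      exact ⟨this.1.symm, h1, this.2⟩
    · intro i
      simp [Game.init]
    · simpa [Game.init] using hB
    · simpa using hB
  · intro q s hs
    have : s.fst.get 0 = .nat P.n := by
      rw [hs]
      rfl
    simp only [this]
    rw [sampleV_eq hM, PMF.map_comp]
    exact congrArg (fun f => PMF.map f _) (funext fun sk => (hf₂ q s sk).symm)
  · intro q s hs w hw
    obtain ⟨sk, -, rfl⟩ := (PMF.mem_support_map_iff _ _ _).1 hw
    exact hs

end Correct

/-! ### Running an adversary with a simulated oracle -/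

/-- A program together with the simulation of its oracle: the argument is paired with the state of
the simulation, and so is the result. Loops are cut off after `M` rounds. -/
def simRun (P : Params) (M : ℕ) : Prog → Val P.K → PMF (Val P.K)
  | .seq f g, x => (simRun P M f x).bind (simRun P M g)
  | .pair f g, x => (simRun P M f x).bind fun y =>
      (simRun P M g (.pair x.fst y.snd)).map fun z => .pair (.pair y.fst z.fst) z.snd
  | .ite c f g, x => (simRun P M c x).bind fun y =>
      bif y.fst.toBool then simRun P M f (.pair x.fst y.snd) else simRun P M g (.pair x.fst y.snd)
  | .loop f, x => piter (simRun P M f) (min x.fst.fst.toNat M) (.pair x.fst.snd x.snd)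
  | .call, x => simV P M x
  | f, x => (run P (noOracle P) f x.fst ()).map fun w => .pair w.1 x.snd

/-- The program is a single instruction other than a call of the oracle. -/
def Basic (f : Prog) : Prop :=
  ∀ (P : Params) (v : Val P.K), ∃ d : PMF (Val P.K), ∀ (S : Type) (O : Oracle P S) (s : S),
    run P O f v s = d.map fun x => (x, s, 1)

theorem Basic.of_run {f : Prog} {φ : ∀ P : Params, Val P.K → Val P.K}
    (h : ∀ (P : Params) (v : Val P.K) (S : Type) (O : Oracle P S) (s : S),
      run P O f v s = PMF.pure (φ P v, s, 1)) : Basic f :=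
  fun P v => ⟨PMF.pure (φ P v), fun S O s => by rw [h, PMF.pure_map]⟩

theorem Basic.of_run_rand {f : Prog} {α : Params → Type} {p : ∀ P : Params, Val P.K → PMF (α P)}
    {φ : ∀ P : Params, α P → Val P.K}
    (h : ∀ (P : Params) (v : Val P.K) (S : Type) (O : Oracle P S) (s : S),
      run P O f v s = (p P v).bind fun a => PMF.pure (φ P a, s, 1)) : Basic f :=
  fun P v => ⟨(p P v).map (φ P), fun S O s => by
    rw [h, PMF.map_comp, ← PMF.bind_pure_comp]
    rfl⟩

theorem Basic.rc {f : Prog} (hf : Basic f) :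
    RC fun P _ x => (run P (noOracle P) f x.fst ()).map fun w => .pair w.1 x.snd := by
  have h1 : RC fun P _ x => (run P (noOracle P) f x.fst ()).map fun w => w.1 := by
    refine RC.unary_rand (d := fun _ _ x => x.fst)
      (φ := fun P v => (run P (noOracle P) f v ()).map fun w => w.1) f (fun P v => ?_) inferInstance
    obtain ⟨d, hd⟩ := hf P v
    intro S O s
    rw [hd, hd, PMF.map_comp, PMF.map_comp, PMF.map_comp]
    refine ⟨rfl, fun w hw => ?_⟩
    obtain ⟨x, -, rfl⟩ := (PMF.mem_support_map_iff _ _ _).1 hw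
    exact le_rfl
  refine (RC.bind h1 (g := fun P _ w => PMF.pure (.pair w.fst w.snd.snd)) inferInstance).congr
    fun P M x => ?_
  rw [PMF.bind_map, ← PMF.bind_pure_comp]
  rfl

/-- Each construction of programs corresponds to a closure property of the class; the calls of the
oracle are replaced by the program for `simV`. -/
theorem RC.simRun (A : Prog) : RC fun P M x => simRun P M A x := by
  induction A with
  | seq f g hf hg => exact RC.comp hf hg
  | pair f g hf hg =>
    have h1 : RC fun P M w => SkewDihedral.simRun P M g (.pair w.snd.fst w.fst.snd) :=
      DC.rcomp (d := fun P M w => .pair w.snd.fst w.fst.snd) inferInstance hg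
    refine (RC.bind hf (RC.bind h1 (g := fun P M w =>
      PMF.pure (.pair (.pair w.snd.fst.fst w.fst.fst) w.fst.snd)) inferInstance)).congr
      fun P M x => ?_
    simp only [SkewDihedral.simRun, ← PMF.bind_pure_comp]
    rfl
  | ite c f g hc hf hg =>
    have h1 : RC fun P M w => SkewDihedral.simRun P M f (.pair w.snd.fst w.fst.snd) :=
      DC.rcomp (d := fun P M w => .pair w.snd.fst w.fst.snd) inferInstance hf
    have h2 : RC fun P M w => SkewDihedral.simRun P M g (.pair w.snd.fst w.fst.snd) :=
      DC.rcomp (d := fun P M w => .pair w.snd.fst w.fst.snd) inferInstance hg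
    exact RC.bind hc (RC.cond (b := fun P M w => w.fst.fst.toBool) (hf := h1) (hg := h2))
  | loop f hf =>
    have h1 : RC fun P M w => SkewDihedral.simRun P M f w.fst :=
      DC.rcomp (d := fun P M w => w.fst) inferInstance hf
    exact RC.loop h1 (i := fun P M x => x.fst.fst.toNat) inferInstance
      (d := fun P M x => .pair x.fst.snd x.snd) inferInstance
  | call => exact RC.simV
  | id => exact Basic.rc (f := .id) (.of_run (φ := fun _ v => v) fun _ _ _ _ _ => rfl)
  | fst => exact Basic.rc (f := .fst) (.of_run fun _ _ _ _ _ => rfl)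
  | snd => exact Basic.rc (f := .snd) (.of_run fun _ _ _ _ _ => rfl)
  | tag => exact Basic.rc (f := .tag) (.of_run fun _ _ _ _ _ => rfl)
  | nat k => exact Basic.rc (f := .nat k) (.of_run fun _ _ _ _ _ => rfl)
  | add => exact Basic.rc (f := .add) (.of_run fun _ _ _ _ _ => rfl)
  | sub => exact Basic.rc (f := .sub) (.of_run fun _ _ _ _ _ => rfl)
  | rand => exact Basic.rc (f := .rand) (.of_run_rand fun _ _ _ _ _ => rfl)
  | fcast => exact Basic.rc (f := .fcast) (.of_run fun _ _ _ _ _ => rfl)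
  | fadd => exact Basic.rc (f := .fadd) (.of_run fun _ _ _ _ _ => rfl)
  | fsub => exact Basic.rc (f := .fsub) (.of_run fun _ _ _ _ _ => rfl)
  | fmul => exact Basic.rc (f := .fmul) (.of_run fun _ _ _ _ _ => rfl)
  | finv => exact Basic.rc (f := .finv) (.of_run fun _ _ _ _ _ => rfl)
  | fsigma => exact Basic.rc (f := .fsigma) (.of_run fun _ _ _ _ _ => rfl)
  | feq => exact Basic.rc (f := .feq) (.of_run fun _ _ _ _ _ => rfl)
  | frand => exact Basic.rc (f := .frand) (.of_run_rand fun _ _ _ _ _ => rfl)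
  | fbasis => exact Basic.rc (f := .fbasis) (.of_run fun _ _ _ _ _ => rfl)
  | fcoord => exact Basic.rc (f := .fcoord) (.of_run fun _ _ _ _ _ => rfl)

/-! ### The cut-off of the loops has no effect -/

section SimRun

variable {P : Params} {M : ℕ}

theorem le_of_mem_iter {V S : Type} {f : V → S → PMF (V × S × ℕ)} {k : ℕ} {v : V} {s : S}
    {w : V × S × ℕ} (hw : w ∈ (iter f k v s).support) : k ≤ w.2.2 := by
  induction k generalizing v s w with
  | zero => exact Nat.zero_le _
  | succ k ih =>
    simp only [iter, pmf_bind_eq, pmf_pure_eq, PMF.mem_support_bind_iff,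
      PMF.mem_support_pure_iff] at hw
    obtain ⟨w₁, -, w₂, hw₂, rfl⟩ := hw
    have := ih hw₂
    change k + 1 ≤ w₁.2.2 + w₂.2.2 + 1
    omega

/-- Two parts of a run that stays within `M` steps stay within `M` steps. -/
theorem cost_parts {α β γ : Type} {p : PMF (α × γ × ℕ)} {q : α × γ × ℕ → PMF (β × γ × ℕ)} {δ : Type}
    {g : α × γ × ℕ → β × γ × ℕ → δ}
    (h : ∀ w ∈ (p.bind fun w₁ => (q w₁).bind fun w₂ =>
      PMF.pure (g w₁ w₂, w₂.2.1, w₁.2.2 + w₂.2.2 + 1)).support, w.2.2 ≤ M) :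
    (∀ w ∈ p.support, w.2.2 ≤ M) ∧ ∀ w₁ ∈ p.support, ∀ w₂ ∈ (q w₁).support, w₂.2.2 ≤ M := by
  have key : ∀ w₁ ∈ p.support, ∀ w₂ ∈ (q w₁).support, w₁.2.2 + w₂.2.2 + 1 ≤ M := by
    intro w₁ h₁ w₂ h₂
    refine h (g w₁ w₂, w₂.2.1, w₁.2.2 + w₂.2.2 + 1) ?_
    simp only [PMF.mem_support_bind_iff, PMF.mem_support_pure_iff]
    exact ⟨w₁, h₁, w₂, h₂, rfl⟩
  constructor
  · intro w₁ h₁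
    obtain ⟨w₂, h₂⟩ := (q w₁).support_nonempty
    have := key w₁ h₁ w₂ h₂
    omega
  · intro w₁ h₁ w₂ h₂
    have := key w₁ h₁ w₂ h₂
    omega

/-- A run within `M` steps is not affected by the bound on the loops. -/
theorem simRun_eq (A : Prog) {v st : Val P.K}
    (hc : ∀ w ∈ (run P (simOracleV P M) A v st).support, w.2.2 ≤ M) :
    simRun P M A (.pair v st) =
      (run P (simOracleV P M) A v st).map fun w => .pair w.1 w.2.1 := by
  induction A generalizing v st with
  | seq f g hf hg =>
    simp only [run, pmf_bind_eq, pmf_pure_eq] at hc ⊢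
    obtain ⟨h1, h2⟩ := cost_parts (g := fun _ w₂ => w₂.1) hc
    simp only [simRun, hf h1, PMF.map_bind, PMF.bind_map, PMF.pure_map]
    refine bind_congr_support fun w hw => ?_
    simp only [Function.comp_apply, hg (h2 w hw), ← PMF.bind_pure_comp]
    rfl
  | pair f g hf hg =>
    simp only [run, pmf_bind_eq, pmf_pure_eq] at hc ⊢
    obtain ⟨h1, h2⟩ := cost_parts (g := fun w₁ w₂ => Val.pair w₁.1 w₂.1) hc
    simp only [simRun, hf h1, PMF.map_bind, PMF.bind_map, PMF.pure_map]
    refine bind_congr_support fun w hw => ?_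
    simp only [Function.comp_apply, Val.fst, Val.snd]
    rw [hg (h2 w hw), PMF.map_comp, ← PMF.bind_pure_comp]
    rfl
  | ite c f g hc' hf hg =>
    have hrun : run P (simOracleV P M) (.ite c f g) v st =
        (run P (simOracleV P M) c v st).bind fun w =>
          (if w.1.toBool then run P (simOracleV P M) f v w.2.1
            else run P (simOracleV P M) g v w.2.1).bind fun w' =>
          PMF.pure (w'.1, w'.2.1, w.2.2 + w'.2.2 + 1) := by
      simp only [run, pmf_bind_eq, pmf_pure_eq]
      congr 1; funext w
      split_ifs <;> rfl
    rw [hrun] at hc ⊢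
    obtain ⟨h1, h2⟩ := cost_parts (g := fun _ w₂ => w₂.1) hc
    simp only [simRun, hc' h1, PMF.map_bind, PMF.bind_map, PMF.pure_map]
    refine bind_congr_support fun w hw => ?_
    have h3 := h2 w hw
    simp only [Function.comp_apply, Val.fst, Val.snd]
    cases hb : w.1.toBool with
    | true =>
      simp only [hb, if_true, cond_true] at h3 ⊢
      rw [hf h3, ← PMF.bind_pure_comp]
      rfl
    | false =>
      simp only [hb, Bool.false_eq_true, if_false, cond_false] at h3 ⊢
      rw [hg h3, ← PMF.bind_pure_comp]
      rfl
  | loop f hf =>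
    change ∀ w ∈ (iter (run P (simOracleV P M) f) v.fst.toNat v.snd st).support, w.2.2 ≤ M at hc
    change piter (simRun P M f) (min v.fst.toNat M) (.pair v.snd st) =
      (iter (run P (simOracleV P M) f) v.fst.toNat v.snd st).map _
    have hk : v.fst.toNat ≤ M := by
      obtain ⟨w, hw⟩ := (iter (run P (simOracleV P M) f) v.fst.toNat v.snd st).support_nonempty
      exact (le_of_mem_iter hw).trans (hc w hw)
    rw [min_eq_left hk]
    clear hk
    generalize v.fst.toNat = k at hc
    generalize v.snd = x at hc
    induction k generalizing x st with
    | zero => simp only [piter, iter, PMF.pure_map]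
    | succ k ih =>
      simp only [iter, pmf_bind_eq, pmf_pure_eq] at hc ⊢
      obtain ⟨h1, h2⟩ := cost_parts (g := fun _ w₂ => w₂.1) hc
      simp only [piter, hf h1, PMF.map_bind, PMF.bind_map, PMF.pure_map]
      refine bind_congr_support fun w hw => ?_
      simp only [Function.comp_apply, ih _ (h2 w hw), ← PMF.bind_pure_comp]
      rfl
  | call =>
    have h1 : (simV P M (.pair v st)).map (fun x => Val.pair x.fst x.snd) =
        simV P M (.pair v st) := by
      rw [simV, PMF.map_comp]
      rfl
    simp only [run, simRun, pmf_bind_eq, pmf_pure_eq, simOracleV, PMF.bind_map, PMF.map_bind,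
      Function.comp_def, PMF.pure_map]
    conv_lhs => rw [← h1, ← PMF.bind_pure_comp]
    rfl
  | rand => simp only [run, simRun, pmf_bind_eq, pmf_pure_eq, PMF.map_bind, PMF.pure_map]; rfl
  | frand => simp only [run, simRun, pmf_bind_eq, pmf_pure_eq, PMF.map_bind, PMF.pure_map]; rfl
  | _ => simp only [run, simRun, PMF.pure_map]; rfl

end SimRun

/-! ### The reduction -/

/-- The reduction as a randomized function. The argument consists of `(N, l)` and of the input of
a DSDP adversary: the guess is drawn below `l`, and the adversary `A` is run with the simulation. -/
def reduceV (A : Prog) (P : Params) (M : ℕ) (x : Val P.K) : PMF (Val P.K) :=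
  ((uniformBelow x.fst.snd.toNat).map .nat).bind fun r =>
    (simRun P M A (.pair
      (.ofList [x.snd.get 0, x.snd.get 1, x.snd.get 2, x.snd.get 3, x.fst.fst, x.snd.get 4])
      (.pair (.ofList [x.snd.get 3, x.fst.fst, x.snd.get 4, x.snd.get 5, x.snd.get 6, x.snd.get 7,
        r]) (.pair (.nat 0) (.pair (.nat 0) (.nat 0)))))).map fun y =>
      .ofBool (y.fst.toBool && hitV P M (y.snd.fst.get 6) y.snd.snd)

theorem RC.reduceV (A : Prog) : RC (reduceV A) := by
  have h1 : RC fun P M y => SkewDihedral.simRun P M A (.pair (.ofList [y.snd.snd.get 0,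
      y.snd.snd.get 1, y.snd.snd.get 2, y.snd.snd.get 3, y.snd.fst.fst, y.snd.snd.get 4])
      (.pair (.ofList [y.snd.snd.get 3, y.snd.fst.fst, y.snd.snd.get 4, y.snd.snd.get 5,
        y.snd.snd.get 6, y.snd.snd.get 7, y.fst]) (.pair (.nat 0) (.pair (.nat 0) (.nat 0))))) :=
    DC.rcomp inferInstance (RC.simRun A)
  exact RC.bind RC.rand (RC.map h1 (d := fun P M y =>
    .ofBool (y.fst.toBool && hitV P M (y.snd.fst.get 6) y.snd.snd)) inferInstance)

/-- The program of the reduction: it computes the bound `W k`, the number `N k` of parties and the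
range `l k` of the guess from the security parameter, which is the first item of its input. -/
theorem exists_reduction (A : Prog) (W N l : ℕ[X]) :
    ∃ (D : Prog) (T : ℕ[X]), ∀ (P : Params) (k : ℕ) (v : Val P.K), v.fst = .nat k →
      Evals P D v (reduceV A P (W.eval k) (.pair (.pair (.nat (N.eval k)) (.nat (l.eval k))) v))
        (T.eval k) := by
  have h1 : DC fun _ M v => .pair (.nat (W.eval M)) (.pair
      (.pair (.nat (N.eval M)) (.nat (l.eval M))) v) :=
    DC.pair (hd := NC.eval W) (he := DC.pair (hd := DC.pair (hd := NC.eval N) (he := NC.eval l))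
      (he := DC.arg))
  obtain ⟨p, T, hp⟩ := h1
  obtain ⟨p', T', hp'⟩ := RC.reduceV A
  refine ⟨.seq (.pair .fst .id) (.seq p p'), 1 + 1 + 1 + (T + T'.comp W + 1) + 1,
    fun P k v hv => ?_⟩
  have k1 : Evals P .fst v (PMF.pure (.nat k)) 1 := Evals.of_run fun _ _ _ => by
    rw [← hv]
    rfl
  have k2 : Evals P .id v (PMF.pure v) 1 := Evals.of_run fun _ _ _ => rfl
  have k3 := k1.pair k2
  rw [PMF.pure_bind, PMF.pure_map] at k3
  have k4 := (hp P k v).seq (g := p') (C' := T'.eval (W.eval k)) (e := fun w =>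
    reduceV A P (W.eval k) w.snd) (by
      intro w hw
      rw [PMF.mem_support_pure_iff] at hw
      subst hw
      exact hp' P _ _)
  rw [PMF.pure_bind] at k4
  have k5 := k3.seq (g := .seq p p') (e := fun _ => reduceV A P (W.eval k)
      (.pair (.pair (.nat (N.eval k)) (.nat (l.eval k))) v)) (by
    intro w hw
    rw [PMF.mem_support_pure_iff] at hw
    subst hw
    exact k4)
  rw [PMF.pure_bind] at k5
  simpa using k5

open Classical in
/-- The outcome of the reduction for a random input of a DSDP adversary. -/
theorem bind_reduceV (P : Params) {k M : ℕ} (N l : ℕ) (A : Prog) (b : Bool) (hM : P.n + P.n ≤ M)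
    (hA : ∀ h, ∀ (S : Type) (O : Oracle P S) (s : S),
      ∀ w ∈ (run P O A (amInput P k N h) s).support, w.2.2 ≤ M) :
    ((samplePublic P).bind fun h => (sampleSecret P).bind fun sk₁ =>
      (sampleSecret P).bind fun sk₂ => (sampleSecret P).bind fun sk₃ => (reduceV A P M (.pair (.pair (.nat N) (.nat l))
        (dsdpInput P k h (pubKey h sk₁) (pubKey h sk₂)
          (if b then pubKey h sk₃ else sharedKey sk₂ (pubKey h sk₁))))).map Val.toBool) =
    (uniformBelow l).bind (hitDist P k N A b) := by
  have h1 : ∀ h pk₁ pk₂ key, (reduceV A P M (.pair (.pair (.nat N) (.nat l))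
      (dsdpInput P k h pk₁ pk₂ key))).map Val.toBool = (uniformBelow l).bind fun r =>
        (interp (fun q g => (sampleSecret P).map fun sk =>
          simStep N h r pk₁ pk₂ key sk g (decQuery q)) (tree P A (amInput P k N h))
          (Game.init P)).map (fun w => w.1.toBool && decide (Hit r w.2.1)) := by
    intro h pk₁ pk₂ key
    have hb : (tree P A (amInput P k N h)).Bounded M :=
      (tree_callsLe A _).bounded (T := M) fun s w hw => by
        rw [← run_eq_interp] at hw
        exact hA h _ _ s w hw
    rw [reduceV, PMF.bind_map, PMF.map_bind]
    refine congrArg _ (funext fun r => ?_)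
    rw [interp_simOracleV hM h r N pk₁ pk₂ key hb le_rfl, ← run_eq_interp]
    have h2 := simRun_eq (M := M) A (v := amInput P k N h) (st := .pair (simEnv h pk₁ pk₂ key N r)
      (.pair (.nat 0) (.pair (.nat 0) (.nat 0)))) (hA h _ _ _)
    refine Eq.trans (congrArg (fun p => (PMF.map _ p).map Val.toBool) h2) ?_
    rw [PMF.map_comp, PMF.map_comp]
    refine congrArg (fun f => PMF.map f _) (funext fun w => ?_)
    exact Val.toBool_ofBool _
  simp only [h1]
  have h3 : ∀ h r, (amRun P k N A h b).map (fun w => w.1.toBool && decide (Hit r w.2.1)) =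
      (sampleSecret P).bind fun sk₁ => (sampleSecret P).bind fun sk₂ => (sampleSecret P).bind
      fun sk₃ => (interp (fun q g => (sampleSecret P).map fun sk =>
        simStep N h r (pubKey h sk₁) (pubKey h sk₂)
          (if b then pubKey h sk₃ else sharedKey sk₂ (pubKey h sk₁)) sk g (decQuery q))
        (tree P A (amInput P k N h)) (Game.init P)).map
          (fun w => w.1.toBool && decide (Hit r w.2.1)) := by
    intro h r
    rw [amRun, run_eq_interp]
    exact interp_sim N h b r (B := M) ((tree_callsLe A _).bounded (T := M) fun s w hw => by
      rw [← run_eq_interp] at hw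
      exact hA h _ _ s w hw)
  unfold hitDist
  simp only [h3]
  rw [PMF.bind_comm (uniformBelow l)]
  refine congrArg _ (funext fun h => ?_)
  rw [PMF.bind_comm (uniformBelow l)]
  refine congrArg _ (funext fun sk₁ => ?_)
  rw [PMF.bind_comm (uniformBelow l)]
  refine congrArg _ (funext fun sk₂ => ?_)
  rw [PMF.bind_comm (uniformBelow l)]

/-- The reduction, with equality. -/
theorem exists_two_skAdv_eq {pp : ℕ → Params} (hpp : PolySize pp) {N : ℕ[X]} {A : Prog}
    (hA : EfficientAM pp N A) {l : ℕ[X]} (hl : SessionBound pp N A l) :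
    ∃ D, EfficientDSDP pp D ∧
      ∀ k, 2 * skAdv pp N A k = ((l.eval k : ℕ) : ℝ) * dsdpAdv pp D k := by
  obtain ⟨T, hT⟩ := hA
  obtain ⟨T', hT'⟩ := hpp
  obtain ⟨D, Tl, hD⟩ := exists_reduction A (T' + T' + T) N l
  refine ⟨D, ⟨Tl, ?_⟩, fun k => two_skAdv_eq ⟨T, hT⟩ hl k fun b => ?_⟩
  · rintro k _ ⟨h, pk₁, pk₂, key, rfl⟩ S O s w hw
    exact (hD (pp k) k _ rfl S O s).2 w hw
  · have hM : (pp k).n + (pp k).n ≤ (T' + T' + T).eval k := by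
      have := hT' k
      rw [Polynomial.eval_add, Polynomial.eval_add]
      omega
    rw [← bind_reduceV (pp k) (N.eval k) (l.eval k) A b hM fun h S O s w hw =>
      (hT k _ ⟨h, rfl⟩ S O s w hw).trans (by
        rw [Polynomial.eval_add]
        exact Nat.le_add_left _ _)]
    unfold dsdpExp
    simp only [pmf_bind_eq, pmf_pure_eq]
    refine congrArg _ (funext fun h => congrArg _ (funext fun sk₁ => congrArg _ (funext fun sk₂ =>
      congrArg _ (funext fun sk₃ => ?_))))
    rw [← PMF.bind_pure_comp]
    exact (hD (pp k) k _ rfl).bind_run (noOracle (pp k)) () fun x => PMF.pure x.toBool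

theorem length_sessions_genStep (N : ℕ) (sk : P.R × P.R) (pk : P.R) (tk : P.R → P.R) (g : Game P)
    (Q : Query P) : (genStep N sk pk tk g Q).2.sessions.length ≤ g.sessions.length + 1 := by
  obtain ⟨F, -, h | ⟨t, -, h⟩⟩ := genStep_sessions N sk pk tk g Q <;> rw [h] <;> simp

/-- An interaction has at most as many sessions as the adversary makes queries. -/
theorem length_sessions_interp {P : Params} (N : ℕ) (h : P.R) (b : Bool) {t : Tree P.K} {B : ℕ}
    (ht : t.Bounded B) (g : Game P) {w : Val P.K × Game P × ℕ}
    (hw : w ∈ (interp (amOracle N h b) t g).support) :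
    w.2.1.sessions.length ≤ g.sessions.length + B := by
  induction t generalizing g B with
  | ret v c =>
    rw [interp, PMF.mem_support_pure_iff] at hw
    subst hw
    exact Nat.le_add_right _ _
  | samp d k ih =>
    obtain ⟨v, hv, hw⟩ := (PMF.mem_support_bind_iff _ _ _).1 hw
    exact ih v (ht v hv) g hw
  | call q k ih =>
    obtain ⟨r, hr, hw⟩ := (PMF.mem_support_bind_iff _ _ _).1 hw
    have h1 := ih _ (ht.2 _) _ hw
    have h2 : r.2.sessions.length ≤ g.sessions.length + 1 := by
      change r ∈ (answer N h b g (decQuery q)).support at hr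
      rw [answer_eq] at hr
      obtain ⟨sk, -, rfl⟩ := (PMF.mem_support_map_iff _ _ _).1 hr
      exact length_sessions_genStep _ _ _ _ _ _
    have := ht.1
    omega

/-- An efficient adversary invokes at most polynomially many sessions. -/
theorem exists_sessionBound {pp : ℕ → Params} {N : ℕ[X]} {A : Prog} (hA : EfficientAM pp N A) :
    ∃ l, SessionBound pp N A l := by
  obtain ⟨T, hT⟩ := hA
  refine ⟨T, fun k h _ b w hw => (List.length_filter_le _ _).trans ?_⟩
  rw [amRun, run_eq_interp] at hw
  have := length_sessions_interp (N.eval k) h b (B := T.eval k)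
    ((tree_callsLe A _).bounded (T := T.eval k) fun s w hw => by
      rw [← run_eq_interp] at hw
      exact hT k _ ⟨h, rfl⟩ _ _ s w hw) _ hw
  simpa [Game.init] using this

end SkewDihedral

theorem mainTheorem1 (pp : ℕ → SkewDihedral.Params) (hpp : SkewDihedral.PolySize pp) (N : ℕ[X]) :
    (SkewDihedral.DSDPAssumption pp → SkewDihedral.SessionKeySecure pp N) ∧
    ∀ A, SkewDihedral.EfficientAM pp N A → ∀ l : ℕ[X], SkewDihedral.SessionBound pp N A l →
      ∃ D, SkewDihedral.EfficientDSDP pp D ∧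
        ∀ k, 2 * SkewDihedral.skAdv pp N A k ≤ ((l.eval k : ℕ) : ℝ) * SkewDihedral.dsdpAdv pp D k := by
  refine ⟨fun hD => ⟨fun k => SkewDihedral.matchingKeysAgree _, fun A hA => ?_⟩,
    fun A hA l hl => ?_⟩
  · obtain ⟨l, hl⟩ := SkewDihedral.exists_sessionBound hA
    obtain ⟨D, hDe, h⟩ := SkewDihedral.exists_two_skAdv_eq hpp hA hl
    have h1 := (hD D hDe).polynomial_mul (l.map (Nat.castRingHom ℝ))
    have h2 := h1.const_mul (1 / 2)
    refine h2.congr fun k => ?_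
    have h3 : (l.map (Nat.castRingHom ℝ)).eval (k : ℝ) = ((l.eval k : ℕ) : ℝ) := by
      rw [Polynomial.eval_natCast_map]
      rfl
    rw [h3, ← h k]
    ring
  · obtain ⟨D, hDe, h⟩ := SkewDihedral.exists_two_skAdv_eq hpp hA hl
    exact ⟨D, hDe, fun k => (h k).le⟩

end
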